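/- **Setting.** Let $T\ge 1$, let $\mathcal X$ be a measurable space with a $\sigma$-finite reference measure $dx$ (Lebesgue or counting measure, for instance), let $\Theta$ be a parameter set, and let $y_1,\dots,y_T$ be fixed observations. A state space model is given by finite, strictly positive, measurable densities $f_1(x\mid\theta)$, $f_t(x\mid x',\theta)$ ($2\le t\le T$) of the states and $g_t(y\mid x,\theta)$ of the observations. Put $$p(y_{1:T},x_{1:T}\mid\theta)=g_1(y_1\mid x_1,\theta)f_1(x_1\mid\theta)\prod_{t=2}^Tg_t(y_t\mid x_t,\theta)f_t(x_t\mid x_{t-1},\theta),$$ let $p(y_{1:T}\mid\theta)=\int p(y_{1:T},x_{1:T}\mid\theta)\,dx_{1:T}$ be finite for every $\theta$ (it is automatically positive), and let $\pi(x_{1:T}\mid\theta)=p(y_{1:T},x_{1:T}\mid\theta)/p(y_{1:T}\mid\theta)$ be the smoothing posterior density. Let $N_t\ge1$ $(1\le t\le T)$ and $C_t\ge1$ $(1\le t\le T-1)$ be integers, and let $M_1(x\mid y_1,\theta)$, $M_t(x\mid y_t,x',\theta)$ be measurable probability densities in $x$. From now on $\theta$ is suppressed. **Variables.** $u=(\bar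 x_{1:T},\bar a_{1:T-1},b_{1:T},\tilde x_{1:T-1})$ with $\bar x_t=(x_t^i)_{i\le N_t}$, $x_t^i\in\mathcal X$; $\bar a_t=(a_t^i)_{i\le N_{t+1}}$, $a_t^i\in\{1,\dots,N_t\}$; $b_t\in\{1,\dots,N_t\}$; $\tilde x_t=(\tilde x_t^j)_{j\le C_t}$, $\tilde x_t^j\in\mathcal X$. A superscript $-b_t$ means that the particle $b_t$ of time $t$ is left out. Weights: $w_1^i=g_1(y_1\mid x_1^i)f_1(x_1^i)/M_1(x_1^i\mid y_1)$, and for $t\ge2$ $$w_t^i=\frac{g_t(y_t\mid x_t^i)\,f_t(x_t^i\mid x_{t-1}^{a_{t-1}^i})}{M_t(x_t^i\mid y_t,x_{t-1}^{a_{t-1}^i})},\qquad W_t^i=\frac{w_t^i}{\sum_jw_t^j}.$$ Write $x^\star_t=\tilde x_t^{C_t}$ for $t<T$ and $x^\star_T=x_T^{b_T}$. **Kernels.** For $t<T$ let $K_t(x,dx')$ be Markov transition kernels on $\mathcal X$ that may depend (jointly measurably) on $\bar x_{1:t-1}$, $x_t^{-b_t}$, $x^\star_{t+1}$, $\bar a_{1:t-2}$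 and $a_{t-1}^{-b_t}$ (and on $\theta$). Let $S_1(x)=f_1(x)$ and $S_t(x)=\sum_iw_{t-1}^if_t(x\mid x_{t-1}^i)$ for $t\ge2$, and let $\hat p_t(dx)$ be the probability distribution with density proportional to $g_t(y_t\mid x)\,f_{t+1}(x^\star_{t+1}\mid x)\,S_t(x)$ (no condition is imposed where this is not integrable). **Proposal law $\Psi$.** $\Psi$ is the law of $u$ generated as follows. Draw $x_1^i\sim M_1(\cdot\mid y_1)$ independently for $i\le N_1$; for $t=2,\dots,T$ draw independently $a_{t-1}^i$ with probabilities $W_{t-1}$ and then $x_t^i\sim M_t(\cdot\mid y_t,x_{t-1}^{a_{t-1}^i})$, $i\le N_t$. Draw $b_T$ with probabilities $W_T$. For $t=T-1,\dots,1$ draw $b_t$ with probabilities $\widetilde W_t^i\propto w_t^if_{t+1}(x^\star_{t+1}\mid x_t^i)$, put $\tilde x_t^0=x_t^{b_t}$, and draw $\tilde x_t^j\sim K_t(\tilde x_t^{j-1},\cdot)$ for $j=1,\dots,C_t$. Let $\psi(\bar x_{1:T},\bar a_{1:T-1})=\prod_iM_1(x_1^i\mid y_1)\prod_{t=2}^T\prod_{i\le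 N_t}W_{t-1}^{a_{t-1}^i}M_t(x_t^i\mid y_t,x_{t-1}^{a_{t-1}^i})$. **Extended target $\Pi$.** With $\tilde x_t^0=x_t^{b_t}$, $$\Pi(du)=\frac{\pi(x^\star_{1:T})}{N_T}\cdot\frac{\psi(\bar x_{1:T},\bar a_{1:T-1})}{M_1(x_1^{b_1}\mid y_1)\prod_{t=2}^TW_{t-1}^{a_{t-1}^{b_t}}M_t(x_t^{b_t}\mid y_t,x_{t-1}^{a_{t-1}^{b_t}})}\cdot\prod_{t=2}^T\frac{w_{t-1}^{a_{t-1}^{b_t}}f_t(x_t^{b_t}\mid x_{t-1}^{a_{t-1}^{b_t}})}{\sum_iw_{t-1}^if_t(x_t^{b_t}\mid x_{t-1}^i)}\cdot\prod_{t=1}^{T-1}\frac1{N_t}\;\times\;dx^\star_{1:T}\prod_{t=1}^Tdx_t^{-b_t}\prod_{t=1}^{T-1}\prod_{j=1}^{C_t}K_t(\tilde x_t^{j},d\tilde x_t^{j-1}),$$ with counting measure in $\bar a_{1:T-1}$ and $b_{1:T}$, the kernels being composed in the order $t=1,\dots,T-1$. **Lemma.** Suppose that $M_1,M_2,\dots,M_T$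 are finite and strictly positive and that, for every $\theta\in\Theta$, every $t<T$ and all values of the conditioning variables, detailed balance holds: $\hat p_t(dx)K_t(x,dx')=\hat p_t(dx')K_t(x',dx)$. Then for every $\theta\in\Theta$: (i) under $\Pi$ the vector $(\tilde x_1^{C_1},\dots,\tilde x_{T-1}^{C_{T-1}},x_T^{b_T},b_T)$ has distribution $\pi(x_{1:T}\mid\theta)\,dx_{1:T}\otimes\mathrm{Uniform}\{1,\dots,N_T\}$; (ii) $\Pi$ and $\Psi$ are mutually absolutely continuous; (iii) a version of the Radon–Nikodym derivative is $$\frac{d\Pi}{d\Psi}(u)=\frac{\prod_{t=1}^T\Bigl\{\frac1{N_t}\sum_{i=1}^{N_t}w_t^i\Bigr\}}{p(y_{1:T}\mid\theta)}.$$ -/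

import Mathlib

open MeasureTheory ProbabilityTheory
open scoped NNReal ENNReal

noncomputable section

namespace PMCMC

/-! Times `1, …, T` are written `0, …, n`, with `T = n + 1`: the elements of `Fin (n + 1)`.
An element `s : Fin n` stands for the time `s.castSucc` (not the final one), or for the
transition from time `s.castSucc` to time `s.succ`. -/

/-- A state space model with `n + 1` time points: the initial density `f₁`, the transition
densities `f s x z` (density at `z` of the state at time `s.succ`, given the state `x` at time
`s.castSucc`), and the observation densities `g t x y`; all of them are finite and positive.
`lam` and `nu` are the reference measures on the state space and on the observation space. -/
structure StateSpaceModel (n : ℕ) (X Y : Type*) [MeasurableSpace X] [MeasurableSpace Y]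
    (lam : Measure X) (nu : Measure Y) where
  f₁ : X → ℝ≥0
  f : Fin n → X → X → ℝ≥0
  g : Fin (n + 1) → X → Y → ℝ≥0
  measurable_f₁ : Measurable f₁
  measurable_f : ∀ s, Measurable (Function.uncurry (f s))
  measurable_g : ∀ t, Measurable (Function.uncurry (g t))
  f₁_pos : ∀ x, 0 < f₁ x
  f_pos : ∀ s x z, 0 < f s x z
  g_pos : ∀ t x y, 0 < g t x y
  lintegral_f₁ : ∫⁻ x, f₁ x ∂lam = 1
  lintegral_f : ∀ s x, ∫⁻ z, f s x z ∂lam = 1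
  lintegral_g : ∀ t x, ∫⁻ y, g t x y ∂nu = 1

/-- Importance densities of the particle filter: `M₁ y x` at the first time, and `M s y x z`,
the density at `z` given the observation `y` at time `s.succ` and the state `x` at time
`s.castSucc`. -/
structure ImportanceDensities (n : ℕ) (X Y : Type*) [MeasurableSpace X]
    (lam : Measure X) where
  M₁ : Y → X → ℝ≥0
  M : Fin n → Y → X → X → ℝ≥0
  measurable_M₁ : ∀ y, Measurable (M₁ y)
  measurable_M : ∀ s y, Measurable (Function.uncurry (M s y))
  lintegral_M₁ : ∀ y, ∫⁻ x, M₁ y x ∂lam = 1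
  lintegral_M : ∀ s y x, ∫⁻ z, M s y x z ∂lam = 1

/-- The importance densities are strictly positive (they are finite by their type). -/
def ImportanceDensities.Positive {n : ℕ} {X Y : Type*} [MeasurableSpace X] {lam : Measure X}
    (q : ImportanceDensities n X Y lam) : Prop :=
  (∀ y x, 0 < q.M₁ y x) ∧ ∀ s y x z, 0 < q.M s y x z

/-! ### The extended space -/

section Spaces

variable {n : ℕ} (N : Fin (n + 1) → ℕ) (C : Fin n → ℕ) (X : Type*)

/-- The particles: `x t i` is the state of particle `i` at time `t`. -/
abbrev States := ∀ t : Fin (n + 1), Fin (N t) → X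

/-- The parent indices: `a s i` is the index, at time `s.castSucc`, of the parent of particle
`i` of time `s.succ`. -/
abbrev Parents := ∀ s : Fin n, Fin (N s.succ) → Fin (N s.castSucc)

/-- The selected indices `b t`. -/
abbrev Indices := ∀ t : Fin (n + 1), Fin (N t)

/-- The states generated by the Markov chain runs: run number `s` takes place at time
`s.castSucc` and has length `C s`. -/
abbrev Generated := ∀ s : Fin n, Fin (C s) → X

/-- The extended space of all variables `(x, a, b, x̃)`. -/
abbrev ExtSpace := States N X × Parents N × Indices N × Generated C X

/-- What the transition kernel at time `s.castSucc` may depend on, besides the current state,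
when the selected index is `b`: the particles at all earlier times and those at time
`s.castSucc` other than `b`; the parent indices of all these particles; and the next selected
state. -/
abbrev Conditioning (s : Fin n) (b : Fin (N s.castSucc)) :=
  ({p : Σ t : Fin (n + 1), Fin (N t) // p.1 ≤ s.castSucc ∧ p ≠ ⟨s.castSucc, b⟩} → X) ×
  ((p : {p : Σ r : Fin n, Fin (N r.succ) //
      p.1.succ ≤ s.castSucc ∧
        (⟨p.1.succ, p.2⟩ : Σ t : Fin (n + 1), Fin (N t)) ≠ ⟨s.castSucc, b⟩}) →
    Fin (N p.1.1.castSucc)) ×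
  X

/-- The Markov chain transition kernels `K s b (c, x) dx'`. -/
abbrev TransitionKernels [MeasurableSpace X] :=
  ∀ (s : Fin n) (b : Fin (N s.castSucc)), Kernel (Conditioning N X s b × X) X

end Spaces

section Variables

variable {n : ℕ} {N : Fin (n + 1) → ℕ} {C : Fin n → ℕ} {X : Type*}

/-- The conditioning variables read off from a full particle system and a next state `z`. -/
def conditioning (x : States N X) (a : Parents N) (z : X) (s : Fin n)
    (b : Fin (N s.castSucc)) : Conditioning N X s b :=
  (fun p => x p.1.1 p.1.2, fun p => a p.1.1 p.1.2, z)

/-- The path of the Markov chain run at time `s.castSucc`: position `0` is the starting point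
`x_s^{b_s}`, positions `1, …, C s` are the generated states. -/
def path (u : ExtSpace N C X) (s : Fin n) : Fin (C s + 1) → X :=
  Fin.cons (u.1 s.castSucc (u.2.2.1 s.castSucc)) (u.2.2.2 s)

/-- The selected trajectory: the last state of the run at each time but the final one, and the
selected particle `x_T^{b_T}` at the final time. -/
def selected (u : ExtSpace N C X) : Fin (n + 1) → X :=
  Fin.snoc (α := fun _ => X) (fun s : Fin n => path u s (Fin.last (C s)))
    (u.1 (Fin.last n) (u.2.2.1 (Fin.last n)))

/-! Overwriting a single coordinate of a point of the extended space. -/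

def setState (t : Fin (n + 1)) (i : Fin (N t)) (u : ExtSpace N C X) (z : X) :
    ExtSpace N C X :=
  (Function.update u.1 t (Function.update (u.1 t) i z), u.2)

def setParent (s : Fin n) (i : Fin (N s.succ)) (u : ExtSpace N C X)
    (k : Fin (N s.castSucc)) : ExtSpace N C X :=
  (u.1, Function.update u.2.1 s (Function.update (u.2.1 s) i k), u.2.2)

def setIndex (t : Fin (n + 1)) (u : ExtSpace N C X) (k : Fin (N t)) : ExtSpace N C X :=
  (u.1, u.2.1, Function.update u.2.2.1 t k, u.2.2.2)

def setGenerated (s : Fin n) (j : Fin (C s)) (u : ExtSpace N C X) (z : X) :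
    ExtSpace N C X :=
  (u.1, u.2.1, u.2.2.1, Function.update u.2.2.2 s (Function.update (u.2.2.2 s) j z))

/-- Overwrites position `j` of the path of the run at time `s.castSucc`. -/
def setPath (s : Fin n) (j : Fin (C s + 1)) (u : ExtSpace N C X) (z : X) : ExtSpace N C X :=
  Fin.cases (motive := fun _ => ExtSpace N C X)
    (setState s.castSucc (u.2.2.1 s.castSucc) u z)
    (fun k => setGenerated s k u z) j

end Variables

/-! ### Densities and weights -/

section Weights

variable {n : ℕ} {N : Fin (n + 1) → ℕ} {X Y : Type*} [MeasurableSpace X] [MeasurableSpace Y]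
  {lam : Measure X} {nu : Measure Y}
  (m : StateSpaceModel n X Y lam nu) (q : ImportanceDensities n X Y lam) (y : Fin (n + 1) → Y)

/-- The joint density `p(y_{1:T}, x_{1:T})`. -/
def jointDensity (z : Fin (n + 1) → X) : ℝ≥0 :=
  m.g 0 (z 0) (y 0) * m.f₁ (z 0) *
    ∏ s : Fin n, m.g s.succ (z s.succ) (y s.succ) * m.f s (z s.castSucc) (z s.succ)

/-- The marginal density `p(y_{1:T})` of the observations. -/
def evidence : ℝ≥0∞ :=
  ∫⁻ z, jointDensity m y z ∂(Measure.pi fun _ : Fin (n + 1) => lam)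

/-- The smoothing posterior density `p(x_{1:T} | y_{1:T})`. -/
def posteriorDensity (z : Fin (n + 1) → X) : ℝ≥0∞ :=
  jointDensity m y z / evidence m y

/-- The unnormalised weights `w_t^i`. -/
def weight (x : States N X) (a : Parents N) (t : Fin (n + 1)) : Fin (N t) → ℝ≥0 :=
  Fin.cases (motive := fun t => Fin (N t) → ℝ≥0)
    (fun i => m.g 0 (x 0 i) (y 0) * m.f₁ (x 0 i) / q.M₁ (y 0) (x 0 i))
    (fun s i => m.g s.succ (x s.succ i) (y s.succ) *
      m.f s (x s.castSucc (a s i)) (x s.succ i) /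
        q.M s (y s.succ) (x s.castSucc (a s i)) (x s.succ i)) t

/-- Normalisation of finitely many weights. -/
def normalize {k : ℕ} (v : Fin k → ℝ≥0) (i : Fin k) : ℝ≥0 := v i / ∑ j, v j

/-- The backward weights at time `s.castSucc`, when the next selected state is `z`. -/
def backwardWeight (x : States N X) (a : Parents N) (z : X) (s : Fin n)
    (i : Fin (N s.castSucc)) : ℝ≥0 :=
  weight m q y x a s.castSucc i * m.f s (x s.castSucc i) z

/-- `f₁ z` at the first time and `∑ i, w_{t-1}^i f_t(z | x_{t-1}^i)` at later times. -/
def predictive (x : States N X) (a : Parents N) (t : Fin (n + 1)) (z : X) : ℝ≥0 :=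
  Fin.cases (motive := fun _ => ℝ≥0) (m.f₁ z)
    (fun s => ∑ i, backwardWeight m q y x a z s i) t

/-- The unnormalised target density of the Markov chain run at time `s.castSucc`, when the next
selected state is `z`. -/
def targetDensity (x : States N X) (a : Parents N) (z : X) (s : Fin n) (x' : X) : ℝ≥0 :=
  m.g s.castSucc x' (y s.castSucc) * m.f s x' z * predictive m q y x a s.castSucc x'

/-- The target distribution `p̂(dx_t | …)` of the Markov chain run at time `s.castSucc`. -/
def target (x : States N X) (a : Parents N) (z : X) (s : Fin n) : Measure X :=
  lam.withDensity fun x' => (targetDensity m q y x a z s x' : ℝ≥0∞) /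
    ∫⁻ x'', targetDensity m q y x a z s x'' ∂lam

/-- Detailed balance of the transition kernels with respect to their targets. -/
def DetailedBalance (K : TransitionKernels N X) : Prop :=
  ∀ (s : Fin n) (b : Fin (N s.castSucc)) (x : States N X) (a : Parents N) (z : X),
    ((K s b).sectR (conditioning x a z s b)).IsReversible (target m q y x a z s)

/-- The joint density of all particles and parent indices in the particle filter. -/
def filterDensity (x : States N X) (a : Parents N) : ℝ≥0 :=
  (∏ i, q.M₁ (y 0) (x 0 i)) *
    ∏ s : Fin n, (∏ i, normalize (weight m q y x a s.castSucc) (a s i)) *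
      ∏ i, q.M s (y s.succ) (x s.castSucc (a s i)) (x s.succ i)

/-- The factor of `filterDensity` that belongs to the particles with the indices `b`. -/
def selectedFilterDensity (x : States N X) (a : Parents N) (b : Indices N) : ℝ≥0 :=
  q.M₁ (y 0) (x 0 (b 0)) *
    ∏ s : Fin n, normalize (weight m q y x a s.castSucc) (a s (b s.succ)) *
      q.M s (y s.succ) (x s.castSucc (a s (b s.succ))) (x s.succ (b s.succ))

end Weights

/-! ### Successive sampling -/

section Sampling

/-- Performs the given steps one after the other; a step `κ` at the point `u` replaces `u` by a
draw from `κ u`. -/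
def run {U : Type*} [MeasurableSpace U] (steps : List (U → Measure U)) (μ : Measure U) :
    Measure U :=
  steps.foldl Measure.bind μ

/-- The step that draws a value from `μ u` and stores it by `set`. -/
def assign {U α : Type*} [MeasurableSpace U] [MeasurableSpace α] (μ : U → Measure α)
    (set : U → α → U) : U → Measure U :=
  fun u => (μ u).map (set u)

/-- The distribution on `Fin k` with probabilities `v`. -/
def categorical {k : ℕ} (v : Fin k → ℝ≥0) : Measure (Fin k) :=
  ∑ i, (v i : ℝ≥0∞) • Measure.dirac i

variable {n : ℕ} {N : Fin (n + 1) → ℕ} {C : Fin n → ℕ} {X Y : Type*}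
  [MeasurableSpace X] [MeasurableSpace Y] {lam : Measure X} {nu : Measure Y}
  (m : StateSpaceModel n X Y lam nu) (q : ImportanceDensities n X Y lam) (y : Fin (n + 1) → Y)
  (K : TransitionKernels N X)

/-- The transition kernel at time `s.castSucc`, started at `x` and conditioned on `u`. -/
def transition (s : Fin n) (x : X) (u : ExtSpace N C X) : Measure X :=
  K s (u.2.2.1 s.castSucc)
    (conditioning u.1 u.2.1 (selected u s.succ) s (u.2.2.1 s.castSucc), x)

/-- Sequential Monte Carlo: draw the particles of the first time; then, for each later time,
draw the parents and then the particles. -/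
def filterSteps : List (ExtSpace N C X → Measure (ExtSpace N C X)) :=
  ((List.finRange (N 0)).map fun i =>
    assign (fun _ => lam.withDensity fun z => (q.M₁ (y 0) z : ℝ≥0∞)) (setState 0 i)) ++
  (List.finRange n).flatMap fun s =>
    ((List.finRange (N s.succ)).map fun i =>
      assign (fun u => categorical (normalize (weight m q y u.1 u.2.1 s.castSucc)))
        (setParent s i)) ++
    ((List.finRange (N s.succ)).map fun i =>
      assign (fun u => lam.withDensity fun z =>
          (q.M s (y s.succ) (u.1 s.castSucc (u.2.1 s i)) z : ℝ≥0∞))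
        (setState s.succ i))

/-- Backward simulation: draw the final index; then, backwards in time, draw an index by the
backward weights and run the Markov chain from the particle with that index. -/
def backwardSteps : List (ExtSpace N C X → Measure (ExtSpace N C X)) :=
  assign (fun u => categorical (normalize (weight m q y u.1 u.2.1 (Fin.last n))))
    (setIndex (Fin.last n)) ::
  (List.finRange n).reverse.flatMap fun s =>
    assign (fun u =>
        categorical (normalize (backwardWeight m q y u.1 u.2.1 (selected u s.succ) s)))
      (setIndex s.castSucc) ::
    (List.finRange (C s)).map fun j =>
      assign (fun u => transition K s (path u s j.castSucc) u) (setPath s j.succ)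

/-- The law `Ψ` of the variables that are generated by sequential Monte Carlo followed by
backward simulation. The point `u₀` is the initial content of the memory; each variable is drawn
before it is used. -/
def proposalLaw (u₀ : ExtSpace N C X) : Measure (ExtSpace N C X) :=
  run (filterSteps m q y ++ backwardSteps m q y K) (Measure.dirac u₀)

/-- The steps which build the measure
`∏_{t<T} dx̃_t^{C_t} dx_T^{b_T} ∏_t dx_t^{-b_t} ∏_{t<T} {∏_j K_t(x̃_t^j, dx̃_t^{j-1}) K_t(x̃_t^1, dx_t^{b_t})}`
(times counting measure in `a` and `b`): the Markov chain runs are reversed in time. -/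
def reversedSteps (lam : Measure X) (K : TransitionKernels N X) :
    List (ExtSpace N C X → Measure (ExtSpace N C X)) :=
  ((List.finRange (n + 1)).map fun t => assign (fun _ => Measure.count) (setIndex t)) ++
  ((List.finRange n).flatMap fun s => (List.finRange (N s.succ)).map fun i =>
    assign (fun _ => Measure.count) (setParent s i)) ++
  ((List.finRange n).map fun s => assign (fun _ => lam) (setPath s (Fin.last (C s)))) ++
  [assign (fun _ => lam) fun u => setState (Fin.last n) (u.2.2.1 (Fin.last n)) u] ++
  ((List.finRange (n + 1)).flatMap fun t => (List.finRange (N t)).map fun i =>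
    fun u => if i = u.2.2.1 t then Measure.dirac u else assign (fun _ => lam) (setState t i) u) ++
  (List.finRange n).flatMap fun s => (List.finRange (C s)).reverse.map fun j =>
    assign (fun u => transition K s (path u s j.succ) u) (setPath s j.castSucc)

/-- The density factors in the definition of the target `Π`. -/
def extendedDensity (u : ExtSpace N C X) : ℝ≥0∞ :=
  posteriorDensity m y (selected u) * (N (Fin.last n) : ℝ≥0∞)⁻¹ *
  ((filterDensity m q y u.1 u.2.1 / selectedFilterDensity m q y u.1 u.2.1 u.2.2.1 : ℝ≥0) : ℝ≥0∞) *
  ((∏ s : Fin n, normalize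
      (backwardWeight m q y u.1 u.2.1 (u.1 s.succ (u.2.2.1 s.succ)) s)
      (u.2.1 s (u.2.2.1 s.succ)) : ℝ≥0) : ℝ≥0∞) *
  ∏ s : Fin n, (N s.castSucc : ℝ≥0∞)⁻¹

/-- The target distribution `Π` on the extended space. -/
def extendedTarget (u₀ : ExtSpace N C X) : Measure (ExtSpace N C X) :=
  (run (reversedSteps lam K) (Measure.dirac u₀)).withDensity (extendedDensity m q y)

/-- The density `∏_t {N_t⁻¹ ∑_i w_t^i} / p(y_{1:T})`. -/
def densityRatio (u : ExtSpace N C X) : ℝ≥0∞ :=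
  ((∏ t : Fin (n + 1), (∑ i, weight m q y u.1 u.2.1 t i) * (N t : ℝ≥0)⁻¹ : ℝ≥0) : ℝ≥0∞) /
    evidence m y

end Sampling

end PMCMC

end

open PMCMC

noncomputable section

namespace PMCMC

set_option linter.unusedSectionVars false

/-! ### Products of lists in a noncommutative monoid -/

section ListProducts

variable {M ι : Type*} [Monoid M]

/-! A step `S` acts on measurable functions by sending `F` to `u ↦ ∫ F dS(u)`. Performing steps in
succession becomes composition of such operators, the first step being the outermost factor
(`lintegral_run`). Drawing from a density is integration against the reference measure followed by
multiplication with the density (`assignOp_withDensity`). Thus the proposal law and the extended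
target both become words in a noncommutative monoid, and the proof is a calculation with these
words. Two draws commute if they write different variables and neither reads what the other writes
(Tonelli, `commute_assignOp`); a weight commutes with a draw that changes nothing the weight reads.
A product of pairs `f i * g i` splits into two products as soon as each `g i` commutes with the
later `f j`, which is the rule used throughout.

Density. In the proposal every density reads only variables that are already drawn, so all densities
move to the right. What remains are sums over indices and parents, integrals over all particles, the
forward runs from the last to the first, and one density (`prod_stepOp_proposal`). The extended
target has the same shape (`prod_stepOp_reversedSteps`), except that the state integrated at each
non-final time is the end of the run instead of the selected particle, and the runs go backwards.
Detailed balance bridges the gap: integrating the start of a run against its unnormalised target and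
running forward is the same as integrating its end against that target and running backward
(`pathOp_forwardRunOp`). The runs are exchanged one after the other, starting with the latest; the
required commutations hold because a kernel reads neither the selected particle of its time other
than as the current state, nor that particle's parent (`prod_exchange`, `prod_target_exchange`). The
exchange replaces the target densities at the starts by those at the ends. A pointwise identity
(`density_identity`, `proposalFunction_mul_ratioFunction`) shows that this change, together with the
claimed ratio, is exactly the difference between the two densities: the normalisers of the backward
and parent probabilities are predictive densities, and everything else cancels.

Exceptional points. Where a target has infinite mass, the detailed balance hypothesis is void. Such
points are negligible: the model densities are positive, so an infinite inner integral on a set of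
positive measure would make the evidence infinite (`ae_smoothingIntegral_succ`), and the integrals
standing to the left of the exchanged run already average over all variables that determine this
mass up to finite factors (`exists_weigh_eq`).

Marginal. The density of the extended target is a function of the selected trajectory and final
index times a conditional density. The latter is normalised time by time, as in a conditional
particle filter: the non-selected parents and particles are drawn, the reversed run then produces
the selected particle, and finally its parent is drawn with backward probabilities
(`conditional_mem_fixOne`). Integrating these variables out leaves the posterior, a uniform final
index, and factors that cancel the sums over the other indices (`map_selected_extendedTarget`).

Mutual absolute continuity follows because the density ratio vanishes nowhere. -/

theorem list_prod_map_mul {f g : ι → M} {l : List ι}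
    (h : l.Pairwise fun i j => Commute (g i) (f j)) :
    (l.map fun i => f i * g i).prod = (l.map f).prod * (l.map g).prod := by
  induction l with
  | nil => simp
  | cons i l ih =>
    rw [List.pairwise_cons] at h
    have hc : Commute (g i) (l.map f).prod :=
      Commute.list_prod_right _ _ (by simpa using fun j hj => h.1 j hj)
    simp only [List.map_cons, List.prod_cons, ih h.2]
    rw [mul_assoc, mul_assoc, ← mul_assoc (g i), hc.eq, mul_assoc]

theorem commute_list_prod {f : ι → M} {l : List ι} {y : M} (h : ∀ i ∈ l, Commute y (f i)) :
    Commute y (l.map f).prod :=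
  Commute.list_prod_right _ _ (by simpa using h)

theorem list_prod_commute {f : ι → M} {l : List ι} {y : M} (h : ∀ i ∈ l, Commute (f i) y) :
    Commute (l.map f).prod y :=
  Commute.list_prod_left _ _ (by simpa using h)

theorem list_prod_commute_list_prod {κ : Type*} {f : ι → M} {g : κ → M} {l : List ι} {l' : List κ}
    (h : ∀ i ∈ l, ∀ j ∈ l', Commute (f i) (g j)) :
    Commute (l.map f).prod (l'.map g).prod :=
  list_prod_commute fun i hi => commute_list_prod fun j hj => h i hi j hj

theorem list_prod_perm {f : ι → M} {l l' : List ι} (hl : l.Perm l')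
    (h : l.Pairwise fun i j => Commute (f i) (f j)) :
    (l.map f).prod = (l'.map f).prod :=
  (hl.map f).prod_eq' (List.pairwise_map.2 h)

theorem pairwise_finRange {k : ℕ} {r : Fin k → Fin k → Prop} (h : ∀ i j, i < j → r i j) :
    (List.finRange k).Pairwise r :=
  (List.pairwise_lt_finRange k).imp (h _ _)

theorem pairwise_finRange_reverse {k : ℕ} {r : Fin k → Fin k → Prop} (h : ∀ i j, j < i → r i j) :
    (List.finRange k).reverse.Pairwise r :=
  List.pairwise_reverse.2 (pairwise_finRange fun i j hij => h j i hij)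

theorem prod_flatMap (f : ι → List M) (l : List ι) :
    (l.flatMap f).prod = (l.map fun i => (f i).prod).prod := by
  induction l with
  | nil => simp
  | cons i l ih => simp [ih]

end ListProducts

/-! ### Operators on measurable functions -/

section Operators

variable {U α β : Type*} [MeasurableSpace U] [MeasurableSpace α] [MeasurableSpace β]

/-- The measurable functions with values in `ℝ≥0∞`. -/
def measurableFunctions (U : Type*) [MeasurableSpace U] : Submonoid (U → ℝ≥0∞) where
  carrier := {F | Measurable F}
  mul_mem' := Measurable.mul
  one_mem' := measurable_one

/-- Operators on measurable functions. -/
structure Op (U : Type*) [MeasurableSpace U] where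
  /-- The image of a function. -/
  apply : measurableFunctions U → measurableFunctions U

instance : Monoid (Op U) where
  one := ⟨id⟩
  mul O O' := ⟨O.apply ∘ O'.apply⟩
  one_mul _ := rfl
  mul_one _ := rfl
  mul_assoc _ _ _ := rfl

/-- The value of the function `O F` at `u`. -/
def Op.eval (O : Op U) (F : measurableFunctions U) (u : U) : ℝ≥0∞ := (O.apply F).1 u

theorem Op.measurable_eval (O : Op U) (F : measurableFunctions U) : Measurable (O.eval F) :=
  (O.apply F).2

theorem Op.ext {O O' : Op U} (h : ∀ F u, O.eval F u = O'.eval F u) : O = O' :=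
  congrArg Op.mk (funext fun F => Subtype.ext (funext fun u => h F u))

theorem Op.eval_mul (O O' : Op U) (F : measurableFunctions U) (u : U) :
    (O * O').eval F u = O.eval (O'.apply F) u := rfl

@[simp] theorem Op.eval_one (F : measurableFunctions U) (u : U) : (1 : Op U).eval F u = F.1 u := rfl

/-- Multiplication by a measurable function. -/
def weigh : measurableFunctions U →* Op U where
  toFun d := ⟨fun F => d * F⟩
  map_one' := congrArg Op.mk (funext fun F => one_mul F)
  map_mul' d e := congrArg Op.mk (funext fun F => mul_assoc d e F)

theorem eval_weigh (d F : measurableFunctions U) (u : U) : (weigh d).eval F u = d.1 u * F.1 u := rfl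

theorem commute_weigh (d e : measurableFunctions U) : Commute (weigh d) (weigh e) :=
  (Commute.all d e).map weigh

theorem measurable_uncurry_left {set : U → α → U} (hset : Measurable (Function.uncurry set))
    (u : U) : Measurable (set u) :=
  hset.comp measurable_prodMk_left

/-- The operator which averages a function over the value stored by `set`. -/
def assignOp (κ : Kernel U α) [IsSFiniteKernel κ] (set : U → α → U)
    (hset : Measurable (Function.uncurry set)) : Op U :=
  ⟨fun F => ⟨fun u => ∫⁻ z, F.1 (set u z) ∂κ u,
    Measurable.lintegral_kernel_prod_right' (f := fun p => F.1 (set p.1 p.2)) (F.2.comp hset)⟩⟩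

theorem eval_assignOp (κ : Kernel U α) [IsSFiniteKernel κ] (set : U → α → U)
    (hset : Measurable (Function.uncurry set)) (F : measurableFunctions U) (u : U) :
    (assignOp κ set hset).eval F u = ∫⁻ z, F.1 (set u z) ∂κ u := rfl

/-- Tonelli's theorem for s-finite measures: the writes commute as maps, and neither kernel reads
what the other step writes. -/
theorem commute_assignOp {κ : Kernel U α} [IsSFiniteKernel κ] {set : U → α → U}
    {hset : Measurable (Function.uncurry set)} {κ' : Kernel U β} [IsSFiniteKernel κ']
    {set' : U → β → U} {hset' : Measurable (Function.uncurry set')}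
    (h : ∀ u z w, set' (set u z) w = set (set' u w) z)
    (hκ : ∀ u w, κ (set' u w) = κ u) (hκ' : ∀ u z, κ' (set u z) = κ' u) :
    Commute (assignOp κ set hset) (assignOp κ' set' hset') := by
  refine Op.ext fun F u => ?_
  rw [Op.eval_mul, Op.eval_mul, eval_assignOp, eval_assignOp]
  change ∫⁻ z, ∫⁻ w, F.1 (set' (set u z) w) ∂κ' (set u z) ∂κ u =
    ∫⁻ w, ∫⁻ z, F.1 (set (set' u w) z) ∂κ (set' u w) ∂κ' u
  simp only [h, hκ, hκ']
  refine lintegral_lintegral_swap (Measurable.aemeasurable ?_)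
  have h1 : Measurable fun p : α × β => set' u p.2 := hset'.comp (measurable_const.prodMk measurable_snd)
  exact F.2.comp (hset.comp (h1.prodMk measurable_fst))

theorem commute_weigh_assignOp {κ : Kernel U α} [IsSFiniteKernel κ] {set : U → α → U}
    {hset : Measurable (Function.uncurry set)} {d : measurableFunctions U}
    (h : ∀ u z, d.1 (set u z) = d.1 u) : Commute (weigh d) (assignOp κ set hset) := by
  refine Op.ext fun F u => ?_
  rw [Op.eval_mul, Op.eval_mul, eval_weigh, eval_assignOp]
  change d.1 u * ∫⁻ z, F.1 (set u z) ∂κ u = ∫⁻ z, d.1 (set u z) * F.1 (set u z) ∂κ u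
  simp only [h]
  rw [lintegral_const_mul]
  exact F.2.comp (measurable_uncurry_left hset u)

/-- The density may be evaluated after the write, at the value just stored. This turns a draw into a
reference integral and a weight, which can then be moved separately. -/
theorem assignOp_withDensity {μ : Measure α} [SFinite μ] {set : U → α → U}
    {hset : Measurable (Function.uncurry set)} {δ : U → α → ℝ≥0}
    (hδ : Measurable (Function.uncurry δ)) {d : measurableFunctions U}
    (h : ∀ u z, d.1 (set u z) = δ u z) :
    assignOp ((Kernel.const U μ).withDensity fun u z => (δ u z : ℝ≥0∞)) set hset =
      assignOp (Kernel.const U μ) set hset * weigh d := by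
  refine Op.ext fun F u => ?_
  have hδ' : Measurable (Function.uncurry fun u z => (δ u z : ℝ≥0∞)) := hδ.coe_nnreal_ennreal
  have hF : Measurable fun z => F.1 (set u z) := F.2.comp (measurable_uncurry_left hset u)
  rw [Op.eval_mul, eval_assignOp, eval_assignOp, Kernel.lintegral_withDensity _ hδ' _ hF,
    Kernel.const_apply]
  change _ = ∫⁻ z, d.1 (set u z) * F.1 (set u z) ∂μ
  simp only [h]

/-! ### The operator of a step -/

open Classical in
/-- The operator that integrates a function with respect to a step. -/
def stepOp (S : U → Measure U) : Op U :=
  if h : Measurable S then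
    ⟨fun F => ⟨fun u => ∫⁻ v, F.1 v ∂S u,
      show Measurable fun u => ∫⁻ v, F.1 v ∂S u from (Measure.measurable_lintegral F.2).comp h⟩⟩
  -- This value is never used: all steps that occur are proved measurable.
  else 1

theorem eval_stepOp {S : U → Measure U} (h : Measurable S) (F : measurableFunctions U) (u : U) :
    (stepOp S).eval F u = ∫⁻ v, F.1 v ∂S u := by
  rw [stepOp, dif_pos h]
  rfl

/-- Duality between pushing measures forward and pulling functions back. The step performed first
becomes the leftmost factor, so no reversal of the list occurs. -/
theorem lintegral_run {steps : List (U → Measure U)} (h : ∀ S ∈ steps, Measurable S)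
    (F : measurableFunctions U) (μ : Measure U) :
    ∫⁻ v, F.1 v ∂run steps μ = ∫⁻ u, (steps.map stepOp).prod.eval F u ∂μ := by
  induction steps generalizing μ with
  | nil => rfl
  | cons S l ih =>
    simp only [List.mem_cons, forall_eq_or_imp] at h
    change ∫⁻ v, F.1 v ∂run l (μ.bind S) = _
    have hm : Measurable ((l.map stepOp).prod.eval F) := Op.measurable_eval _ _
    rw [ih h.2, Measure.lintegral_bind h.1.aemeasurable hm.aemeasurable]
    simp only [List.map_cons, List.prod_cons, Op.eval_mul, eval_stepOp h.1]
    rfl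

theorem lintegral_run_dirac {steps : List (U → Measure U)} (h : ∀ S ∈ steps, Measurable S)
    (F : measurableFunctions U) (u₀ : U) :
    ∫⁻ v, F.1 v ∂run steps (Measure.dirac u₀) = (steps.map stepOp).prod.eval F u₀ := by
  rw [lintegral_run h]
  exact lintegral_dirac' _ (Op.measurable_eval _ _)

theorem isProbabilityMeasure_run {steps : List (U → Measure U)}
    (h : ∀ S ∈ steps, Measurable S ∧ ∀ u, IsProbabilityMeasure (S u))
    (μ : Measure U) [IsProbabilityMeasure μ] : IsProbabilityMeasure (run steps μ) := by
  induction steps generalizing μ with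
  | nil => assumption
  | cons S l ih =>
    simp only [List.mem_cons, forall_eq_or_imp] at h
    have : IsProbabilityMeasure (μ.bind S) :=
      isProbabilityMeasure_bind h.1.1.aemeasurable (.of_forall h.1.2)
    exact ih h.2 (μ.bind S)

theorem measurable_assign {μ : U → Measure α} (κ : Kernel U α) [IsSFiniteKernel κ]
    (hκ : ∀ u, μ u = κ u) {set : U → α → U} (hset : Measurable (Function.uncurry set)) :
    Measurable (assign μ set) := by
  refine Measure.measurable_of_measurable_coe _ fun s hs => ?_
  have : ∀ u, assign μ set u s = κ u (Prod.mk u ⁻¹' (Function.uncurry set ⁻¹' s)) := fun u => by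
    rw [assign, Measure.map_apply (measurable_uncurry_left hset u) hs, hκ]
    rfl
  simp only [this]
  exact Kernel.measurable_kernel_prodMk_left (hset hs)

theorem stepOp_assign {μ : U → Measure α} (κ : Kernel U α) [IsSFiniteKernel κ]
    (hκ : ∀ u, μ u = κ u) {set : U → α → U} (hset : Measurable (Function.uncurry set)) :
    stepOp (assign μ set) = assignOp κ set hset := by
  refine Op.ext fun F u => ?_
  rw [eval_stepOp (measurable_assign κ hκ hset), eval_assignOp, assign,
    lintegral_map F.2 (measurable_uncurry_left hset u), hκ]

theorem isProbabilityMeasure_assign {μ : U → Measure α} {set : U → α → U}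
    (hset : Measurable (Function.uncurry set)) {u : U} (h : IsProbabilityMeasure (μ u)) :
    IsProbabilityMeasure (assign μ set u) :=
  Measure.isProbabilityMeasure_map (measurable_uncurry_left hset u).aemeasurable

theorem categorical_eq_withDensity {k : ℕ} (v : Fin k → ℝ≥0) :
    categorical v = Measure.count.withDensity fun i => (v i : ℝ≥0∞) := by
  refine Measure.ext_of_singleton fun i => ?_
  rw [withDensity_apply _ (measurableSet_singleton i), lintegral_singleton, Measure.count_singleton,
    mul_one, categorical, Measure.finsetSum_apply]
  simp [Set.indicator_apply]

theorem isProbabilityMeasure_categorical_normalize {k : ℕ} {v : Fin k → ℝ≥0}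
    (h : ∑ i, v i ≠ 0) : IsProbabilityMeasure (categorical (normalize v)) := by
  refine ⟨?_⟩
  rw [categorical, Measure.finsetSum_apply]
  simp only [Measure.smul_apply, measure_univ, smul_eq_mul, mul_one]
  rw [← ENNReal.ofNNReal_finsetSum, ENNReal.coe_eq_one]
  simp only [normalize]
  rw [← Finset.sum_div, div_self h]

end Operators

/-! ### Overwriting coordinates -/

section Coordinates

variable {n : ℕ} {N : Fin (n + 1) → ℕ} {C : Fin n → ℕ} {X : Type*}

theorem setState_time {t t' : Fin (n + 1)} (h : t' ≠ t) (i : Fin (N t)) (u : ExtSpace N C X)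
    (z : X) : (setState t i u z).1 t' = u.1 t' :=
  Function.update_of_ne h _ _

theorem setState_self (t : Fin (n + 1)) (i : Fin (N t)) (u : ExtSpace N C X) (z : X) :
    (setState t i u z).1 t i = z := by
  simp [setState]

theorem setState_of_ne {t t' : Fin (n + 1)} {i : Fin (N t)} {i' : Fin (N t')}
    (h : (⟨t', i'⟩ : Σ t, Fin (N t)) ≠ ⟨t, i⟩) (u : ExtSpace N C X) (z : X) :
    (setState t i u z).1 t' i' = u.1 t' i' := by
  by_cases ht : t' = t
  · subst ht
    have hi : i' ≠ i := fun hi => h (by rw [hi])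
    simp [setState, hi]
  · rw [setState_time ht]

theorem setParent_time {s s' : Fin n} (h : s' ≠ s) (i : Fin (N s.succ)) (u : ExtSpace N C X)
    (k : Fin (N s.castSucc)) : (setParent s i u k).2.1 s' = u.2.1 s' :=
  Function.update_of_ne h _ _

theorem setParent_self (s : Fin n) (i : Fin (N s.succ)) (u : ExtSpace N C X)
    (k : Fin (N s.castSucc)) : (setParent s i u k).2.1 s i = k := by
  simp [setParent]

theorem setParent_of_ne {s s' : Fin n} {i : Fin (N s.succ)} {i' : Fin (N s'.succ)}
    (h : (⟨s', i'⟩ : Σ s : Fin n, Fin (N s.succ)) ≠ ⟨s, i⟩) (u : ExtSpace N C X)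
    (k : Fin (N s.castSucc)) : (setParent s i u k).2.1 s' i' = u.2.1 s' i' := by
  by_cases hs : s' = s
  · subst hs
    have hi : i' ≠ i := fun hi => h (by rw [hi])
    simp [setParent, hi]
  · rw [setParent_time hs]

theorem setIndex_of_ne {t t' : Fin (n + 1)} (h : t' ≠ t) (u : ExtSpace N C X) (k : Fin (N t)) :
    (setIndex t u k).2.2.1 t' = u.2.2.1 t' :=
  Function.update_of_ne h _ _

theorem setIndex_self (t : Fin (n + 1)) (u : ExtSpace N C X) (k : Fin (N t)) :
    (setIndex t u k).2.2.1 t = k :=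
  Function.update_self _ _ _

theorem setGenerated_self (s : Fin n) (j : Fin (C s)) (u : ExtSpace N C X) (z : X) :
    (setGenerated s j u z).2.2.2 s j = z := by
  simp [setGenerated]

theorem setGenerated_of_ne {s s' : Fin n} {j : Fin (C s)} {j' : Fin (C s')}
    (h : (⟨s', j'⟩ : Σ s, Fin (C s)) ≠ ⟨s, j⟩) (u : ExtSpace N C X) (z : X) :
    (setGenerated s j u z).2.2.2 s' j' = u.2.2.2 s' j' := by
  by_cases hs : s' = s
  · subst hs
    have hj : j' ≠ j := fun hj => h (by rw [hj])
    simp [setGenerated, hj]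
  · simp [setGenerated, hs]

theorem update_update_comm {ι : Type*} [DecidableEq ι] {κ : ι → Type*} [∀ i, DecidableEq (κ i)]
    {β : ι → Type*} (x : ∀ i, κ i → β i) {i i' : ι} {j : κ i} {j' : κ i'}
    (h : (⟨i, j⟩ : Σ i, κ i) ≠ ⟨i', j'⟩) (z : β i) (z' : β i') :
    Function.update (Function.update x i (Function.update (x i) j z)) i'
        (Function.update (Function.update x i (Function.update (x i) j z) i') j' z') =
      Function.update (Function.update x i' (Function.update (x i') j' z')) i
        (Function.update (Function.update x i' (Function.update (x i') j' z') i) j z) := by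
  by_cases hi : i = i'
  · subst hi
    have hj : j ≠ j' := fun hj => h (by rw [hj])
    simp [Function.update_comm hj]
  · rw [Function.update_of_ne (Ne.symm hi), Function.update_of_ne hi, Function.update_comm hi]

theorem setState_comm {t t' : Fin (n + 1)} {i : Fin (N t)} {i' : Fin (N t')}
    (h : (⟨t, i⟩ : Σ t, Fin (N t)) ≠ ⟨t', i'⟩) (u : ExtSpace N C X) (z z' : X) :
    setState t' i' (setState t i u z) z' = setState t i (setState t' i' u z') z :=
  congrArg (fun x => (x, u.2)) (update_update_comm u.1 h z z')

theorem setParent_comm {s s' : Fin n} {i : Fin (N s.succ)} {i' : Fin (N s'.succ)}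
    (h : (⟨s, i⟩ : Σ s : Fin n, Fin (N s.succ)) ≠ ⟨s', i'⟩) (u : ExtSpace N C X)
    (k : Fin (N s.castSucc)) (k' : Fin (N s'.castSucc)) :
    setParent s' i' (setParent s i u k) k' = setParent s i (setParent s' i' u k') k :=
  congrArg (fun a => (u.1, a, u.2.2)) (update_update_comm u.2.1 h k k')

theorem setGenerated_comm {s s' : Fin n} {j : Fin (C s)} {j' : Fin (C s')}
    (h : (⟨s, j⟩ : Σ s, Fin (C s)) ≠ ⟨s', j'⟩) (u : ExtSpace N C X) (z z' : X) :
    setGenerated s' j' (setGenerated s j u z) z' = setGenerated s j (setGenerated s' j' u z') z :=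
  congrArg (fun x => (u.1, u.2.1, u.2.2.1, x)) (update_update_comm u.2.2.2 h z z')

theorem setIndex_comm {t t' : Fin (n + 1)} (h : t ≠ t') (u : ExtSpace N C X) (k : Fin (N t))
    (k' : Fin (N t')) : setIndex t' (setIndex t u k) k' = setIndex t (setIndex t' u k') k := by
  have h' := Function.update_comm h k k' u.2.2.1
  exact congrArg (fun b : Indices N => ((u.1, u.2.1, b, u.2.2.2) : ExtSpace N C X)) h'

/-- Overwrites the selected particle of time `t`. -/
def setSelectedState (t : Fin (n + 1)) (u : ExtSpace N C X) (z : X) : ExtSpace N C X :=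
  setState t (u.2.2.1 t) u z

/-- Overwrites the parent of the selected particle of time `s.succ`. -/
def setSelectedParent (s : Fin n) (u : ExtSpace N C X) (k : Fin (N s.castSucc)) :
    ExtSpace N C X :=
  setParent s (u.2.2.1 s.succ) u k

theorem path_zero (u : ExtSpace N C X) (s : Fin n) :
    path u s 0 = u.1 s.castSucc (u.2.2.1 s.castSucc) := rfl

theorem path_succ (u : ExtSpace N C X) (s : Fin n) (j : Fin (C s)) :
    path u s j.succ = u.2.2.2 s j := rfl

@[simp] theorem setPath_parents (s : Fin n) (j : Fin (C s + 1)) (u : ExtSpace N C X) (z : X) :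
    (setPath s j u z).2.1 = u.2.1 := by
  cases j using Fin.cases <;> rfl

@[simp] theorem setPath_indices (s : Fin n) (j : Fin (C s + 1)) (u : ExtSpace N C X) (z : X) :
    (setPath s j u z).2.2.1 = u.2.2.1 := by
  cases j using Fin.cases <;> rfl

theorem setPath_states_of_ne {s : Fin n} {t : Fin (n + 1)} {i : Fin (N t)} {u : ExtSpace N C X}
    (h : (⟨t, i⟩ : Σ t, Fin (N t)) ≠ ⟨s.castSucc, u.2.2.1 s.castSucc⟩) (j : Fin (C s + 1))
    (z : X) : (setPath s j u z).1 t i = u.1 t i := by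
  cases j using Fin.cases with
  | zero => exact setState_of_ne h u z
  | succ j => rfl

theorem setPath_states_time {s : Fin n} {t : Fin (n + 1)} (h : t ≠ s.castSucc)
    (j : Fin (C s + 1)) (u : ExtSpace N C X) (z : X) : (setPath s j u z).1 t = u.1 t := by
  cases j using Fin.cases with
  | zero => exact setState_time h _ u z
  | succ j => rfl

theorem path_setPath_self (s : Fin n) (j : Fin (C s + 1)) (u : ExtSpace N C X) (z : X) :
    path (setPath s j u z) s j = z := by
  cases j using Fin.cases with
  | zero => exact setState_self _ _ u z
  | succ j => exact setGenerated_self s j u z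

theorem path_setPath_of_ne {s s' : Fin n} {j : Fin (C s + 1)} {j' : Fin (C s' + 1)}
    (h : (⟨s', j'⟩ : Σ s, Fin (C s + 1)) ≠ ⟨s, j⟩) (u : ExtSpace N C X) (z : X) :
    path (setPath s j u z) s' j' = path u s' j' := by
  cases j using Fin.cases with
  | zero =>
    cases j' using Fin.cases with
    | zero =>
      refine setState_of_ne (fun h' => h ?_) u z
      rw [Sigma.mk.injEq] at h'
      obtain rfl := Fin.castSucc_injective n h'.1
      rfl
    | succ j' => rfl
  | succ j =>
    cases j' using Fin.cases with
    | zero => rfl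
    | succ j' =>
      refine setGenerated_of_ne (fun h' => h ?_) u z
      rw [Sigma.mk.injEq] at h'
      obtain ⟨rfl, h'⟩ := h'
      have hj : j' = j := eq_of_heq h'
      rw [hj]

theorem setPath_comm {s s' : Fin n} {j : Fin (C s + 1)} {j' : Fin (C s' + 1)}
    (h : (⟨s, j⟩ : Σ s, Fin (C s + 1)) ≠ ⟨s', j'⟩) (u : ExtSpace N C X) (z z' : X) :
    setPath s' j' (setPath s j u z) z' = setPath s j (setPath s' j' u z') z := by
  cases j using Fin.cases with
  | zero =>
    cases j' using Fin.cases with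
    | zero =>
      refine setState_comm (fun h' => h ?_) u z z'
      rw [Sigma.mk.injEq] at h'
      obtain rfl := Fin.castSucc_injective n h'.1
      rfl
    | succ j' => rfl
  | succ j =>
    cases j' using Fin.cases with
    | zero => rfl
    | succ j' =>
      refine setGenerated_comm (fun h' => h ?_) u z z'
      rw [Sigma.mk.injEq] at h'
      obtain ⟨rfl, h'⟩ := h'
      have hj : j = j' := eq_of_heq h'
      rw [hj]

theorem setPath_setState_comm {s : Fin n} {j : Fin (C s + 1)} {t : Fin (n + 1)} {i : Fin (N t)}
    {u : ExtSpace N C X} (h : (⟨t, i⟩ : Σ t, Fin (N t)) ≠ ⟨s.castSucc, u.2.2.1 s.castSucc⟩)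
    (z z' : X) : setPath s j (setState t i u z) z' = setState t i (setPath s j u z') z := by
  cases j using Fin.cases with
  | zero => exact setState_comm h u z z'
  | succ j => rfl

theorem setPath_setParent_comm {s : Fin n} {j : Fin (C s + 1)} {r : Fin n} {i : Fin (N r.succ)}
    (u : ExtSpace N C X) (k : Fin (N r.castSucc)) (z : X) :
    setPath s j (setParent r i u k) z = setParent r i (setPath s j u z) k := by
  cases j using Fin.cases <;> rfl

/-! ### The selected trajectory as a family of coordinates -/

section Selected

theorem selected_last (u : ExtSpace N C X) :
    selected u (Fin.last n) = u.1 (Fin.last n) (u.2.2.1 (Fin.last n)) :=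
  Fin.snoc_last _ _

theorem selected_castSucc (u : ExtSpace N C X) (s : Fin n) :
    selected u s.castSucc = path u s (Fin.last (C s)) :=
  Fin.snoc_castSucc _ _ _

/-- Overwrites the state of the selected trajectory at time `t`. -/
def setSelected (t : Fin (n + 1)) (u : ExtSpace N C X) (z : X) : ExtSpace N C X :=
  Fin.lastCases (motive := fun _ => ExtSpace N C X) (setSelectedState (Fin.last n) u z)
    (fun s => setPath s (Fin.last (C s)) u z) t

theorem setSelected_last (u : ExtSpace N C X) (z : X) :
    setSelected (Fin.last n) u z = setSelectedState (Fin.last n) u z :=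
  Fin.lastCases_last

theorem setSelected_castSucc (s : Fin n) (u : ExtSpace N C X) (z : X) :
    setSelected s.castSucc u z = setPath s (Fin.last (C s)) u z :=
  Fin.lastCases_castSucc _

theorem selected_congr {u u' : ExtSpace N C X} {t : Fin (n + 1)}
    (h : ∀ s : Fin n, t = s.castSucc → path u s (Fin.last (C s)) = path u' s (Fin.last (C s)))
    (h' : t = Fin.last n →
      u.1 (Fin.last n) (u.2.2.1 (Fin.last n)) = u'.1 (Fin.last n) (u'.2.2.1 (Fin.last n))) :
    selected u t = selected u' t := by
  cases t using Fin.lastCases with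
  | last => rw [selected_last, selected_last, h' rfl]
  | cast s => rw [selected_castSucc, selected_castSucc, h s rfl]

theorem selected_setPath_of_ne {s : Fin n} {j : Fin (C s + 1)} {t : Fin (n + 1)}
    (h : t = s.castSucc → j ≠ Fin.last (C s)) (u : ExtSpace N C X) (z : X) :
    selected (setPath s j u z) t = selected u t := by
  refine selected_congr (fun s' hs' => path_setPath_of_ne (fun h' => ?_) u z) fun _ => ?_
  · rw [Sigma.mk.injEq] at h'
    obtain ⟨rfl, h'⟩ := h'
    exact h hs' (eq_of_heq h').symm
  · rw [setPath_indices, setPath_states_time s.castSucc_lt_last.ne']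

/-- Because of this, integrating over `setSelected` at all times amounts to integrating the selected
trajectory against the product measure. -/
theorem selected_setSelected (t : Fin (n + 1)) (u : ExtSpace N C X) (z : X) :
    selected (setSelected t u z) = Function.update (selected u) t z := by
  funext t'
  cases t using Fin.lastCases with
  | last =>
    rw [setSelected_last]
    cases t' using Fin.lastCases with
    | last =>
      rw [selected_last, Function.update_self]
      exact setState_self _ _ u z
    | cast s =>
      rw [Function.update_of_ne s.castSucc_lt_last.ne, selected_castSucc, selected_castSucc]
      -- Without the assumption `C s ≥ 1` the path may consist of its starting particle alone, so
      -- both forms of its last position are treated.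
      cases hj : Fin.last (C s) using Fin.cases with
      | zero =>
        rw [path_zero, path_zero]
        exact congrFun (setState_time s.castSucc_lt_last.ne _ u z) _
      | succ j => rfl
  | cast s =>
    rw [setSelected_castSucc]
    by_cases h : t' = s.castSucc
    · subst h
      rw [Function.update_self, selected_castSucc, path_setPath_self]
    · rw [Function.update_of_ne h, selected_setPath_of_ne fun h' => absurd h' h]

theorem selected_setParent (s : Fin n) (i : Fin (N s.succ)) (u : ExtSpace N C X)
    (k : Fin (N s.castSucc)) : selected (setParent s i u k) = selected u := rfl

@[simp] theorem setSelected_parents (t : Fin (n + 1)) (u : ExtSpace N C X) (z : X) :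
    (setSelected t u z).2.1 = u.2.1 := by
  cases t using Fin.lastCases with
  | last => rw [setSelected_last]; rfl
  | cast s => rw [setSelected_castSucc, setPath_parents]

@[simp] theorem setSelected_indices (t : Fin (n + 1)) (u : ExtSpace N C X) (z : X) :
    (setSelected t u z).2.2.1 = u.2.2.1 := by
  cases t using Fin.lastCases with
  | last => rw [setSelected_last]; rfl
  | cast s => rw [setSelected_castSucc, setPath_indices]

end Selected

/-! ### Runs with at least one transition -/

section SelectedGenerated

variable [∀ s, NeZero (C s)]

theorem exists_succ_eq_last (s : Fin n) : ∃ j : Fin (C s), j.succ = Fin.last (C s) :=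
  ⟨⟨C s - 1, Nat.sub_lt (NeZero.pos (C s)) one_pos⟩,
    Fin.ext (Nat.succ_pred_eq_of_pos (NeZero.pos (C s)))⟩

/-- With at least one transition, the end of a run is a generated state, stored apart from the
particles. Hence at non-final times the selected state is independent of the particle system and of
the indices as a coordinate. -/
theorem path_last_congr {u u' : ExtSpace N C X} {s : Fin n} (h : u.2.2.2 s = u'.2.2.2 s) :
    path u s (Fin.last (C s)) = path u' s (Fin.last (C s)) := by
  obtain ⟨j, hj⟩ := exists_succ_eq_last (C := C) s
  rw [← hj, path_succ, path_succ, h]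

theorem selected_setState_of_ne {t : Fin (n + 1)} {i : Fin (N t)} {u : ExtSpace N C X}
    (h : t = Fin.last n → i ≠ u.2.2.1 t) (z : X) :
    selected (setState t i u z) = selected u := by
  funext t'
  refine selected_congr (fun s _ => path_last_congr rfl) fun _ => setState_of_ne (fun h' => ?_) u z
  rw [Sigma.mk.injEq] at h'
  obtain ⟨rfl, h'⟩ := h'
  exact h rfl (eq_of_heq h').symm

theorem selected_setIndex_of_lt {t t' : Fin (n + 1)} (h : t < Fin.last n) (u : ExtSpace N C X)
    (k : Fin (N t)) : selected (setIndex t u k) t' = selected u t' := by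
  refine selected_congr (fun s _ => path_last_congr rfl) fun _ => ?_
  rw [setIndex_of_ne h.ne']
  rfl

theorem setSelected_states_of_ne {t t' : Fin (n + 1)} {i : Fin (N t')} {u : ExtSpace N C X}
    (h : t = Fin.last n → (⟨t', i⟩ : Σ t, Fin (N t)) ≠ ⟨t, u.2.2.1 t⟩) (z : X) :
    (setSelected t u z).1 t' i = u.1 t' i := by
  cases t using Fin.lastCases with
  | last => rw [setSelected_last]; exact setState_of_ne (h rfl) u z
  | cast s =>
    obtain ⟨j, hj⟩ := exists_succ_eq_last (C := C) s
    rw [setSelected_castSucc, ← hj]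
    rfl

theorem setSelected_setState_comm {t t' : Fin (n + 1)} {i : Fin (N t')} {u : ExtSpace N C X}
    (h : t = Fin.last n → (⟨t', i⟩ : Σ t, Fin (N t)) ≠ ⟨t, u.2.2.1 t⟩) (z z' : X) :
    setSelected t (setState t' i u z) z' = setState t' i (setSelected t u z') z := by
  cases t using Fin.lastCases with
  | last =>
    rw [setSelected_last, setSelected_last]
    exact setState_comm (h rfl) u z z'
  | cast s =>
    obtain ⟨j, hj⟩ := exists_succ_eq_last (C := C) s
    rw [setSelected_castSucc, setSelected_castSucc, ← hj]
    rfl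

end SelectedGenerated

end Coordinates

/-! ### Measurability -/

section Measurability

variable {n : ℕ} {N : Fin (n + 1) → ℕ} {C : Fin n → ℕ} {X Y : Type*} [MeasurableSpace X]
  [MeasurableSpace Y]

/-- Random indices take countably many values, so measurability may be checked for each fixed index.
-/
theorem measurable_apply_index {U ι β : Type*} [MeasurableSpace U] [MeasurableSpace ι]
    [MeasurableSpace β] [Countable ι] [MeasurableSingletonClass ι] {f : ι → U → β} {h : U → ι}
    (hf : ∀ i, Measurable (f i)) (hh : Measurable h) : Measurable fun u => f (h u) u :=
  (measurable_from_prod_countable_right (f := Function.uncurry f) hf).comp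
    (hh.prodMk measurable_id)

theorem measurable_state (t : Fin (n + 1)) (i : Fin (N t)) :
    Measurable fun u : ExtSpace N C X => u.1 t i := by fun_prop

theorem measurable_parent (s : Fin n) (i : Fin (N s.succ)) :
    Measurable fun u : ExtSpace N C X => u.2.1 s i := by fun_prop

theorem measurable_index (t : Fin (n + 1)) :
    Measurable fun u : ExtSpace N C X => u.2.2.1 t := by fun_prop

theorem measurable_generated (s : Fin n) (j : Fin (C s)) :
    Measurable fun u : ExtSpace N C X => u.2.2.2 s j := by fun_prop

theorem measurable_selectedState (t : Fin (n + 1)) :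
    Measurable fun u : ExtSpace N C X => u.1 t (u.2.2.1 t) :=
  measurable_apply_index (measurable_state t) (measurable_index t)

theorem measurable_parentState (s : Fin n) (i : Fin (N s.succ)) :
    Measurable fun u : ExtSpace N C X => u.1 s.castSucc (u.2.1 s i) :=
  measurable_apply_index (measurable_state _) (measurable_parent s i)

theorem measurable_path (s : Fin n) (j : Fin (C s + 1)) :
    Measurable fun u : ExtSpace N C X => path u s j := by
  cases j using Fin.cases with
  | zero => exact measurable_selectedState s.castSucc
  | succ j => exact measurable_generated s j

theorem measurable_selected (t : Fin (n + 1)) :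
    Measurable fun u : ExtSpace N C X => selected u t := by
  cases t using Fin.lastCases with
  | last => simpa only [selected_last] using measurable_selectedState (Fin.last n)
  | cast s => simpa only [selected_castSucc] using measurable_path s (Fin.last (C s))

theorem measurable_update_update {ι : Type*} [DecidableEq ι] {κ : ι → Type*}
    [∀ i, DecidableEq (κ i)] {β : ι → Type*} [∀ i, MeasurableSpace (β i)] (i : ι) (j : κ i) :
    Measurable fun p : (∀ i, κ i → β i) × β i =>
      Function.update p.1 i (Function.update (p.1 i) j p.2) := by
  have h : Measurable fun p : (∀ i, κ i → β i) × β i => Function.update (p.1 i) j p.2 :=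
    (measurable_update' (a := j)).comp (by fun_prop : Measurable fun p :
      (∀ i, κ i → β i) × β i => (p.1 i, p.2))
  exact (measurable_update' (a := i)).comp (measurable_fst.prodMk h)

theorem measurable_setState (t : Fin (n + 1)) (i : Fin (N t)) :
    Measurable (Function.uncurry (setState (C := C) (X := X) t i)) := by
  refine Measurable.prodMk ?_ (by fun_prop)
  exact (measurable_update_update t i).comp (by fun_prop :
    Measurable fun p : ExtSpace N C X × X => (p.1.1, p.2))

theorem measurable_setParent (s : Fin n) (i : Fin (N s.succ)) :
    Measurable (Function.uncurry (setParent (C := C) (X := X) s i)) := by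
  refine Measurable.prodMk (by fun_prop) (Measurable.prodMk ?_ (by fun_prop))
  exact (measurable_update_update s i).comp (by fun_prop :
    Measurable fun p : ExtSpace N C X × Fin (N s.castSucc) => (p.1.2.1, p.2))

theorem measurable_setIndex (t : Fin (n + 1)) :
    Measurable (Function.uncurry (setIndex (N := N) (C := C) (X := X) t)) := by
  refine Measurable.prodMk (by fun_prop) (Measurable.prodMk (by fun_prop)
    (Measurable.prodMk ?_ (by fun_prop)))
  exact (measurable_update' (a := t)).comp (by fun_prop :
    Measurable fun p : ExtSpace N C X × Fin (N t) => (p.1.2.2.1, p.2))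

theorem measurable_setGenerated (s : Fin n) (j : Fin (C s)) :
    Measurable (Function.uncurry (setGenerated (N := N) (X := X) s j)) := by
  refine Measurable.prodMk (by fun_prop) (Measurable.prodMk (by fun_prop)
    (Measurable.prodMk (by fun_prop) ?_))
  exact (measurable_update_update s j).comp (by fun_prop :
    Measurable fun p : ExtSpace N C X × X => (p.1.2.2.2, p.2))

theorem measurable_setSelectedState (t : Fin (n + 1)) :
    Measurable (Function.uncurry (setSelectedState (N := N) (C := C) (X := X) t)) :=
  measurable_apply_index (f := fun i (p : ExtSpace N C X × X) => setState t i p.1 p.2)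
    (measurable_setState t) ((measurable_index t).comp measurable_fst)

theorem measurable_setSelectedParent (s : Fin n) :
    Measurable (Function.uncurry (setSelectedParent (N := N) (C := C) (X := X) s)) :=
  measurable_apply_index
    (f := fun i (p : ExtSpace N C X × Fin (N s.castSucc)) => setParent s i p.1 p.2)
    (measurable_setParent s) ((measurable_index s.succ).comp measurable_fst)

theorem measurable_setPath (s : Fin n) (j : Fin (C s + 1)) :
    Measurable (Function.uncurry (setPath (N := N) (X := X) s j)) := by
  cases j using Fin.cases with
  | zero => exact measurable_setSelectedState s.castSucc
  | succ j => exact measurable_setGenerated s j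

theorem measurable_setSelected (t : Fin (n + 1)) :
    Measurable (Function.uncurry (setSelected (N := N) (C := C) (X := X) t)) := by
  cases t using Fin.lastCases with
  | last =>
    have h : setSelected (N := N) (C := C) (X := X) (Fin.last n) = setSelectedState (Fin.last n) :=
      funext fun u => funext fun z => setSelected_last u z
    rw [h]
    exact measurable_setSelectedState _
  | cast s =>
    have h : setSelected (N := N) (C := C) (X := X) s.castSucc = setPath s (Fin.last (C s)) :=
      funext fun u => funext fun z => setSelected_castSucc s u z
    rw [h]
    exact measurable_setPath _ _

variable {lam : Measure X} {nu : Measure Y}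
  (m : StateSpaceModel n X Y lam nu) (q : ImportanceDensities n X Y lam) (y : Fin (n + 1) → Y)

theorem measurable_observation (t : Fin (n + 1)) (η : Y) : Measurable fun x => m.g t x η :=
  (m.measurable_g t).comp (measurable_id.prodMk measurable_const)

theorem measurable_weight (t : Fin (n + 1)) (i : Fin (N t)) :
    Measurable fun u : ExtSpace N C X => weight m q y u.1 u.2.1 t i := by
  cases t using Fin.cases with
  | zero =>
    exact (((measurable_observation m 0 (y 0)).comp (measurable_state 0 i)).mul
      (m.measurable_f₁.comp (measurable_state 0 i))).div
        ((q.measurable_M₁ (y 0)).comp (measurable_state 0 i))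
  | succ s =>
    have h : Measurable fun u : ExtSpace N C X => (u.1 s.castSucc (u.2.1 s i), u.1 s.succ i) :=
      (measurable_parentState s i).prodMk (measurable_state _ _)
    exact (((measurable_observation m s.succ (y s.succ)).comp (measurable_state s.succ i)).mul
      ((m.measurable_f s).comp h)).div ((q.measurable_M s (y s.succ)).comp h)

theorem measurable_normalize {U : Type*} [MeasurableSpace U] {k : ℕ} {v : U → Fin k → ℝ≥0}
    (hv : ∀ i, Measurable fun u => v u i) (i : Fin k) : Measurable fun u => normalize (v u) i :=
  (hv i).div (Finset.univ.measurable_sum fun j _ => hv j)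

theorem measurable_backwardWeight (s : Fin n) (i : Fin (N s.castSucc))
    {z : ExtSpace N C X → X} (hz : Measurable z) :
    Measurable fun u : ExtSpace N C X => backwardWeight m q y u.1 u.2.1 (z u) s i :=
  (measurable_weight m q y _ i).mul
    ((m.measurable_f s).comp ((measurable_state _ i).prodMk hz))

theorem measurable_backwardWeight_uncurry (s : Fin n) (i : Fin (N s.castSucc)) :
    Measurable fun p : ExtSpace N C X × X => backwardWeight m q y p.1.1 p.1.2.1 p.2 s i :=
  ((measurable_weight m q y _ i).comp measurable_fst).mul
    ((m.measurable_f s).comp (((measurable_state _ i).comp measurable_fst).prodMk measurable_snd))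

theorem measurable_predictive (t : Fin (n + 1)) :
    Measurable fun p : ExtSpace N C X × X => predictive m q y p.1.1 p.1.2.1 t p.2 := by
  cases t using Fin.cases with
  | zero => exact m.measurable_f₁.comp measurable_snd
  | succ s => exact Finset.univ.measurable_sum fun i _ => measurable_backwardWeight_uncurry m q y s i

theorem measurable_targetDensity (s : Fin n) {z : ExtSpace N C X → X} (hz : Measurable z) :
    Measurable fun p : ExtSpace N C X × X =>
      targetDensity m q y p.1.1 p.1.2.1 (z p.1) s p.2 :=
  (((measurable_observation m _ _).comp measurable_snd).mul
    ((m.measurable_f s).comp (measurable_snd.prodMk (hz.comp measurable_fst)))).mul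
      (measurable_predictive m q y _)

theorem measurable_conditioning (s : Fin n) (b : Fin (N s.castSucc)) {z : ExtSpace N C X → X}
    (hz : Measurable z) :
    Measurable fun u : ExtSpace N C X => conditioning u.1 u.2.1 (z u) s b := by
  refine Measurable.prodMk ?_ (Measurable.prodMk ?_ hz)
  · exact measurable_pi_lambda _ fun p => measurable_state _ _
  · exact measurable_pi_lambda _ fun p => measurable_parent _ _

variable (K : TransitionKernels N X)

theorem measurable_transition (s : Fin n) (j : Fin (C s + 1)) :
    Measurable fun u : ExtSpace N C X => transition K s (path u s j) u :=
  measurable_apply_index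
    (f := fun b (u : ExtSpace N C X) =>
      K s b (conditioning u.1 u.2.1 (selected u s.succ) s b, path u s j))
    (fun b => (K s b).measurable.comp
      ((measurable_conditioning s b (measurable_selected _)).prodMk (measurable_path s j)))
    (measurable_index _)

theorem measurable_jointDensity : Measurable (jointDensity m y) := by
  refine (((measurable_observation m _ _).comp (measurable_pi_apply 0)).mul
    (m.measurable_f₁.comp (measurable_pi_apply 0))).mul (Finset.univ.measurable_prod fun s _ => ?_)
  exact ((measurable_observation m _ _).comp (measurable_pi_apply s.succ)).mul
    ((m.measurable_f s).comp (f := fun z : Fin (n + 1) → X => (z s.castSucc, z s.succ))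
      ((measurable_pi_apply s.castSucc).prodMk (measurable_pi_apply s.succ)))

theorem measurable_posteriorDensity : Measurable (posteriorDensity m y) :=
  (measurable_jointDensity m y).coe_nnreal_ennreal.div_const _

end Measurability

/-! ### Conditional assignments -/

section Skip

variable {U α β : Type*}

open Classical in
/-- Stores a value by `set`, except where `p` holds. -/
def skipSet (p : U → Prop) (set : U → α → U) (u : U) (z : α) : U := if p u then u else set u z

theorem skipSet_of_pos {p : U → Prop} {u : U} (h : p u) (set : U → α → U) (z : α) :
    skipSet p set u z = u := if_pos h

theorem skipSet_of_neg {p : U → Prop} {u : U} (h : ¬ p u) (set : U → α → U) (z : α) :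
    skipSet p set u z = set u z := if_neg h

variable [MeasurableSpace U] [MeasurableSpace α] [MeasurableSpace β]

/-- The finite-valued measurable function `d`, as an element of `measurableFunctions U`. -/
def finiteFunction (d : U → ℝ≥0) (hd : Measurable d) : measurableFunctions U :=
  ⟨fun u => d u, show Measurable fun u => (d u : ℝ≥0∞) from hd.coe_nnreal_ennreal⟩

theorem measurable_skipSet {p : U → Prop} (hp : MeasurableSet {u | p u}) {set : U → α → U}
    (hset : Measurable (Function.uncurry set)) : Measurable (Function.uncurry (skipSet p set)) :=
  Measurable.ite (measurable_fst hp) measurable_fst hset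

open Classical in
/-- The measure `μ`, except where `p` holds. -/
def skipKernel [Nonempty α] (p : U → Prop) (hp : MeasurableSet {u | p u}) (μ : Measure α) :
    Kernel U α :=
  -- Where `p` holds, `skipSet` discards the drawn value, so any probability measure would serve. In
  -- this form a skipped step is an ordinary assignment and the general commutation lemmas apply.
  Kernel.piecewise hp (Kernel.const U (Measure.dirac (Classical.arbitrary α))) (Kernel.const U μ)

instance [Nonempty α] (p : U → Prop) (hp : MeasurableSet {u | p u}) (μ : Measure α) [SFinite μ] :
    IsSFiniteKernel (skipKernel p hp μ) := by
  unfold skipKernel; infer_instance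

/-- The operator that averages over the value stored by `set`, except where `p` holds. -/
def skipOp [Nonempty α] (p : U → Prop) (hp : MeasurableSet {u | p u}) (μ : Measure α) [SFinite μ]
    (set : U → α → U) (hset : Measurable (Function.uncurry set)) : Op U :=
  assignOp (skipKernel p hp μ) (skipSet p set) (measurable_skipSet hp hset)

variable [Nonempty α] {p : U → Prop} {hp : MeasurableSet {u | p u}} {μ : Measure α}

theorem skipKernel_of_pos {u : U} (h : p u) :
    skipKernel p hp μ u = Measure.dirac (Classical.arbitrary α) := by
  classical
  rw [skipKernel, Kernel.piecewise_apply]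
  exact if_pos h

theorem skipKernel_of_neg {u : U} (h : ¬ p u) : skipKernel p hp μ u = μ := by
  classical
  rw [skipKernel, Kernel.piecewise_apply]
  exact if_neg h

theorem skipKernel_congr {u u' : U} (h : p u ↔ p u') : skipKernel p hp μ u = skipKernel p hp μ u' := by
  by_cases hu : p u
  · rw [skipKernel_of_pos hu, skipKernel_of_pos (h.1 hu)]
  · rw [skipKernel_of_neg hu, skipKernel_of_neg (fun hu' => hu (h.2 hu'))]

variable [SFinite μ] {set : U → α → U} {hset : Measurable (Function.uncurry set)}

theorem eval_skipOp_of_pos {u : U} (h : p u) (F : measurableFunctions U) :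
    (skipOp p hp μ set hset).eval F u = F.1 u := by
  rw [skipOp, eval_assignOp, skipKernel_of_pos h]
  simp [skipSet_of_pos h]

theorem eval_skipOp_of_neg {u : U} (h : ¬ p u) (F : measurableFunctions U) :
    (skipOp p hp μ set hset).eval F u = ∫⁻ z, F.1 (set u z) ∂μ := by
  rw [skipOp, eval_assignOp, skipKernel_of_neg h]
  simp [skipSet_of_neg h]

/-- Where `p` holds the first step does nothing, so the conditions on writing and reading are needed
only off `p`, provided that the other step does not alter `p`. -/
theorem commute_skipOp_assignOp {κ : Kernel U β} [IsSFiniteKernel κ] {set' : U → β → U}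
    {hset' : Measurable (Function.uncurry set')}
    (h : ∀ u z w, ¬ p u → set' (set u z) w = set (set' u w) z)
    (hp' : ∀ u w, p (set' u w) ↔ p u) (hκ : ∀ u z, ¬ p u → κ (set u z) = κ u) :
    Commute (skipOp p hp μ set hset) (assignOp κ set' hset') := by
  refine commute_assignOp (fun u z w => ?_) (fun u w => skipKernel_congr (hp' u w)) fun u z => ?_
  · by_cases hu : p u
    · rw [skipSet_of_pos hu, skipSet_of_pos ((hp' u w).2 hu)]
    · rw [skipSet_of_neg hu, skipSet_of_neg (fun h' => hu ((hp' u w).1 h')), h u z w hu]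
  · by_cases hu : p u
    · rw [skipSet_of_pos hu]
    · rw [skipSet_of_neg hu, hκ u z hu]

theorem commute_skipOp_skipOp [Nonempty β] {p' : U → Prop} {hp' : MeasurableSet {u | p' u}}
    {μ' : Measure β} [SFinite μ'] {set' : U → β → U} {hset' : Measurable (Function.uncurry set')}
    (h : ∀ u z w, ¬ p u → ¬ p' u → set' (set u z) w = set (set' u w) z)
    (hpp' : ∀ u w, p (set' u w) ↔ p u) (hp'p : ∀ u z, p' (set u z) ↔ p' u) :
    Commute (skipOp p hp μ set hset) (skipOp p' hp' μ' set' hset') := by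
  refine commute_skipOp_assignOp (fun u z w hu => ?_) (fun u w => ?_) fun u z hu =>
    skipKernel_congr (hp'p u z)
  · by_cases hu' : p' u
    · rw [skipSet_of_pos hu', skipSet_of_pos ((hp'p u z).2 hu')]
    · rw [skipSet_of_neg hu', skipSet_of_neg (fun h' => hu' ((hp'p u z).1 h')), h u z w hu hu']
  · by_cases hu' : p' u
    · rw [skipSet_of_pos hu']
    · rw [skipSet_of_neg hu', hpp']

theorem commute_weigh_skipOp {d : measurableFunctions U}
    (h : ∀ u z, ¬ p u → d.1 (set u z) = d.1 u) :
    Commute (weigh d) (skipOp p hp μ set hset) := by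
  refine commute_weigh_assignOp fun u z => ?_
  by_cases hu : p u
  · rw [skipSet_of_pos hu]
  · rw [skipSet_of_neg hu, h u z hu]

open Classical in
theorem stepOp_ite {S : U → Measure U} {p : U → Prop} {hp : MeasurableSet {u | p u}}
    (hS : ∀ u, S u = if p u then Measure.dirac u else assign (fun _ => μ) set u) :
    Measurable S ∧ stepOp S = skipOp p hp μ set hset := by
  have hm : Measurable S := by
    rw [funext hS]
    exact Measurable.ite hp Measure.measurable_dirac
      (measurable_assign (Kernel.const U μ) (fun _ => rfl) hset)
  refine ⟨hm, Op.ext fun F u => ?_⟩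
  rw [eval_stepOp hm, hS]
  by_cases hu : p u
  · rw [if_pos hu, eval_skipOp_of_pos hu, lintegral_dirac' _ F.2]
  · rw [if_neg hu, eval_skipOp_of_neg hu, assign, lintegral_map F.2 (measurable_uncurry_left hset u)]

/-- Averaging over all values of a family is the same as averaging over all but a selected one and
then over the selected one. -/
theorem prod_assignOp_eq_prod_skipOp_mul {k : ℕ} {f : Fin k → U → α → U}
    (hf : ∀ i, Measurable (Function.uncurry (f i))) {b : U → Fin k}
    (hb : ∀ i, MeasurableSet {u | i = b u}) {g : U → α → U} (hg : Measurable (Function.uncurry g))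
    (hfg : ∀ u, g u = f (b u) u) (hbf : ∀ i u z, b (f i u z) = b u)
    (hcomm : ∀ i j, i ≠ j → ∀ u z w, f j (f i u z) w = f i (f j u w) z) :
    ((List.finRange k).map fun i => assignOp (Kernel.const U μ) (f i) (hf i)).prod =
      ((List.finRange k).map fun i => skipOp (fun u => i = b u) (hb i) μ (f i) (hf i)).prod *
        assignOp (Kernel.const U μ) g hg := by
  refine Op.ext fun F u => ?_
  -- The selected index depends on the point, so the two sides are compared pointwise. No write
  -- alters the index, so it keeps its value at `u`, and the skipping product becomes the plain
  -- product with this one index deleted.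
  have key : ∀ (l : List (Fin k)) (u' : U), b u' = b u →
      ((l.map fun i => skipOp (fun u => i = b u) (hb i) μ (f i) (hf i)).prod *
        assignOp (Kernel.const U μ) g hg).eval F u' =
      (((l.filter (· ≠ b u)).map fun i => assignOp (Kernel.const U μ) (f i) (hf i)).prod *
        assignOp (Kernel.const U μ) (f (b u)) (hf (b u))).eval F u' := by
    intro l
    induction l with
    | nil =>
      intro u' hu'
      simp only [List.map_nil, List.prod_nil, one_mul, List.filter_nil, eval_assignOp, hfg, hu']
    | cons i l ih =>
      intro u' hu'
      rw [List.map_cons, List.prod_cons, mul_assoc, Op.eval_mul]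
      by_cases hi : i = b u
      · rw [eval_skipOp_of_pos (u := u') (hi.trans hu'.symm), List.filter_cons_of_neg (by simpa using hi)]
        exact ih u' hu'
      · have hi' : ¬ i = b u' := fun h => hi (h.trans hu')
        rw [eval_skipOp_of_neg (u := u') hi', List.filter_cons_of_pos (by simpa using hi), List.map_cons,
          List.prod_cons, mul_assoc, Op.eval_mul, eval_assignOp, Kernel.const_apply]
        exact lintegral_congr fun z => ih _ ((hbf i u' z).trans hu')
  rw [key _ u rfl]
  refine congrArg (fun O : Op U => O.eval F u) ?_
  -- For a fixed index it remains to move the selected factor to the end, which is harmless as the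
  -- factors commute.
  have hperm : (List.finRange k).Perm ((List.finRange k).filter (· ≠ b u) ++ [b u]) := by
    refine (List.perm_ext_iff_of_nodup (List.nodup_finRange k) ?_).2 fun i => ?_
    · rw [List.nodup_append]
      refine ⟨(List.nodup_finRange k).filter _, List.nodup_singleton _, ?_⟩
      simp
    · simp [em']
  rw [list_prod_perm hperm]
  · simp
  · refine pairwise_finRange fun i j hij => commute_assignOp (hcomm i j hij.ne)
      (fun _ _ => rfl) fun _ _ => rfl

end Skip

/-! ### The operators of the extended space -/

section ElementaryOperators

variable {n : ℕ} {N : Fin (n + 1) → ℕ} {C : Fin n → ℕ} {X : Type*} [MeasurableSpace X]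
  (lam : Measure X) [SFinite lam]

/-- Averages over the state of particle `i` of time `t`. -/
def stateOp (t : Fin (n + 1)) (i : Fin (N t)) : Op (ExtSpace N C X) :=
  assignOp (Kernel.const _ lam) (setState t i) (measurable_setState t i)

/-- Sums over the parent of particle `i` of time `s.succ`. -/
def parentOp (s : Fin n) (i : Fin (N s.succ)) : Op (ExtSpace N C X) :=
  assignOp (Kernel.const _ Measure.count) (setParent s i) (measurable_setParent s i)

/-- Sums over the selected index of time `t`. -/
def indexOp (t : Fin (n + 1)) : Op (ExtSpace N C X) :=
  assignOp (Kernel.const _ Measure.count) (setIndex t) (measurable_setIndex t)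

/-- Averages over position `j` of the path of run `s`. -/
def pathOp (s : Fin n) (j : Fin (C s + 1)) : Op (ExtSpace N C X) :=
  assignOp (Kernel.const _ lam) (setPath s j) (measurable_setPath s j)

/-- Averages over the selected particle of time `t`. -/
def selectedStateOp (t : Fin (n + 1)) : Op (ExtSpace N C X) :=
  assignOp (Kernel.const _ lam) (setSelectedState t) (measurable_setSelectedState t)

/-- Averages over the state of the selected trajectory at time `t`. -/
def selectedOp (t : Fin (n + 1)) : Op (ExtSpace N C X) :=
  assignOp (Kernel.const _ lam) (setSelected t) (measurable_setSelected t)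

/-- Sums over the parent of the selected particle of time `s.succ`. -/
def selectedParentOp (s : Fin n) : Op (ExtSpace N C X) :=
  assignOp (Kernel.const _ Measure.count) (setSelectedParent s) (measurable_setSelectedParent s)

theorem measurableSet_index_eq (t : Fin (n + 1)) (i : Fin (N t)) :
    MeasurableSet {u : ExtSpace N C X | i = u.2.2.1 t} :=
  measurable_index t (measurableSet_singleton i) |>.congr (by ext u; simp [eq_comm])

/-- Averages over the state of particle `i` of time `t`, unless it is selected. -/
def otherStateOp [Nonempty X] (t : Fin (n + 1)) (i : Fin (N t)) : Op (ExtSpace N C X) :=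
  skipOp (fun u => i = u.2.2.1 t) (measurableSet_index_eq t i) lam (setState t i)
    (measurable_setState t i)

/-- Sums over the parent of particle `i` of time `s.succ`, unless this particle is selected. -/
def otherParentOp [∀ t, NeZero (N t)] (s : Fin n) (i : Fin (N s.succ)) : Op (ExtSpace N C X) :=
  skipOp (fun u => i = u.2.2.1 s.succ) (measurableSet_index_eq s.succ i) Measure.count
    (setParent s i) (measurable_setParent s i)

variable (K : TransitionKernels N X)

/-- The transition kernel of run `s`, started at position `j` of the path. -/
def transitionKernel (s : Fin n) (j : Fin (C s + 1)) : Kernel (ExtSpace N C X) X :=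
  ⟨fun u => transition K s (path u s j) u, measurable_transition K s j⟩

theorem transitionKernel_apply (s : Fin n) (j : Fin (C s + 1)) (u : ExtSpace N C X) :
    transitionKernel K s j u = transition K s (path u s j) u := rfl

variable [∀ s b, IsMarkovKernel (K s b)]

instance (s : Fin n) (j : Fin (C s + 1)) :
    IsMarkovKernel (transitionKernel (C := C) K s j) :=
  ⟨fun u => inferInstanceAs (IsProbabilityMeasure (K s (u.2.2.1 s.castSucc) _))⟩

/-- A transition from position `j` to position `j + 1` of the path of run `s`. -/
def forwardOp (s : Fin n) (j : Fin (C s)) : Op (ExtSpace N C X) :=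
  assignOp (transitionKernel K s j.castSucc) (setPath s j.succ) (measurable_setPath s j.succ)

/-- A transition from position `j + 1` to position `j` of the path of run `s`. -/
def reverseOp (s : Fin n) (j : Fin (C s)) : Op (ExtSpace N C X) :=
  assignOp (transitionKernel K s j.succ) (setPath s j.castSucc) (measurable_setPath s j.castSucc)

/-- Averages over the states of all particles of time `t`. -/
def statesOp (t : Fin (n + 1)) : Op (ExtSpace N C X) :=
  ((List.finRange (N t)).map (stateOp lam t)).prod

/-- Sums over the parents of all particles of time `s.succ`. -/
def parentsOp (s : Fin n) : Op (ExtSpace N C X) :=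
  ((List.finRange (N s.succ)).map (parentOp s)).prod

/-- Averages over the states of all particles of time `t` but the selected one. -/
def otherStatesOp [Nonempty X] (t : Fin (n + 1)) : Op (ExtSpace N C X) :=
  ((List.finRange (N t)).map (otherStateOp lam t)).prod

/-- Sums over the parents of all particles of time `s.succ` but the selected one. -/
def otherParentsOp [∀ t, NeZero (N t)] (s : Fin n) : Op (ExtSpace N C X) :=
  ((List.finRange (N s.succ)).map (otherParentOp s)).prod

/-- Run `s` of the Markov chain. -/
def forwardRunOp (s : Fin n) : Op (ExtSpace N C X) :=
  ((List.finRange (C s)).map (forwardOp K s)).prod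

/-- Run `s` of the Markov chain, reversed in time. -/
def reverseRunOp (s : Fin n) : Op (ExtSpace N C X) :=
  ((List.finRange (C s)).reverse.map (reverseOp K s)).prod

end ElementaryOperators

/-! ### Commutation of averaging operators -/

section Commutation

variable {n : ℕ} {N : Fin (n + 1) → ℕ} {C : Fin n → ℕ} {X : Type*} [MeasurableSpace X]
  {lam : Measure X} [SFinite lam]

theorem commute_stateOp {t t' : Fin (n + 1)} {i : Fin (N t)} {i' : Fin (N t')}
    (h : (⟨t, i⟩ : Σ t, Fin (N t)) ≠ ⟨t', i'⟩) :
    Commute (stateOp (C := C) lam t i) (stateOp lam t' i') :=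
  commute_assignOp (fun u z w => setState_comm h u z w) (fun _ _ => rfl) fun _ _ => rfl

theorem commute_indexOp {t t' : Fin (n + 1)} (h : t ≠ t') :
    Commute (indexOp (N := N) (C := C) (X := X) t) (indexOp t') :=
  commute_assignOp (fun u z w => setIndex_comm h u z w) (fun _ _ => rfl) fun _ _ => rfl

theorem commute_stateOp_parentOp (t : Fin (n + 1)) (i : Fin (N t)) (s : Fin n)
    (j : Fin (N s.succ)) : Commute (stateOp (C := C) lam t i) (parentOp s j) :=
  commute_assignOp (fun _ _ _ => rfl) (fun _ _ => rfl) fun _ _ => rfl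

theorem commute_stateOp_indexOp (t : Fin (n + 1)) (i : Fin (N t)) (t' : Fin (n + 1)) :
    Commute (stateOp (C := C) lam t i) (indexOp t') :=
  commute_assignOp (fun _ _ _ => rfl) (fun _ _ => rfl) fun _ _ => rfl

theorem commute_parentOp_indexOp (s : Fin n) (j : Fin (N s.succ)) (t : Fin (n + 1)) :
    Commute (parentOp (C := C) (X := X) s j) (indexOp t) :=
  commute_assignOp (fun _ _ _ => rfl) (fun _ _ => rfl) fun _ _ => rfl

theorem commute_statesOp_parentsOp (t : Fin (n + 1)) (s : Fin n) :
    Commute (statesOp (N := N) (C := C) lam t) (parentsOp s) :=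
  list_prod_commute_list_prod fun i _ j _ => commute_stateOp_parentOp t i s j

theorem commute_statesOp_indexOp (t t' : Fin (n + 1)) :
    Commute (statesOp (N := N) (C := C) lam t) (indexOp t') :=
  list_prod_commute fun i _ => commute_stateOp_indexOp t i t'

theorem commute_parentsOp_indexOp (s : Fin n) (t : Fin (n + 1)) :
    Commute (parentsOp (N := N) (C := C) (X := X) s) (indexOp t) :=
  list_prod_commute fun i _ => commute_parentOp_indexOp s i t

variable {K : TransitionKernels N X}

/-- Apart from its starting state, a transition reads only its index and the conditioning variables;
these contain neither the selected particle of its time nor the parent of that particle. All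
commutations of transitions rest on this. -/
theorem transition_congr {s : Fin n} {u u' : ExtSpace N C X} (x : X)
    (hb : u.2.2.1 s.castSucc = u'.2.2.1 s.castSucc) (hz : selected u s.succ = selected u' s.succ)
    (hx : ∀ t i, t ≤ s.castSucc →
      (⟨t, i⟩ : Σ t, Fin (N t)) ≠ ⟨s.castSucc, u.2.2.1 s.castSucc⟩ → u.1 t i = u'.1 t i)
    (ha : ∀ (r : Fin n) i, r.succ ≤ s.castSucc →
      (⟨r.succ, i⟩ : Σ t, Fin (N t)) ≠ ⟨s.castSucc, u.2.2.1 s.castSucc⟩ →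
        u.2.1 r i = u'.2.1 r i) :
    transition K s x u = transition K s x u' := by
  unfold transition
  rw [← hb, hz]
  congr 2
  refine Prod.ext (funext fun p => ?_) (Prod.ext (funext fun p => ?_) rfl)
  · exact hx _ _ p.2.1 p.2.2
  · exact ha _ _ p.2.1 p.2.2

/-- A write on a path can be noticed by another run in two ways only: position `0` is a particle,
read by runs at later times, and the last position is the next selected state, read by the run one
step earlier. The two hypotheses exclude these cases. -/
theorem transition_setPath {s s' : Fin n} {j : Fin (C s + 1)} (x : X) (u : ExtSpace N C X) (z : X)
    (h : s'.castSucc < s.castSucc ∨ s' = s ∨ j ≠ 0)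
    (h' : s'.succ = s.castSucc → j ≠ Fin.last (C s)) :
    transition K s' x (setPath s j u z) = transition K s' x u := by
  refine transition_congr x (by rw [setPath_indices]) (selected_setPath_of_ne h' u z)
    (fun t i ht hi => ?_) fun r i _ _ => by rw [setPath_parents]
  rw [setPath_indices] at hi
  cases j using Fin.cases with
  | zero =>
    rcases h with h | rfl | h
    · exact setPath_states_of_ne (fun e => (ht.trans_lt h).ne (congrArg Sigma.fst e)) _ _
    · exact setPath_states_of_ne hi _ _
    · exact absurd rfl h
  | succ j => rfl

variable [∀ s b, IsMarkovKernel (K s b)]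

/-- Later runs do not read the selected indices of earlier times, so all indices may be drawn before
any run. -/
theorem commute_forwardOp_indexOp [∀ s, NeZero (C s)] {s s' : Fin n} (h : s < s') (j : Fin (C s')) :
    Commute (forwardOp (C := C) K s' j) (indexOp s.castSucc) := by
  have hne : s'.castSucc ≠ s.castSucc := fun e => h.ne' (Fin.castSucc_injective n e)
  refine commute_assignOp (fun u z k => rfl) (fun u k => ?_) fun _ _ => rfl
  rw [transitionKernel_apply, transitionKernel_apply]
  have hp : path (setIndex s.castSucc u k) s' j.castSucc = path u s' j.castSucc := by
    cases hj : j.castSucc using Fin.cases with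
    | zero => rw [path_zero, path_zero, setIndex_of_ne hne]; rfl
    | succ i => rfl
  rw [hp]
  exact transition_congr _ (setIndex_of_ne hne _ _)
    (selected_setIndex_of_lt s.castSucc_lt_last _ _) (fun _ _ _ _ => rfl) fun _ _ _ _ => rfl

theorem commute_forwardRunOp_indexOp [∀ s, NeZero (C s)] {s s' : Fin n} (h : s < s') :
    Commute (forwardRunOp (C := C) K s') (indexOp s.castSucc) :=
  list_prod_commute fun j _ => commute_forwardOp_indexOp h j

end Commutation

/-! ### Products of weights -/

section WeighProducts

variable {U : Type*} [MeasurableSpace U]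

theorem weigh_prod {k : ℕ} (d : Fin k → measurableFunctions U) :
    weigh (∏ i, d i) = ((List.finRange k).map fun i => weigh (d i)).prod := by
  rw [← List.prod_ofFn, map_list_prod, List.ofFn_eq_map, List.map_map]
  rfl

theorem weigh_prod_reverse {k : ℕ} (d : Fin k → measurableFunctions U) :
    weigh (∏ i, d i) = ((List.finRange k).reverse.map fun i => weigh (d i)).prod := by
  rw [weigh_prod]
  exact list_prod_perm (List.reverse_perm _).symm (pairwise_finRange fun _ _ _ => commute_weigh _ _)

theorem commute_weigh_prod {k : ℕ} {d : Fin k → measurableFunctions U} {O : Op U}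
    (h : ∀ i, Commute (weigh (d i)) O) : Commute (weigh (∏ i, d i)) O := by
  rw [weigh_prod]
  exact list_prod_commute fun i _ => h i

theorem commute_weigh_mul {d e : measurableFunctions U} {O : Op U}
    (hd : Commute (weigh d) O) (he : Commute (weigh e) O) : Commute (weigh (d * e)) O := by
  rw [map_mul]
  exact hd.mul_left he

theorem prod_finiteFunction_apply {k : ℕ} {d : Fin k → U → ℝ≥0} (hd : ∀ i, Measurable (d i))
    (u : U) : (∏ i, finiteFunction (d i) (hd i)).1 u = ((∏ i, d i u : ℝ≥0) : ℝ≥0∞) := by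
  rw [Submonoid.coe_finsetProd, Finset.prod_apply, ENNReal.ofNNReal_finsetProd]
  rfl

end WeighProducts

/-! ### The proposal law -/

section Proposal

variable {n : ℕ} {N : Fin (n + 1) → ℕ} {C : Fin n → ℕ} {X Y : Type*} [MeasurableSpace X]
  [MeasurableSpace Y] {lam : Measure X} {nu : Measure Y}
  (m : StateSpaceModel n X Y lam nu) (q : ImportanceDensities n X Y lam) (y : Fin (n + 1) → Y)

theorem weight_congr {x x' : States N X} {a a' : Parents N} {t : Fin (n + 1)} (hx : x t = x' t)
    (h : ∀ s : Fin n, t = s.succ → x s.castSucc = x' s.castSucc ∧ a s = a' s) :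
    weight m q y x a t = weight m q y x' a' t := by
  cases t using Fin.cases with
  | zero => simp only [weight, Fin.cases_zero, hx]
  | succ s => simp only [weight, Fin.cases_succ, hx, h s rfl]

theorem weight_setState {t t' : Fin (n + 1)} (h : t < t') (i : Fin (N t')) (u : ExtSpace N C X)
    (z : X) : weight m q y (setState t' i u z).1 (setState t' i u z).2.1 t =
      weight m q y u.1 u.2.1 t := by
  refine weight_congr m q y (setState_time h.ne _ _ _) fun s hs => ⟨setState_time ?_ _ _ _, rfl⟩
  subst hs
  exact (s.castSucc_lt_succ.trans h).ne

theorem weight_setParent {t : Fin (n + 1)} {s : Fin n} (h : t < s.succ) (i : Fin (N s.succ))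
    (u : ExtSpace N C X) (k : Fin (N s.castSucc)) :
    weight m q y (setParent s i u k).1 (setParent s i u k).2.1 t = weight m q y u.1 u.2.1 t := by
  refine weight_congr m q y rfl fun r hr => ⟨rfl, setParent_time ?_ _ _ _⟩
  rintro rfl
  exact h.ne hr

theorem measurable_initialDensity (i : Fin (N 0)) :
    Measurable fun u : ExtSpace N C X => q.M₁ (y 0) (u.1 0 i) :=
  (q.measurable_M₁ (y 0)).comp (measurable_state 0 i)

/-- The density of particle `i` of the first time. -/
def initialDensity (i : Fin (N 0)) : measurableFunctions (ExtSpace N C X) :=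
  finiteFunction _ (measurable_initialDensity q y i)

theorem initialDensity_apply (i : Fin (N 0)) (u : ExtSpace N C X) :
    (initialDensity q y i).1 u = q.M₁ (y 0) (u.1 0 i) := rfl

theorem measurable_proposalDensity (s : Fin n) (i : Fin (N s.succ)) :
    Measurable fun u : ExtSpace N C X =>
      q.M s (y s.succ) (u.1 s.castSucc (u.2.1 s i)) (u.1 s.succ i) :=
  (q.measurable_M s (y s.succ)).comp ((measurable_parentState s i).prodMk (measurable_state _ _))

/-- The density of particle `i` of time `s.succ`, given its parent. -/
def proposalDensity (s : Fin n) (i : Fin (N s.succ)) : measurableFunctions (ExtSpace N C X) :=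
  finiteFunction _ (measurable_proposalDensity q y s i)

theorem proposalDensity_apply (s : Fin n) (i : Fin (N s.succ)) (u : ExtSpace N C X) :
    (proposalDensity q y s i).1 u =
      q.M s (y s.succ) (u.1 s.castSucc (u.2.1 s i)) (u.1 s.succ i) := rfl

theorem measurable_parentProb (s : Fin n) (i : Fin (N s.succ)) :
    Measurable fun u : ExtSpace N C X =>
      normalize (weight m q y u.1 u.2.1 s.castSucc) (u.2.1 s i) :=
  measurable_apply_index (fun k => measurable_normalize (measurable_weight m q y s.castSucc) k)
    (measurable_parent s i)

/-- The probability of the parent of particle `i` of time `s.succ`. -/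
def parentProb (s : Fin n) (i : Fin (N s.succ)) : measurableFunctions (ExtSpace N C X) :=
  finiteFunction _ (measurable_parentProb m q y s i)

theorem parentProb_apply (s : Fin n) (i : Fin (N s.succ)) (u : ExtSpace N C X) :
    (parentProb m q y s i).1 u =
      normalize (weight m q y u.1 u.2.1 s.castSucc) (u.2.1 s i) := rfl

theorem measurable_finalProb :
    Measurable fun u : ExtSpace N C X =>
      normalize (weight m q y u.1 u.2.1 (Fin.last n)) (u.2.2.1 (Fin.last n)) :=
  measurable_apply_index (fun k => measurable_normalize (measurable_weight m q y _) k)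
    (measurable_index _)

/-- The probability of the selected index of the final time. -/
def finalProb : measurableFunctions (ExtSpace N C X) :=
  finiteFunction _ (measurable_finalProb m q y)

theorem finalProb_apply (u : ExtSpace N C X) :
    (finalProb m q y).1 u =
      normalize (weight m q y u.1 u.2.1 (Fin.last n)) (u.2.2.1 (Fin.last n)) := rfl

theorem measurable_backwardProb (s : Fin n) :
    Measurable fun u : ExtSpace N C X =>
      normalize (backwardWeight m q y u.1 u.2.1 (selected u s.succ) s) (u.2.2.1 s.castSucc) :=
  measurable_apply_index (fun k => measurable_normalize
    (fun i => measurable_backwardWeight m q y s i (measurable_selected _)) k) (measurable_index _)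

/-- The backward probability of the selected index of time `s.castSucc`. -/
def backwardProb (s : Fin n) : measurableFunctions (ExtSpace N C X) :=
  finiteFunction _ (measurable_backwardProb m q y s)

theorem backwardProb_apply (s : Fin n) (u : ExtSpace N C X) :
    (backwardProb m q y s).1 u =
      normalize (backwardWeight m q y u.1 u.2.1 (selected u s.succ) s) (u.2.2.1 s.castSucc) := rfl

variable {m q y}

theorem commute_initialDensity_stateOp [SFinite lam] {i : Fin (N 0)} {t : Fin (n + 1)}
    {j : Fin (N t)} (h : (⟨0, i⟩ : Σ t, Fin (N t)) ≠ ⟨t, j⟩) :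
    Commute (weigh (initialDensity (N := N) (C := C) q y i)) (stateOp lam t j) :=
  commute_weigh_assignOp fun u z => by
    simp only [initialDensity_apply, setState_of_ne h]

theorem commute_parentProb_stateOp [SFinite lam] {s : Fin n} {t : Fin (n + 1)} (h : s.castSucc < t)
    (i : Fin (N s.succ)) (j : Fin (N t)) :
    Commute (weigh (parentProb (N := N) (C := C) m q y s i)) (stateOp lam t j) :=
  commute_weigh_assignOp fun u z => by
    simp only [parentProb_apply, weight_setState m q y h]
    rfl

theorem commute_parentProb_parentOp {s s' : Fin n} (hs : s ≤ s') {i : Fin (N s.succ)}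
    {j : Fin (N s'.succ)} (h : (⟨s, i⟩ : Σ s : Fin n, Fin (N s.succ)) ≠ ⟨s', j⟩) :
    Commute (weigh (parentProb (N := N) (C := C) m q y s i)) (parentOp s' j) :=
  commute_weigh_assignOp fun u z => by
    simp only [parentProb_apply, setParent_of_ne h,
      weight_setParent m q y (lt_of_lt_of_le s.castSucc_lt_succ (Fin.succ_le_succ_iff.2 hs))]

theorem commute_proposalDensity_stateOp [SFinite lam] {s : Fin n} {t : Fin (n + 1)}
    (ht : s.succ ≤ t) {i : Fin (N s.succ)} {j : Fin (N t)}
    (h : (⟨s.succ, i⟩ : Σ t, Fin (N t)) ≠ ⟨t, j⟩) :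
    Commute (weigh (proposalDensity (N := N) (C := C) q y s i)) (stateOp lam t j) :=
  commute_weigh_assignOp fun u z => by
    simp only [proposalDensity_apply, setState_of_ne h]
    rw [setState_time (lt_of_lt_of_le s.castSucc_lt_succ ht).ne]
    rfl

theorem commute_proposalDensity_parentOp {s s' : Fin n} {i : Fin (N s.succ)}
    {j : Fin (N s'.succ)} (h : (⟨s, i⟩ : Σ s : Fin n, Fin (N s.succ)) ≠ ⟨s', j⟩) :
    Commute (weigh (proposalDensity (N := N) (C := C) q y s i)) (parentOp s' j) :=
  commute_weigh_assignOp fun u z => by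
    simp only [proposalDensity_apply, setParent_of_ne h]
    rfl

/-- The density of the particle filter. -/
def filterFunction (m : StateSpaceModel n X Y lam nu) (q : ImportanceDensities n X Y lam)
    (y : Fin (n + 1) → Y) : measurableFunctions (ExtSpace N C X) :=
  (∏ i, initialDensity q y i) *
    ∏ s, (∏ i, parentProb m q y s i) * ∏ i, proposalDensity q y s i

theorem filterFunction_apply (u : ExtSpace N C X) :
    (filterFunction m q y).1 u = (filterDensity m q y u.1 u.2.1 : ℝ≥0∞) := by
  unfold filterFunction filterDensity initialDensity parentProb proposalDensity
  rw [Submonoid.coe_mul, Pi.mul_apply, prod_finiteFunction_apply, Submonoid.coe_finsetProd,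
    Finset.prod_apply, ENNReal.coe_mul, ENNReal.ofNNReal_finsetProd (s := Finset.univ)
      (f := fun s : Fin n => _)]
  congr 1
  refine Finset.prod_congr rfl fun s _ => ?_
  rw [Submonoid.coe_mul, Pi.mul_apply, prod_finiteFunction_apply, prod_finiteFunction_apply,
    ENNReal.coe_mul]

theorem stepOp_assign_withDensity [SFinite lam] {U : Type*} [MeasurableSpace U] {set : U → X → U}
    {hset : Measurable (Function.uncurry set)} {δ : U → X → ℝ≥0}
    (hδ : Measurable (Function.uncurry δ)) {d : measurableFunctions U}
    (h : ∀ u z, d.1 (set u z) = δ u z) :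
    stepOp (assign (fun u => lam.withDensity fun z => (δ u z : ℝ≥0∞)) set) =
        assignOp (Kernel.const U lam) set hset * weigh d ∧
      Measurable (assign (fun u => lam.withDensity fun z => (δ u z : ℝ≥0∞)) set) := by
  have hκ : ∀ u, lam.withDensity (fun z => (δ u z : ℝ≥0∞)) =
      (Kernel.const U lam).withDensity (fun u z => (δ u z : ℝ≥0∞)) u := fun u => by
    rw [Kernel.withDensity_apply _ hδ.coe_nnreal_ennreal, Kernel.const_apply]
  exact ⟨by rw [stepOp_assign _ hκ hset, assignOp_withDensity hδ h], measurable_assign _ hκ hset⟩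

theorem stepOp_assign_categorical {U : Type*} [MeasurableSpace U] {k : ℕ} {set : U → Fin k → U}
    {hset : Measurable (Function.uncurry set)} {v : U → Fin k → ℝ≥0}
    (hv : ∀ i, Measurable fun u => v u i) {d : measurableFunctions U}
    (h : ∀ u i, d.1 (set u i) = v u i) :
    stepOp (assign (fun u => categorical (v u)) set) =
        assignOp (Kernel.const U Measure.count) set hset * weigh d ∧
      Measurable (assign (fun u => categorical (v u)) set) := by
  have hδ : Measurable (Function.uncurry v) := by
    refine measurable_from_prod_countable_left fun i => hv i
  have hκ : ∀ u, categorical (v u) =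
      (Kernel.const U Measure.count).withDensity (fun u z => (v u z : ℝ≥0∞)) u := fun u => by
    rw [Kernel.withDensity_apply _ hδ.coe_nnreal_ennreal, Kernel.const_apply,
      categorical_eq_withDensity]
  exact ⟨by rw [stepOp_assign _ hκ hset, assignOp_withDensity hδ h], measurable_assign _ hκ hset⟩

theorem initialStep [SFinite lam] (i : Fin (N 0)) :
    stepOp (assign (fun _ : ExtSpace N C X => lam.withDensity fun z => (q.M₁ (y 0) z : ℝ≥0∞))
        (setState 0 i)) = stateOp lam 0 i * weigh (initialDensity q y i) ∧
      Measurable (assign (fun _ : ExtSpace N C X =>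
        lam.withDensity fun z => (q.M₁ (y 0) z : ℝ≥0∞)) (setState 0 i)) := by
  refine stepOp_assign_withDensity (δ := fun _ z => q.M₁ (y 0) z)
    ((q.measurable_M₁ (y 0)).comp measurable_snd) fun u z => ?_
  rw [initialDensity_apply, setState_self]

theorem parentStep (s : Fin n) (i : Fin (N s.succ)) :
    stepOp (assign (fun u : ExtSpace N C X =>
        categorical (normalize (weight m q y u.1 u.2.1 s.castSucc))) (setParent s i)) =
        parentOp s i * weigh (parentProb m q y s i) ∧
      Measurable (assign (fun u : ExtSpace N C X =>
        categorical (normalize (weight m q y u.1 u.2.1 s.castSucc))) (setParent s i)) := by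
  refine stepOp_assign_categorical
    (fun i => measurable_normalize (measurable_weight m q y s.castSucc) i) fun u k => ?_
  rw [parentProb_apply, setParent_self,
    weight_setParent m q y s.castSucc_lt_succ]

theorem stateStep [SFinite lam] (s : Fin n) (i : Fin (N s.succ)) :
    stepOp (assign (fun u : ExtSpace N C X => lam.withDensity fun z =>
        (q.M s (y s.succ) (u.1 s.castSucc (u.2.1 s i)) z : ℝ≥0∞)) (setState s.succ i)) =
        stateOp lam s.succ i * weigh (proposalDensity q y s i) ∧
      Measurable (assign (fun u : ExtSpace N C X => lam.withDensity fun z =>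
        (q.M s (y s.succ) (u.1 s.castSucc (u.2.1 s i)) z : ℝ≥0∞)) (setState s.succ i)) := by
  have hδ : Measurable fun p : ExtSpace N C X × X =>
      q.M s (y s.succ) (p.1.1 s.castSucc (p.1.2.1 s i)) p.2 :=
    (q.measurable_M s (y s.succ)).comp
      (((measurable_parentState s i).comp measurable_fst).prodMk measurable_snd)
  refine stepOp_assign_withDensity
    (δ := fun (u : ExtSpace N C X) z => q.M s (y s.succ) (u.1 s.castSucc (u.2.1 s i)) z)
    hδ fun u z => ?_
  rw [proposalDensity_apply, setState_self, setState_time s.castSucc_lt_succ.ne]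
  rfl

theorem finalIndexStep :
    stepOp (assign (fun u : ExtSpace N C X =>
        categorical (normalize (weight m q y u.1 u.2.1 (Fin.last n)))) (setIndex (Fin.last n))) =
        indexOp (Fin.last n) * weigh (finalProb m q y) ∧
      Measurable (assign (fun u : ExtSpace N C X =>
        categorical (normalize (weight m q y u.1 u.2.1 (Fin.last n)))) (setIndex (Fin.last n))) := by
  refine stepOp_assign_categorical
    (fun i => measurable_normalize (measurable_weight m q y _) i) fun u k => ?_
  rw [finalProb_apply, setIndex_self]
  rfl

theorem indexStep [∀ s, NeZero (C s)] (s : Fin n) :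
    stepOp (assign (fun u : ExtSpace N C X =>
        categorical (normalize (backwardWeight m q y u.1 u.2.1 (selected u s.succ) s)))
        (setIndex s.castSucc)) = indexOp s.castSucc * weigh (backwardProb m q y s) ∧
      Measurable (assign (fun u : ExtSpace N C X =>
        categorical (normalize (backwardWeight m q y u.1 u.2.1 (selected u s.succ) s)))
        (setIndex s.castSucc)) := by
  refine stepOp_assign_categorical (fun i => measurable_normalize
    (fun i => measurable_backwardWeight m q y s i (measurable_selected _)) i) fun u k => ?_
  rw [backwardProb_apply, setIndex_self,
    selected_setIndex_of_lt s.castSucc_lt_last]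
  rfl

variable {K : TransitionKernels N X} [∀ s b, IsMarkovKernel (K s b)]

theorem forwardStep (s : Fin n) (j : Fin (C s)) :
    stepOp (assign (fun u : ExtSpace N C X => transition K s (path u s j.castSucc) u)
        (setPath s j.succ)) = forwardOp K s j ∧
      Measurable (assign (fun u : ExtSpace N C X => transition K s (path u s j.castSucc) u)
        (setPath s j.succ)) :=
  ⟨stepOp_assign (transitionKernel K s j.castSucc) (fun _ => rfl) _,
    measurable_assign (transitionKernel K s j.castSucc) (fun _ => rfl) (measurable_setPath s j.succ)⟩

theorem reverseStep (s : Fin n) (j : Fin (C s)) :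
    stepOp (assign (fun u : ExtSpace N C X => transition K s (path u s j.succ) u)
        (setPath s j.castSucc)) = reverseOp K s j ∧
      Measurable (assign (fun u : ExtSpace N C X => transition K s (path u s j.succ) u)
        (setPath s j.castSucc)) :=
  ⟨stepOp_assign (transitionKernel K s j.succ) (fun _ => rfl) _, measurable_assign (transitionKernel K s j.succ)
    (fun _ => rfl) (measurable_setPath s j.castSucc)⟩

/-- Every density of the particle filter reads only variables drawn before it or together with it,
so each one passes all later draws. The remaining reference integrals and sums no longer interact
and can be sorted. -/
theorem prod_stepOp_filterSteps [SFinite lam] :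
    ((filterSteps (N := N) (C := C) m q y).map stepOp).prod =
      ((List.finRange (n + 1)).map fun t => statesOp lam t).prod *
        ((List.finRange n).map fun s => parentsOp s).prod * weigh (filterFunction m q y) := by
  have h0 : ((List.finRange (N 0)).map fun i =>
      stateOp (N := N) (C := C) lam 0 i * weigh (initialDensity q y i)).prod =
      statesOp lam 0 * weigh (∏ i, initialDensity q y i) := by
    rw [list_prod_map_mul (pairwise_finRange fun i j hij => commute_initialDensity_stateOp
      fun h => hij.ne (by simpa using h)), weigh_prod]
    rfl
  have h1 : ∀ s : Fin n, ((List.finRange (N s.succ)).map fun i =>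
      parentOp (N := N) (C := C) s i * weigh (parentProb m q y s i)).prod =
      parentsOp s * weigh (∏ i, parentProb m q y s i) := fun s => by
    rw [list_prod_map_mul (pairwise_finRange fun i j hij => commute_parentProb_parentOp le_rfl
      fun h => hij.ne (by simpa using h)), weigh_prod]
    rfl
  have h2 : ∀ s : Fin n, ((List.finRange (N s.succ)).map fun i =>
      stateOp (N := N) (C := C) lam s.succ i * weigh (proposalDensity q y s i)).prod =
      statesOp lam s.succ * weigh (∏ i, proposalDensity q y s i) := fun s => by
    rw [list_prod_map_mul (pairwise_finRange fun i j hij => commute_proposalDensity_stateOp le_rfl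
      fun h => hij.ne (by simpa using h)), weigh_prod]
    rfl
  have h3 : ∀ s : Fin n, Commute (weigh (∏ i, parentProb (N := N) (C := C) m q y s i))
      (statesOp lam s.succ) := fun s =>
    commute_weigh_prod fun i => commute_list_prod fun j _ =>
      commute_parentProb_stateOp s.castSucc_lt_succ i j
  have hA : ((List.finRange (n + 1)).map fun t => statesOp (N := N) (C := C) lam t).prod =
      statesOp lam 0 * ((List.finRange n).map fun s => statesOp lam s.succ).prod := by
    rw [List.finRange_succ, List.map_cons, List.prod_cons, List.map_map]
    rfl
  rw [filterSteps, List.map_append, List.prod_append, List.map_map, List.map_flatMap,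
    prod_flatMap]
  simp only [List.map_append, List.prod_append, List.map_map, Function.comp_def,
    (initialStep _).1, (parentStep _ _).1, (stateStep _ _).1, h0, h1, h2]
  have h4 : ∀ s : Fin n, parentsOp s * weigh (∏ i, parentProb (N := N) (C := C) m q y s i) *
      (statesOp lam s.succ * weigh (∏ i, proposalDensity q y s i)) =
      (parentsOp s * statesOp lam s.succ) *
        weigh ((∏ i, parentProb m q y s i) * ∏ i, proposalDensity q y s i) := fun s => by
    rw [map_mul, mul_assoc, ← mul_assoc (weigh _), (h3 s).eq]
    simp only [mul_assoc]
  simp only [h4]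
  rw [list_prod_map_mul, list_prod_map_mul, ← weigh_prod, hA, filterFunction, map_mul]
  · have hc : Commute (weigh (∏ i, initialDensity (N := N) (C := C) q y i))
        (((List.finRange n).map fun s => parentsOp s).prod *
          ((List.finRange n).map fun s => statesOp lam s.succ).prod) := by
      refine commute_weigh_prod fun i => Commute.mul_right ?_ ?_
      · exact commute_list_prod fun s _ => commute_list_prod fun j _ =>
          commute_weigh_assignOp fun _ _ => rfl
      · exact commute_list_prod fun s _ => commute_list_prod fun j _ =>
          commute_initialDensity_stateOp fun h => (Fin.succ_ne_zero s).symm (congrArg Sigma.fst h)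
    have hc' : Commute ((List.finRange n).map fun s => parentsOp (N := N) (C := C) (X := X) s).prod
        ((List.finRange n).map fun s => statesOp (N := N) lam s.succ).prod :=
      list_prod_commute_list_prod fun s _ r _ => (commute_statesOp_parentsOp _ _).symm
    rw [mul_assoc (statesOp lam 0), ← mul_assoc (weigh _), hc.eq, hc'.eq]
    simp only [mul_assoc]
  · exact pairwise_finRange fun s s' h => commute_statesOp_parentsOp _ _
  · refine pairwise_finRange fun s s' h => commute_weigh_mul ?_ ?_
    · refine commute_weigh_prod fun i => Commute.mul_right ?_ ?_
      · exact commute_list_prod fun j _ => commute_parentProb_parentOp h.le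
          fun e => h.ne (congrArg Sigma.fst e)
      · exact commute_list_prod fun j _ => commute_parentProb_stateOp
          (s.castSucc_lt_succ.trans (Fin.succ_lt_succ_iff.2 h)) i j
    · refine commute_weigh_prod fun i => Commute.mul_right ?_ ?_
      · exact commute_list_prod fun j _ => commute_proposalDensity_parentOp
          fun e => h.ne (congrArg Sigma.fst e)
      · exact commute_list_prod fun j _ => commute_proposalDensity_stateOp
          (Fin.succ_le_succ_iff.2 h.le)
          fun e => h.ne (Fin.succ_injective n (congrArg Sigma.fst e))

end Proposal

/-! ### Normal form of the proposal law -/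

section ProposalNormalForm

variable {n : ℕ} {N : Fin (n + 1) → ℕ} {C : Fin n → ℕ} {X Y : Type*} [MeasurableSpace X]
  [MeasurableSpace Y] {lam : Measure X} {nu : Measure Y}
  {m : StateSpaceModel n X Y lam nu} {q : ImportanceDensities n X Y lam} {y : Fin (n + 1) → Y}
  {K : TransitionKernels N X} [∀ s b, IsMarkovKernel (K s b)]

theorem commute_filterFunction_indexOp (t : Fin (n + 1)) :
    Commute (weigh (filterFunction (N := N) (C := C) m q y)) (indexOp t) :=
  commute_weigh_assignOp fun u k => by
    rw [filterFunction_apply, filterFunction_apply]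
    rfl

theorem commute_filterFunction_forwardRunOp (s : Fin n) :
    Commute (weigh (filterFunction (N := N) (C := C) m q y)) (forwardRunOp K s) :=
  commute_list_prod fun j _ => commute_weigh_assignOp fun u z => by
    rw [filterFunction_apply, filterFunction_apply]
    rfl

theorem commute_finalProb_indexOp {t : Fin (n + 1)} (h : t < Fin.last n) :
    Commute (weigh (finalProb (N := N) (C := C) m q y)) (indexOp t) :=
  commute_weigh_assignOp fun u k => by
    rw [finalProb_apply, finalProb_apply, setIndex_of_ne h.ne']
    rfl

theorem commute_finalProb_forwardRunOp (s : Fin n) :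
    Commute (weigh (finalProb (N := N) (C := C) m q y)) (forwardRunOp K s) :=
  commute_list_prod fun _ _ => commute_weigh_assignOp fun _ _ => rfl

theorem commute_backwardProb_forwardRunOp {s s' : Fin n} (h : s' ≤ s) :
    Commute (weigh (backwardProb (N := N) (C := C) m q y s)) (forwardRunOp K s') :=
  commute_list_prod fun j _ => commute_weigh_assignOp fun u z => by
    rw [backwardProb_apply, backwardProb_apply, selected_setPath_of_ne]
    · rfl
    · intro e
      exact absurd e (lt_of_le_of_lt (Fin.castSucc_le_castSucc_iff.2 h) s.castSucc_lt_succ).ne'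

theorem commute_backwardProb_indexOp [∀ s, NeZero (C s)] {s s' : Fin n} (h : s' < s) :
    Commute (weigh (backwardProb (N := N) (C := C) m q y s)) (indexOp s'.castSucc) :=
  commute_weigh_assignOp fun u k => by
    rw [backwardProb_apply, backwardProb_apply, selected_setIndex_of_lt s'.castSucc_lt_last,
      setIndex_of_ne fun e => h.ne' (Fin.castSucc_injective n e)]
    rfl

/-- The density of the proposal law. -/
def proposalFunction (m : StateSpaceModel n X Y lam nu) (q : ImportanceDensities n X Y lam)
    (y : Fin (n + 1) → Y) : measurableFunctions (ExtSpace N C X) :=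
  filterFunction m q y * finalProb m q y * ∏ s, backwardProb m q y s

theorem prod_indexOp :
    (indexOp (N := N) (C := C) (X := X) (Fin.last n) *
      ((List.finRange n).reverse.map fun s => indexOp s.castSucc).prod) =
      ((List.finRange (n + 1)).map fun t => indexOp t).prod := by
  have h : ((List.finRange n).reverse.map fun s =>
      indexOp (N := N) (C := C) (X := X) s.castSucc).prod =
      ((List.finRange n).map fun s => indexOp s.castSucc).prod :=
    list_prod_perm (List.reverse_perm _) (pairwise_finRange_reverse fun s s' hs =>
      commute_indexOp fun e => hs.ne' (Fin.castSucc_injective n e))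
  rw [h, List.finRange_succ_last, List.map_append, List.prod_append, List.map_map, List.map_cons,
    List.map_nil, List.prod_singleton]
  exact (commute_list_prod fun s _ => commute_indexOp s.castSucc_lt_last.ne').eq

/-- The backward probability at a time reads the state selected one step later, which is drawn
already; it therefore passes the run at its own time and everything that happens at earlier times.
-/
theorem prod_stepOp_backwardSteps [∀ s, NeZero (C s)] :
    ((backwardSteps (N := N) (C := C) m q y K).map stepOp).prod =
      ((List.finRange (n + 1)).map fun t => indexOp t).prod *
        ((List.finRange n).reverse.map fun s => forwardRunOp K s).prod *
        weigh (finalProb m q y * ∏ s, backwardProb m q y s) := by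
  rw [backwardSteps, List.map_cons, List.prod_cons, List.map_flatMap, prod_flatMap]
  simp only [List.map_cons, List.prod_cons, List.map_map, Function.comp_def, finalIndexStep.1,
    (indexStep _).1, (forwardStep _ _).1]
  have h1 : ∀ s : Fin n, indexOp s.castSucc * weigh (backwardProb m q y s) *
      ((List.finRange (C s)).map fun j => forwardOp K s j).prod =
      (indexOp s.castSucc * forwardRunOp K s) * weigh (backwardProb m q y s) := fun s => by
    rw [mul_assoc, mul_assoc, ← (commute_backwardProb_forwardRunOp le_rfl).eq]
    rfl
  simp only [h1]
  rw [list_prod_map_mul, list_prod_map_mul, ← weigh_prod_reverse, map_mul, ← prod_indexOp]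
  · have hc : Commute (weigh (finalProb (N := N) (C := C) m q y))
        (((List.finRange n).reverse.map fun s => indexOp s.castSucc).prod *
          ((List.finRange n).reverse.map fun s => forwardRunOp K s).prod) :=
      Commute.mul_right
        (commute_list_prod fun s _ => commute_finalProb_indexOp s.castSucc_lt_last)
        (commute_list_prod fun s _ => commute_finalProb_forwardRunOp s)
    rw [mul_assoc (indexOp _), ← mul_assoc (weigh _), hc.eq]
    simp only [mul_assoc]
  · exact pairwise_finRange_reverse fun s s' h => commute_forwardRunOp_indexOp h
  · exact pairwise_finRange_reverse fun s s' h => Commute.mul_right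
      (commute_backwardProb_indexOp h) (commute_backwardProb_forwardRunOp h.le)

/-- The chronology of the sampler survives only in the order of the forward runs; all other
dependence is collected in one density. -/
theorem prod_stepOp_proposal [SFinite lam] [∀ s, NeZero (C s)] :
    ((filterSteps (N := N) (C := C) m q y ++ backwardSteps m q y K).map stepOp).prod =
      ((List.finRange (n + 1)).map fun t => indexOp t).prod *
        ((List.finRange n).map fun s => parentsOp s).prod *
        ((List.finRange (n + 1)).map fun t => statesOp lam t).prod *
        ((List.finRange n).reverse.map fun s => forwardRunOp K s).prod *
        weigh (proposalFunction m q y) := by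
  rw [List.map_append, List.prod_append, prod_stepOp_filterSteps, prod_stepOp_backwardSteps,
    proposalFunction, mul_assoc (filterFunction m q y), map_mul weigh (filterFunction m q y)]
  have h1 : Commute (weigh (filterFunction (N := N) (C := C) m q y))
      (((List.finRange (n + 1)).map fun t => indexOp t).prod *
        ((List.finRange n).reverse.map fun s => forwardRunOp K s).prod) :=
    Commute.mul_right (commute_list_prod fun t _ => commute_filterFunction_indexOp t)
      (commute_list_prod fun s _ => commute_filterFunction_forwardRunOp s)
  have h2 : Commute (((List.finRange (n + 1)).map fun t => statesOp lam t).prod *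
        ((List.finRange n).map fun s => parentsOp s).prod)
      ((List.finRange (n + 1)).map fun t => indexOp (N := N) (C := C) (X := X) t).prod :=
    Commute.mul_left
      (list_prod_commute_list_prod fun t _ t' _ => commute_statesOp_indexOp t t')
      (list_prod_commute_list_prod fun s _ t _ => commute_parentsOp_indexOp s t)
  have h3 : Commute ((List.finRange (n + 1)).map fun t => statesOp (N := N) (C := C) lam t).prod
      ((List.finRange n).map fun s => parentsOp (N := N) s).prod :=
    list_prod_commute_list_prod fun t _ s _ => commute_statesOp_parentsOp t s
  rw [mul_assoc _ (weigh _), ← mul_assoc (weigh (filterFunction m q y)), h1.eq]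
  simp only [← mul_assoc]
  rw [h2.eq, h3.eq]
  simp only [← mul_assoc]

theorem measurable_proposalSteps [SFinite lam] [∀ s, NeZero (C s)] :
    ∀ S ∈ filterSteps (N := N) (C := C) m q y ++ backwardSteps m q y K, Measurable S := by
  intro S hS
  simp only [filterSteps, backwardSteps, List.mem_append, List.mem_map, List.mem_finRange,
    true_and, List.mem_flatMap, List.mem_cons, List.mem_reverse] at hS
  rcases hS with (⟨i, rfl⟩ | ⟨s, ⟨i, rfl⟩ | ⟨i, rfl⟩⟩) | rfl | ⟨s, rfl | ⟨j, rfl⟩⟩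
  · exact (initialStep i).2
  · exact (parentStep s i).2
  · exact (stateStep s i).2
  · exact finalIndexStep.2
  · exact (indexStep s).2
  · exact (forwardStep s j).2

theorem weight_pos (hq : q.Positive) (x : States N X) (a : Parents N) (t : Fin (n + 1))
    (i : Fin (N t)) : 0 < weight m q y x a t i := by
  cases t using Fin.cases with
  | zero => exact div_pos (mul_pos (m.g_pos _ _ _) (m.f₁_pos _)) (hq.1 _ _)
  | succ s => exact div_pos (mul_pos (m.g_pos _ _ _) (m.f_pos _ _ _)) (hq.2 _ _ _ _)

theorem sum_weight_pos [∀ t, NeZero (N t)] (hq : q.Positive) (x : States N X) (a : Parents N)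
    (t : Fin (n + 1)) : 0 < ∑ i, weight m q y x a t i :=
  Finset.sum_pos (fun i _ => weight_pos hq x a t i) Finset.univ_nonempty

theorem backwardWeight_pos (hq : q.Positive) (x : States N X) (a : Parents N) (z : X) (s : Fin n)
    (i : Fin (N s.castSucc)) : 0 < backwardWeight m q y x a z s i :=
  mul_pos (weight_pos hq x a _ i) (m.f_pos _ _ _)

theorem sum_backwardWeight_pos [∀ t, NeZero (N t)] (hq : q.Positive) (x : States N X)
    (a : Parents N) (z : X) (s : Fin n) : 0 < ∑ i, backwardWeight m q y x a z s i :=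
  Finset.sum_pos (fun i _ => backwardWeight_pos hq x a z s i) Finset.univ_nonempty

/-- Positive weights keep every normalising sum away from zero, so no categorical draw degenerates
to the zero measure. -/
theorem isProbabilityMeasure_proposalLaw [SFinite lam] [∀ s, NeZero (C s)] [∀ t, NeZero (N t)]
    (hq : q.Positive) (u₀ : ExtSpace N C X) : IsProbabilityMeasure (proposalLaw m q y K u₀) := by
  refine isProbabilityMeasure_run (fun S hS => ⟨measurable_proposalSteps S hS, fun u => ?_⟩) _
  simp only [filterSteps, backwardSteps, List.mem_append, List.mem_map, List.mem_finRange,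
    true_and, List.mem_flatMap, List.mem_cons, List.mem_reverse] at hS
  rcases hS with (⟨i, rfl⟩ | ⟨s, ⟨i, rfl⟩ | ⟨i, rfl⟩⟩) | rfl | ⟨s, rfl | ⟨j, rfl⟩⟩
  · refine isProbabilityMeasure_assign (measurable_setState _ _) ⟨?_⟩
    rw [withDensity_apply _ .univ, setLIntegral_univ, q.lintegral_M₁]
  · exact isProbabilityMeasure_assign (measurable_setParent _ _)
      (isProbabilityMeasure_categorical_normalize (sum_weight_pos hq _ _ _).ne')
  · refine isProbabilityMeasure_assign (measurable_setState _ _) ⟨?_⟩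
    rw [withDensity_apply _ .univ, setLIntegral_univ, q.lintegral_M]
  · exact isProbabilityMeasure_assign (measurable_setIndex _)
      (isProbabilityMeasure_categorical_normalize (sum_weight_pos hq _ _ _).ne')
  · exact isProbabilityMeasure_assign (measurable_setIndex _)
      (isProbabilityMeasure_categorical_normalize (sum_backwardWeight_pos hq _ _ _ _).ne')
  · exact isProbabilityMeasure_assign (measurable_setPath _ _)
      (inferInstanceAs (IsProbabilityMeasure (transitionKernel K s j.castSucc u)))

end ProposalNormalForm

/-! ### Exchanging factors of products -/

section Exchange

variable {M : Type*} [Monoid M]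

/-- If `L j * G j` can be replaced by `L (j + 1) * R j`, then a product of all the `G j` can be
replaced by the product of all the `R j` in reverse order. -/
theorem mul_prod_eq_mul_prod_reverse {c : ℕ} {L : Fin (c + 1) → M} {G R : Fin c → M}
    (h : ∀ j, L j.castSucc * G j = L j.succ * R j) (hc : ∀ i j, i < j → Commute (R i) (G j)) :
    L 0 * ((List.finRange c).map G).prod =
      L (Fin.last c) * ((List.finRange c).reverse.map R).prod := by
  induction c with
  | zero => simp
  | succ c ih =>
    -- Each exchange deposits its reversed factor at the right; the first one has to pass all
    -- forward factors that are still to be exchanged.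
    have h0 : Commute (R 0) (((List.finRange c).map Fin.succ).map G).prod :=
      commute_list_prod fun j hj => by
        obtain ⟨i, -, rfl⟩ := List.mem_map.1 hj
        exact hc _ _ i.succ_pos
    have ih' := ih (L := fun j => L j.succ) (G := fun j => G j.succ) (R := fun j => R j.succ)
      (fun j => h j.succ) fun i j hij => hc _ _ (Fin.succ_lt_succ_iff.2 hij)
    have h00 := h 0
    rw [Fin.castSucc_zero] at h00
    rw [List.finRange_succ, List.map_cons, List.prod_cons, ← mul_assoc, h00, mul_assoc, h0.eq,
      ← mul_assoc, List.map_map, List.reverse_cons, List.map_append, List.prod_append,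
      List.map_singleton, List.prod_singleton, ← mul_assoc, ← List.map_reverse, List.map_map]
    exact congrArg (· * R 0) ih'

/-- Exchanges the factors `A s, G s, T s` for `E s, R s, T' s` one after the other. -/
theorem prod_exchange {n : ℕ} {P Z : M} {A E G R T T' : Fin n → M}
    (hAE : ∀ s s', s < s' → Commute (A s) (E s')) (hEE : ∀ s s', s < s' → Commute (E s) (E s'))
    (hAZ : ∀ s, Commute (A s) Z) (hEZ : ∀ s, Commute (E s) Z)
    (hRG : ∀ s s', s' < s → Commute (R s) (G s'))
    (hTG : ∀ s s', s' < s → Commute (T s) (G s')) (hTG' : ∀ s s', s' < s → Commute (T' s) (G s'))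
    (hTR : ∀ s s', s < s' → Commute (T s) (R s')) (hTR' : ∀ s s', s < s' → Commute (T' s) (R s'))
    (hTT : ∀ s s', Commute (T s) (T s')) (hTT' : ∀ s s', Commute (T s) (T' s'))
    (hloc : ∀ l k r, l ++ k :: r = List.finRange n →
      P * (l.map A).prod * (r.map E).prod * Z * (A k * G k * T k) =
        P * (l.map A).prod * (r.map E).prod * Z * (E k * R k * T' k)) :
    P * ((List.finRange n).map A).prod * Z * ((List.finRange n).reverse.map G).prod *
        ((List.finRange n).map T).prod =
      P * ((List.finRange n).map E).prod * Z * ((List.finRange n).map R).prod *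
        ((List.finRange n).map T').prod := by
  -- Interpolation between the two sides: the times in `l` are still in their original form, those
  -- in `r` are already exchanged. The last element of `l` comes next, so the runs are reversed from
  -- the latest to the earliest.
  have key : ∀ l r, l ++ r = List.finRange n →
      P * ((l.map A).prod * (r.map E).prod) * Z * ((l.reverse.map G).prod * (r.map R).prod) *
        ((l.map T).prod * (r.map T').prod) =
      P * ((List.finRange n).map E).prod * Z * ((List.finRange n).map R).prod *
        ((List.finRange n).map T').prod := by
    intro l
    induction l using List.reverseRecOn with
    | nil => rintro r rfl; simp
    | append_singleton l k ih =>
      intro r hr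
      rw [List.append_assoc, List.singleton_append] at hr
      rw [← ih (k :: r) hr]
      have hp := List.pairwise_lt_finRange n
      rw [← hr, List.pairwise_append, List.pairwise_cons] at hp
      have hl : ∀ s ∈ l, s < k := fun s hs => hp.2.2 s hs k (by simp)
      have hr' : ∀ s ∈ r, k < s := hp.2.1.1
      simp only [List.map_append, List.prod_append, List.map_cons, List.prod_cons, List.map_nil,
        List.prod_nil, mul_one, List.reverse_append, List.reverse_cons, List.reverse_nil,
        List.nil_append, List.singleton_append]
      have e1 : Commute (A k) (r.map E).prod := commute_list_prod fun s hs => hAE _ _ (hr' s hs)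
      have e2 : Commute (E k) (r.map E).prod := commute_list_prod fun s hs => hEE _ _ (hr' s hs)
      have e3 : Commute (R k) (l.reverse.map G).prod :=
        commute_list_prod fun s hs => hRG _ _ (hl s (List.mem_reverse.1 hs))
      have e4 : Commute (T k) (l.reverse.map G).prod :=
        commute_list_prod fun s hs => hTG _ _ (hl s (List.mem_reverse.1 hs))
      have e5 : Commute (T' k) (l.reverse.map G).prod :=
        commute_list_prod fun s hs => hTG' _ _ (hl s (List.mem_reverse.1 hs))
      have e6 : Commute (T k) (r.map R).prod := commute_list_prod fun s hs => hTR _ _ (hr' s hs)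
      have e7 : Commute (T' k) (r.map R).prod := commute_list_prod fun s hs => hTR' _ _ (hr' s hs)
      have e8 : Commute (T k) (l.map T).prod := commute_list_prod fun s _ => hTT _ _
      have e9 : Commute (T' k) (l.map T).prod := commute_list_prod fun s _ => (hTT' _ _).symm
      have e10 := hAZ k
      have e11 := hEZ k
      have hk := hloc l k r hr
      generalize (l.map A).prod = a at *
      generalize (r.map E).prod = e at *
      generalize (l.reverse.map G).prod = g at *
      generalize (r.map R).prod = ρ at *
      generalize (l.map T).prod = t at *
      generalize (r.map T').prod = t' at *
      -- The three factors belonging to `k` are brought together, exchanged by `hk`, and the new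
      -- ones are moved to their places.
      calc P * (a * A k * e) * Z * (G k * g * ρ) * (t * T k * t')
          = P * a * (A k * e) * Z * G k * g * ρ * (t * T k) * t' := by simp only [mul_assoc]
        _ = P * a * e * (A k * Z) * G k * g * (ρ * T k) * t * t' := by
            rw [e1.eq, ← e8.eq]; simp only [mul_assoc]
        _ = P * a * e * Z * A k * G k * (g * T k) * ρ * t * t' := by
            rw [e10.eq, ← e6.eq]; simp only [mul_assoc]
        _ = P * a * e * Z * (A k * G k * T k) * g * ρ * t * t' := by
            rw [← e4.eq]; simp only [mul_assoc]
        _ = P * a * e * Z * (E k * R k * T' k) * g * ρ * t * t' := by rw [hk]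
        _ = P * a * (e * (Z * E k)) * R k * (T' k * g) * ρ * t * t' := by simp only [mul_assoc]
        _ = P * a * ((e * E k) * Z) * (R k * g) * (T' k * ρ) * t * t' := by
            rw [← e11.eq, e5.eq]; simp only [mul_assoc]
        _ = P * (a * (E k * e)) * Z * (g * (R k * ρ)) * (T' k * t) * t' := by
            rw [← e2.eq, e3.eq, e7.eq]; simp only [mul_assoc]
        _ = P * (a * (E k * e)) * Z * (g * (R k * ρ)) * (t * (T' k * t')) := by
            rw [e9.eq]; simp only [mul_assoc]
  have h := key (List.finRange n) [] (by simp)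
  simpa using h

end Exchange

/-! ### The extended target -/

section Target

variable {n : ℕ} {N : Fin (n + 1) → ℕ} {C : Fin n → ℕ} {X Y : Type*} [MeasurableSpace X]
  [MeasurableSpace Y] {lam : Measure X} {nu : Measure Y}
  {K : TransitionKernels N X} [∀ s b, IsMarkovKernel (K s b)]

theorem selectedOp_castSucc [SFinite lam] (s : Fin n) :
    selectedOp (N := N) (C := C) lam s.castSucc = pathOp lam s (Fin.last (C s)) := by
  refine Op.ext fun F u => ?_
  simp only [selectedOp, pathOp, eval_assignOp, setSelected_castSucc]

theorem selectedOp_last [SFinite lam] :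
    selectedOp (N := N) (C := C) lam (Fin.last n) = selectedStateOp lam (Fin.last n) := by
  refine Op.ext fun F u => ?_
  simp only [selectedOp, selectedStateOp, eval_assignOp, setSelected_last]

theorem prod_selectedOp [SFinite lam] :
    ((List.finRange (n + 1)).map fun t => selectedOp (N := N) (C := C) lam t).prod =
      ((List.finRange n).map fun s => pathOp lam s (Fin.last (C s))).prod *
        selectedStateOp lam (Fin.last n) := by
  rw [List.finRange_succ_last, List.map_append, List.prod_append, List.map_map, List.map_singleton,
    List.prod_singleton, selectedOp_last]
  simp only [Function.comp_def, selectedOp_castSucc]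

theorem prod_selectedStateOp [SFinite lam] :
    ((List.finRange (n + 1)).map fun t => selectedStateOp (N := N) (C := C) lam t).prod =
      ((List.finRange n).map fun s => pathOp lam s 0).prod *
        selectedStateOp lam (Fin.last n) := by
  rw [List.finRange_succ_last, List.map_append, List.prod_append, List.map_map, List.map_singleton,
    List.prod_singleton]
  rfl

theorem index_ne {t t' : Fin (n + 1)} {i : Fin (N t)} {b : Indices N} (h : ¬ i = b t) :
    (⟨t, i⟩ : Σ t, Fin (N t)) ≠ ⟨t', b t'⟩ := by
  intro e
  rw [Sigma.mk.injEq] at e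
  obtain ⟨rfl, e⟩ := e
  exact h (eq_of_heq e)

theorem commute_otherStatesOp_selectedStateOp [SFinite lam] [Nonempty X] (t t' : Fin (n + 1)) :
    Commute (otherStatesOp (N := N) (C := C) lam t) (selectedStateOp lam t') :=
  list_prod_commute fun _ _ => commute_skipOp_assignOp
    (fun u z w hu => setState_comm (index_ne hu) u z w) (fun _ _ => Iff.rfl) fun _ _ _ => rfl

theorem commute_otherStatesOp_selectedOp [SFinite lam] [Nonempty X] [∀ s, NeZero (C s)]
    (t t' : Fin (n + 1)) :
    Commute (otherStatesOp (N := N) (C := C) lam t) (selectedOp lam t') :=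
  list_prod_commute fun i _ => commute_skipOp_assignOp
    (fun u z w hu => setSelected_setState_comm (fun _ => index_ne hu) z w)
    (fun u w => by rw [setSelected_indices]) fun _ _ _ => rfl

/-- Isolates the particle from which the run starts; the other particles are treated alike by the
proposal and by the extended target. -/
theorem statesOp_eq [SFinite lam] [Nonempty X] (t : Fin (n + 1)) :
    statesOp (N := N) (C := C) lam t = otherStatesOp lam t * selectedStateOp lam t :=
  prod_assignOp_eq_prod_skipOp_mul (measurable_setState t) (measurableSet_index_eq t)
    (measurable_setSelectedState t) (fun _ => rfl) (fun _ _ _ => rfl) fun i j hij u z w =>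
      setState_comm (fun e => hij (by simpa using e)) u z w

theorem prod_statesOp [SFinite lam] [Nonempty X] :
    ((List.finRange (n + 1)).map fun t => statesOp (N := N) (C := C) lam t).prod =
      ((List.finRange (n + 1)).map fun t => otherStatesOp lam t).prod *
        ((List.finRange n).map fun s => pathOp lam s 0).prod *
        selectedStateOp lam (Fin.last n) := by
  rw [mul_assoc, ← prod_selectedStateOp]
  simp only [statesOp_eq]
  exact list_prod_map_mul (pairwise_finRange fun t t' _ =>
    (commute_otherStatesOp_selectedStateOp t' t).symm)

theorem assignStep [SFinite lam] {U : Type*} [MeasurableSpace U] {set : U → X → U}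
    (hset : Measurable (Function.uncurry set)) :
    stepOp (assign (fun _ => lam) set) = assignOp (Kernel.const U lam) set hset ∧
      Measurable (assign (fun _ => lam) set) :=
  ⟨stepOp_assign (Kernel.const U lam) (fun _ => rfl) _,
    measurable_assign (Kernel.const U lam) (fun _ => rfl) hset⟩

theorem otherStateStep [SFinite lam] [Nonempty X] (t : Fin (n + 1)) (i : Fin (N t)) :
    Measurable (fun u : ExtSpace N C X => if i = u.2.2.1 t then Measure.dirac u else
        assign (fun _ => lam) (setState t i) u) ∧
      stepOp (fun u : ExtSpace N C X => if i = u.2.2.1 t then Measure.dirac u else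
        assign (fun _ => lam) (setState t i) u) = otherStateOp lam t i :=
  stepOp_ite fun u => by
    by_cases h : i = u.2.2.1 t
    · rw [if_pos h, if_pos h]
    · rw [if_neg h, if_neg h]

/-- Non-selected particles and selected states are disjoint coordinates, so the two blocks can be
interchanged to match the order in the proposal. -/
theorem prod_stepOp_reversedSteps [SFinite lam] [Nonempty X] [∀ s, NeZero (C s)] :
    ((reversedSteps (N := N) (C := C) lam K).map stepOp).prod =
      ((List.finRange (n + 1)).map fun t => indexOp t).prod *
        ((List.finRange n).map fun s => parentsOp s).prod *
        ((List.finRange (n + 1)).map fun t => otherStatesOp lam t).prod *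
        ((List.finRange (n + 1)).map fun t => selectedOp lam t).prod *
        ((List.finRange n).map fun s => reverseRunOp K s).prod := by
  have hc : Commute ((List.finRange (n + 1)).map fun t => selectedOp (N := N) (C := C) lam t).prod
      ((List.finRange (n + 1)).map fun t => otherStatesOp lam t).prod :=
    list_prod_commute_list_prod fun t _ t' _ => (commute_otherStatesOp_selectedOp t' t).symm
  rw [mul_assoc _ _ (List.prod (List.map (fun t => selectedOp lam t) _)), ← hc.eq, prod_selectedOp]
  simp only [reversedSteps, List.map_append, List.prod_append, List.map_map, List.map_flatMap,
    prod_flatMap, Function.comp_def, List.map_singleton, List.prod_singleton,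
    (reverseStep _ _).1, (otherStateStep _ _).2, (assignStep (measurable_setPath _ _)).1]
  have h3 : stepOp (assign (fun _ => lam) fun u : ExtSpace N C X =>
      setState (Fin.last n) (u.2.2.1 (Fin.last n)) u) = selectedStateOp lam (Fin.last n) :=
    (assignStep (measurable_setSelectedState (Fin.last n))).1
  have h1 : ∀ t, stepOp (assign (fun _ => Measure.count)
      (setIndex (N := N) (C := C) (X := X) t)) = indexOp t := fun t =>
    (assignStep (measurable_setIndex t)).1
  have h2 : ∀ (s : Fin n) (i : Fin (N s.succ)), stepOp (assign (fun _ => Measure.count)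
      (setParent (C := C) (X := X) s i)) = parentOp s i := fun s i =>
    (assignStep (measurable_setParent s i)).1
  simp only [h1, h2, h3, mul_assoc]
  rfl

theorem measurable_reversedSteps [SFinite lam] [Nonempty X] :
    ∀ S ∈ reversedSteps (N := N) (C := C) lam K, Measurable S := by
  intro S hS
  simp only [reversedSteps, List.mem_append, List.mem_map, List.mem_finRange,
    true_and, List.mem_flatMap, List.mem_reverse, List.mem_singleton] at hS
  rcases hS with ((((⟨t, rfl⟩ | ⟨s, i, rfl⟩) | ⟨s, rfl⟩) | rfl) | ⟨t, i, rfl⟩) | ⟨s, j, rfl⟩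
  · exact (assignStep (measurable_setIndex t)).2
  · exact (assignStep (measurable_setParent s i)).2
  · exact (assignStep (measurable_setPath _ _)).2
  · exact (assignStep (measurable_setSelectedState (Fin.last n))).2
  · exact (otherStateStep t i).1
  · exact (reverseStep s j).2

end Target

/-! ### Reversing the Markov chain runs -/

/-- Reversibility is the symmetry of the joint law of two successive states; multiplying by the
total mass removes the normalisation. Finite mass is essential: otherwise division by `∞` makes the
normalised target the zero measure and `hrev` carries no information. -/
theorem lintegral_reversible {X : Type*} [MeasurableSpace X] {lam : Measure X} [SFinite lam]
    {κ : Kernel X X} [IsMarkovKernel κ] {τ : X → ℝ≥0∞} (hτ : Measurable τ)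
    (hfin : ∫⁻ x, τ x ∂lam ≠ ∞)
    (hrev : κ.IsReversible (lam.withDensity fun x => τ x / ∫⁻ x', τ x' ∂lam))
    {H : X → X → ℝ≥0∞} (hH : Measurable (Function.uncurry H)) :
    ∫⁻ z, τ z * ∫⁻ w, H z w ∂κ z ∂lam = ∫⁻ w, τ w * ∫⁻ z, H z w ∂κ w ∂lam := by
  have hH' : Measurable (Function.uncurry fun w z => H z w) := hH.comp measurable_swap
  have m1 : Measurable fun z => ∫⁻ w, H z w ∂κ z := Measurable.lintegral_kernel_prod_right' hH
  have m2 : Measurable fun w => ∫⁻ z, H z w ∂κ w := Measurable.lintegral_kernel_prod_right' hH'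
  set c := ∫⁻ x, τ x ∂lam with hc
  rcases eq_or_ne c 0 with h0 | h0
  · have h0' : τ =ᵐ[lam] 0 := (lintegral_eq_zero_iff hτ).1 (hc.symm.trans h0)
    rw [lintegral_congr_ae (g := fun _ => 0) (h0'.mono fun z hz => by simp [hz]),
      lintegral_congr_ae (f := fun w => τ w * _) (g := fun _ => 0)
        (h0'.mono fun z hz => by simp [hz])]
  set μ := lam.withDensity fun x => τ x / c with hμ
  have : IsProbabilityMeasure μ := ⟨by
    rw [hμ, withDensity_apply _ .univ, setLIntegral_univ]
    simp only [div_eq_mul_inv]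
    rw [lintegral_mul_const _ hτ, ← hc, ENNReal.mul_inv_cancel h0 hfin]⟩
  have key : μ.compProd κ = (μ.compProd κ).map Prod.swap := by
    have : IsProbabilityMeasure ((μ.compProd κ).map Prod.swap) :=
      Measure.isProbabilityMeasure_map measurable_swap.aemeasurable
    -- Reversibility gives the symmetry on rectangles, and these determine a finite measure on the
    -- product.
    refine Measure.ext_prod fun {A B} hA hB => ?_
    rw [Measure.map_apply measurable_swap (hA.prod hB), Set.preimage_swap_prod,
      Measure.compProd_apply_prod hA hB, Measure.compProd_apply_prod hB hA]
    exact hrev hA hB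
  have key2 : ∫⁻ z, ∫⁻ w, H z w ∂κ z ∂μ = ∫⁻ w, ∫⁻ z, H z w ∂κ w ∂μ := by
    have e1 := Measure.lintegral_compProd (μ := μ) (κ := κ) hH
    have e2 := Measure.lintegral_compProd (μ := μ) (κ := κ) hH'
    rw [key, lintegral_map hH measurable_swap] at e1
    exact e1.symm.trans e2
  have hd : Measurable fun x => τ x / c := hτ.div_const c
  rw [hμ, lintegral_withDensity_eq_lintegral_mul _ hd m1,
    lintegral_withDensity_eq_lintegral_mul _ hd m2] at key2
  have hmul : ∀ G : X → ℝ≥0∞, Measurable G →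
      ∫⁻ z, τ z * G z ∂lam = c * ∫⁻ z, ((fun x => τ x / c) * G) z ∂lam := fun G hG => by
    rw [← lintegral_const_mul _ (hd.mul hG)]
    refine lintegral_congr fun z => ?_
    rw [Pi.mul_apply, ← mul_assoc, ENNReal.mul_div_cancel h0 hfin]
  rw [hmul _ m1, hmul _ m2, key2]

/-! ### Detailed balance along a whole run -/

section Runs

variable {n : ℕ} {N : Fin (n + 1) → ℕ} {C : Fin n → ℕ} {X Y : Type*} [MeasurableSpace X]
  [MeasurableSpace Y] {lam : Measure X} {nu : Measure Y}
  (m : StateSpaceModel n X Y lam nu) (q : ImportanceDensities n X Y lam) (y : Fin (n + 1) → Y)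

theorem predictive_congr {x x' : States N X} {a a' : Parents N} {t : Fin (n + 1)}
    (hx : ∀ t' < t, x t' = x' t') (ha : ∀ r : Fin n, r.succ < t → a r = a' r) (z : X) :
    predictive m q y x a t z = predictive m q y x' a' t z := by
  cases t using Fin.cases with
  | zero => rfl
  | succ s =>
    have h1 := hx _ s.castSucc_lt_succ
    have h2 : weight m q y x a s.castSucc = weight m q y x' a' s.castSucc :=
      weight_congr m q y h1 fun r hr =>
        ⟨hx _ ((r.castSucc_lt_succ.trans_eq hr.symm).trans s.castSucc_lt_succ),
          ha _ (hr.symm.trans_lt s.castSucc_lt_succ)⟩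
    simp only [predictive, Fin.cases_succ, backwardWeight, h1, h2]

/-- The target involves only particles at strictly earlier times, so neither the run nor its
starting particle affects the target of that run. -/
theorem targetDensity_congr {x x' : States N X} {a a' : Parents N} {s : Fin n}
    (hx : ∀ t < s.castSucc, x t = x' t) (ha : ∀ r : Fin n, r.succ < s.castSucc → a r = a' r)
    (z w : X) : targetDensity m q y x a z s w = targetDensity m q y x' a' z s w := by
  rw [targetDensity, targetDensity, predictive_congr m q y hx ha]

theorem measurable_targetFunction (s : Fin n) (j : Fin (C s + 1)) :
    Measurable fun u : ExtSpace N C X =>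
      targetDensity m q y u.1 u.2.1 (selected u s.succ) s (path u s j) :=
  (measurable_targetDensity m q y s (measurable_selected s.succ)).comp
    (measurable_id.prodMk (measurable_path s j))

/-- The unnormalised target density of run `s`, at position `j` of the path. -/
def targetFunction (s : Fin n) (j : Fin (C s + 1)) : measurableFunctions (ExtSpace N C X) :=
  finiteFunction _ (measurable_targetFunction m q y s j)

theorem targetFunction_apply (s : Fin n) (j : Fin (C s + 1)) (u : ExtSpace N C X) :
    (targetFunction m q y s j).1 u =
      targetDensity m q y u.1 u.2.1 (selected u s.succ) s (path u s j) := rfl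

variable {m q y}

theorem targetDensity_setPath {s s' : Fin n} {j' : Fin (C s' + 1)}
    (h : s ≤ s' ∨ j' ≠ 0) (h' : s.succ = s'.castSucc → j' ≠ Fin.last (C s'))
    (u : ExtSpace N C X) (z w : X) :
    targetDensity m q y (setPath s' j' u z).1 (setPath s' j' u z).2.1
        (selected (setPath s' j' u z) s.succ) s w =
      targetDensity m q y u.1 u.2.1 (selected u s.succ) s w := by
  rw [selected_setPath_of_ne h', setPath_parents]
  refine targetDensity_congr m q y (fun t ht => ?_) (fun r _ => rfl) _ _
  cases j' using Fin.cases with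
  | zero =>
    rcases h with h | h
    · exact setPath_states_time (ht.trans_le (Fin.castSucc_le_castSucc_iff.2 h)).ne _ _ _
    · exact absurd rfl h
  | succ j => rfl

theorem targetFunction_setPath {s s' : Fin n} {j : Fin (C s + 1)} {j' : Fin (C s' + 1)}
    (h : s ≤ s' ∨ j' ≠ 0) (h' : s.succ = s'.castSucc → j' ≠ Fin.last (C s'))
    (hj : (⟨s, j⟩ : Σ s, Fin (C s + 1)) ≠ ⟨s', j'⟩) (u : ExtSpace N C X) (z : X) :
    (targetFunction m q y s j).1 (setPath s' j' u z) = (targetFunction m q y s j).1 u := by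
  rw [targetFunction_apply, targetFunction_apply, targetDensity_setPath h h',
    path_setPath_of_ne hj]

variable {K : TransitionKernels N X} [∀ s b, IsMarkovKernel (K s b)]

theorem succ_ne_castSucc_of_le {s s' : Fin n} (h : s' ≤ s) : s.succ ≠ s'.castSucc :=
  (lt_of_le_of_lt (Fin.castSucc_le_castSucc_iff.2 h) s.castSucc_lt_succ).ne'

theorem commute_targetFunction_forwardRunOp {s s' : Fin n} (h : s' < s) (j : Fin (C s + 1)) :
    Commute (weigh (targetFunction m q y s j)) (forwardRunOp K s') :=
  commute_list_prod fun i _ => commute_weigh_assignOp fun u z =>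
    targetFunction_setPath (Or.inr (Fin.succ_ne_zero i))
      (fun e => absurd e (succ_ne_castSucc_of_le h.le))
      (fun e => h.ne' (congrArg Sigma.fst e)) u z

theorem commute_targetFunction_reverseRunOp {s s' : Fin n} (h : s < s') (j : Fin (C s + 1)) :
    Commute (weigh (targetFunction m q y s j)) (reverseRunOp K s') :=
  commute_list_prod fun i _ => commute_weigh_assignOp fun u z =>
    targetFunction_setPath (Or.inl h.le) (fun _ => i.castSucc_lt_last.ne)
      (fun e => h.ne (congrArg Sigma.fst e)) u z

theorem commute_targetFunction_zero_forwardRunOp (s : Fin n) :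
    Commute (weigh (targetFunction m q y s 0)) (forwardRunOp (N := N) (C := C) K s) :=
  commute_list_prod fun i _ => commute_weigh_assignOp fun u z =>
    targetFunction_setPath (Or.inl le_rfl) (fun e => absurd e (succ_ne_castSucc_of_le le_rfl))
      (fun e => (Fin.succ_ne_zero i).symm (by simpa using e)) u z

theorem commute_targetFunction_last_reverseRunOp (s : Fin n) :
    Commute (weigh (targetFunction m q y s (Fin.last (C s))))
      (reverseRunOp (N := N) (C := C) K s) :=
  commute_list_prod fun i _ => commute_weigh_assignOp fun u z =>
    targetFunction_setPath (Or.inl le_rfl) (fun e => absurd e (succ_ne_castSucc_of_le le_rfl))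
      (fun e => i.castSucc_lt_last.ne' (by simpa using e)) u z

/-- Within one run, the reversed move `i` reads position `i + 1` and writes `i`, while the forward
move `j` reads `j` and writes `j + 1`; for `i < j` these do not interfere. Across runs, a reversed
move may change a particle, but only at a time which the earlier forward run does not see, and it
never changes the end of its run. -/
theorem commute_reverseOp_forwardOp {s s' : Fin n} (h : s' ≤ s) (i : Fin (C s)) (j : Fin (C s'))
    (hij : s = s' → i.val < j.val) :
    Commute (reverseOp (N := N) (C := C) K s i) (forwardOp K s' j) := by
  have hne : ∀ {a : Fin (C s + 1)} {b : Fin (C s' + 1)}, (s = s' → a.val ≠ b.val) →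
      (⟨s, a⟩ : Σ s, Fin (C s + 1)) ≠ ⟨s', b⟩ := by
    intro a b hab e
    rw [Sigma.mk.injEq] at e
    obtain ⟨rfl, e⟩ := e
    exact hab rfl (congrArg Fin.val (eq_of_heq e))
  refine commute_assignOp (fun u z w => setPath_comm (hne fun e => ?_) u z w) (fun u w => ?_)
    fun u z => ?_
  · have := hij e
    simp; omega
  · rw [transitionKernel_apply, transitionKernel_apply, path_setPath_of_ne (hne fun e => ?_),
      transition_setPath _ _ _ (Or.inr (Or.inr (Fin.succ_ne_zero j)))
        (fun e => absurd e (succ_ne_castSucc_of_le h))]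
    have := hij e
    simp; omega
  · rw [transitionKernel_apply, transitionKernel_apply,
      path_setPath_of_ne (Ne.symm (hne fun e => ?_)), transition_setPath _ _ _ ?_
        (fun _ => i.castSucc_lt_last.ne)]
    · rcases h.lt_or_eq with h | h
      · exact Or.inl (Fin.castSucc_lt_castSucc_iff.2 h)
      · exact Or.inr (Or.inl h)
    · have := hij e
      simp; omega

theorem commute_reverseRunOp_forwardRunOp {s s' : Fin n} (h : s' < s) :
    Commute (reverseRunOp (N := N) (C := C) K s) (forwardRunOp K s') :=
  list_prod_commute_list_prod fun i _ j _ =>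
    commute_reverseOp_forwardOp h.le i j fun e => absurd e h.ne'

theorem commute_pathOp [SFinite lam] {s s' : Fin n} {j : Fin (C s + 1)} {j' : Fin (C s' + 1)}
    (h : s ≠ s') : Commute (pathOp (N := N) (C := C) lam s j) (pathOp lam s' j') :=
  commute_assignOp (fun u z w => setPath_comm (fun e => h (congrArg Sigma.fst e)) u z w)
    (fun _ _ => rfl) fun _ _ => rfl

theorem commute_pathOp_selectedStateOp [SFinite lam] (s : Fin n) (j : Fin (C s + 1)) :
    Commute (pathOp (N := N) (C := C) lam s j) (selectedStateOp lam (Fin.last n)) :=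
  commute_assignOp (fun u z w => by
    rw [setSelectedState, setSelectedState, setPath_indices]
    exact (setPath_setState_comm
      (fun e => s.castSucc_lt_last.ne' (congrArg Sigma.fst e)) w z).symm)
    (fun _ _ => rfl) fun _ _ => rfl

/-- A single use of detailed balance: the two positions joined by the move exchange their roles. The
weight `d` confines the argument to points whose target has finite mass; elsewhere both sides
vanish. -/
theorem pathOp_forwardOp [SFinite lam] (hbal : DetailedBalance m q y K)
    {d : measurableFunctions (ExtSpace N C X)} {s : Fin n}
    (hd : ∀ u, d.1 u ≠ 0 → ∫⁻ x, (targetDensity m q y u.1 u.2.1 (selected u s.succ) s x : ℝ≥0∞) ∂lam ≠ ∞)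
    (j : Fin (C s)) :
    weigh d * pathOp lam s j.castSucc * weigh (targetFunction m q y s j.castSucc) *
        forwardOp K s j =
      weigh d * pathOp lam s j.succ * weigh (targetFunction m q y s j.succ) * reverseOp K s j := by
  simp only [mul_assoc]
  refine Op.ext fun F u => ?_
  rw [Op.eval_mul, Op.eval_mul, eval_weigh, eval_weigh]
  rcases eq_or_ne (d.1 u) 0 with h0 | h0
  · rw [h0, zero_mul, zero_mul]
  congr 1
  have hne : j.castSucc ≠ j.succ := j.castSucc_lt_succ.ne
  have hT : ∀ i z, (targetFunction m q y s i).1 (setPath s i u z) =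
      (targetDensity m q y u.1 u.2.1 (selected u s.succ) s z : ℝ≥0∞) := fun i z => by
    rw [targetFunction_apply, targetDensity_setPath (Or.inl le_rfl)
      (fun e => absurd e (succ_ne_castSucc_of_le le_rfl)), path_setPath_self]
  set κ := (K s (u.2.2.1 s.castSucc)).sectR
    (conditioning u.1 u.2.1 (selected u s.succ) s (u.2.2.1 s.castSucc)) with hκ
  have hK : ∀ i z, transitionKernel K s i (setPath s i u z) = κ z := fun i z => by
    rw [transitionKernel_apply, transition_setPath _ _ _ (Or.inr (Or.inl rfl))
      (fun e => absurd e (succ_ne_castSucc_of_le le_rfl)), path_setPath_self, hκ,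
      Kernel.sectR_apply]
    rfl
  have hm : Measurable fun x => targetDensity m q y u.1 u.2.1 (selected u s.succ) s x :=
    (measurable_targetDensity m q y s (measurable_selected (N := N) (C := C) s.succ)).comp
      (measurable_prodMk_left (x := u))
  have hH : Measurable (Function.uncurry fun z w =>
      F.1 (setPath s j.succ (setPath s j.castSucc u z) w)) :=
    F.2.comp ((measurable_setPath s j.succ).comp
      (((measurable_uncurry_left (measurable_setPath s j.castSucc) u).comp
        measurable_fst).prodMk measurable_snd))
  have key := lintegral_reversible (lam := lam) (κ := κ) hm.coe_nnreal_ennreal (hd u h0)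
    (hbal s _ u.1 u.2.1 _) hH
  change ∫⁻ z, (targetFunction m q y s j.castSucc).1 (setPath s j.castSucc u z) *
      ∫⁻ w, F.1 (setPath s j.succ (setPath s j.castSucc u z) w)
        ∂transitionKernel K s j.castSucc (setPath s j.castSucc u z) ∂lam =
    ∫⁻ w, (targetFunction m q y s j.succ).1 (setPath s j.succ u w) *
      ∫⁻ z, F.1 (setPath s j.castSucc (setPath s j.succ u w) z)
        ∂transitionKernel K s j.succ (setPath s j.succ u w) ∂lam
  simp only [hT, hK]
  refine key.trans (lintegral_congr fun w => ?_)
  congr 1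
  refine lintegral_congr fun z => ?_
  rw [setPath_comm (fun e => hne (by simpa using e))]

/-- Detailed balance for each move carries the integral and the target density from one position to
the next, from the start of the run to its end. -/
theorem pathOp_forwardRunOp [SFinite lam] (hbal : DetailedBalance m q y K)
    {d : measurableFunctions (ExtSpace N C X)} {s : Fin n}
    (hd : ∀ u, d.1 u ≠ 0 → ∫⁻ x, (targetDensity m q y u.1 u.2.1 (selected u s.succ) s x : ℝ≥0∞) ∂lam ≠ ∞) :
    weigh d * (pathOp lam s 0 * forwardRunOp K s * weigh (targetFunction m q y s 0)) =
      weigh d * (pathOp lam s (Fin.last (C s)) * reverseRunOp K s *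
        weigh (targetFunction m q y s (Fin.last (C s)))) := by
  have h := mul_prod_eq_mul_prod_reverse
    (L := fun i => weigh d * pathOp lam s i * weigh (targetFunction m q y s i))
    (G := forwardOp K s) (R := reverseOp K s) (fun j => pathOp_forwardOp hbal hd j)
    fun i j hij => commute_reverseOp_forwardOp le_rfl i j fun _ => hij
  rw [mul_assoc (pathOp lam s 0), ← (commute_targetFunction_zero_forwardRunOp s).eq,
    mul_assoc (pathOp lam s (Fin.last _)), ← (commute_targetFunction_last_reverseRunOp s).eq]
  simp only [← mul_assoc]
  exact h

end Runs

/-! ### Integrability of the targets of the Markov chain runs -/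

section Marginals

variable {ι X : Type*} [Fintype ι] [DecidableEq ι] [MeasurableSpace X] {lam : Measure X}
  [SigmaFinite lam]

/-- Tonelli: integrating coordinate `κ` first yields `∞` on `B`, so a finite total integral forces
`B` to be negligible for the remaining coordinates. -/
theorem lmarginal_compl_indicator_eq_zero {f : (ι → X) → ℝ≥0∞} (hf : Measurable f)
    (hfin : ∫⁻ w, f w ∂(Measure.pi fun _ => lam) ≠ ∞) {κ : ι} {B : Set (ι → X)}
    (hB : MeasurableSet B)
    (h : ∀ w ∈ B, ∫⁻ x, f (Function.update w κ x) ∂lam = ∞) (w₀ : ι → X) :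
    lmarginal (fun _ => lam) ({κ}ᶜ : Finset ι) (B.indicator 1) w₀ = 0 := by
  have hle : lmarginal (fun _ => lam) ({κ}ᶜ : Finset ι) (fun w => ∞ * B.indicator 1 w) w₀ ≤
      ∫⁻ w, f w ∂(Measure.pi fun _ => lam) := by
    have hu : (Finset.univ : Finset ι) = {κ}ᶜ ∪ {κ} := by ext; simp
    rw [lintegral_eq_lmarginal_univ w₀, hu,
      lmarginal_union _ f hf (Finset.disjoint_left.2 fun i hi => by simpa using hi)]
    refine lmarginal_mono (fun w => ?_) w₀
    by_cases hw : w ∈ B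
    · rw [lmarginal_singleton]
      exact (le_top.trans_eq (h w hw).symm)
    · simp [hw]
  by_contra hne
  have hm : Measurable fun v => B.indicator (1 : (ι → X) → ℝ≥0∞)
      (Function.updateFinset w₀ ({κ}ᶜ : Finset ι) v) :=
    (measurable_one.indicator hB).comp measurable_updateFinset
  have e : lmarginal (fun _ => lam) ({κ}ᶜ : Finset ι) (fun w => ∞ * B.indicator 1 w) w₀ =
      ∞ * lmarginal (fun _ => lam) ({κ}ᶜ : Finset ι) (B.indicator 1) w₀ :=
    lintegral_const_mul _ hm
  rw [e, ENNReal.top_mul hne] at hle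
  exact hfin (top_le_iff.1 hle)

theorem lmarginal_const_eq_zero (hlam : lam ≠ 0) {s : Finset ι} {c : ℝ≥0∞} {w₀ : ι → X}
    (h : lmarginal (fun _ => lam) s (fun _ => c) w₀ = 0) : c = 0 := by
  rw [lmarginal, lintegral_const, Measure.pi_univ, mul_eq_zero, Finset.prod_eq_zero_iff] at h
  refine h.resolve_right ?_
  rintro ⟨i, -, hi⟩
  exact hlam (Measure.measure_univ_eq_zero.1 hi)

/-- The coordinates on which `D` does not depend contribute only a nonzero, possibly infinite,
factor to the marginal, so its vanishing is decided by the measure of `D`. -/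
theorem ae_of_lmarginal_eq_zero (hlam : lam ≠ 0) {s : Finset ι} {i : ι} (hi : i ∈ s) {D : Set X}
    (hD : MeasurableSet D) {w₀ : ι → X}
    (h : lmarginal (fun _ => lam) s (((fun w => w i) ⁻¹' D).indicator 1) w₀ = 0) :
    ∀ᵐ x ∂lam, x ∉ D := by
  have hm : Measurable (((fun w : ι → X => w i) ⁻¹' D).indicator (1 : (ι → X) → ℝ≥0∞)) :=
    measurable_one.indicator (measurable_pi_apply i hD)
  rw [lmarginal_erase' _ hm hi] at h
  have e : (fun w : ι → X => ∫⁻ x, ((fun w : ι → X => w i) ⁻¹' D).indicator (1 : (ι → X) → ℝ≥0∞)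
      (Function.update w i x) ∂lam) = fun _ => lam D := by
    funext w
    rw [← lintegral_indicator_one hD]
    refine lintegral_congr fun x => ?_
    by_cases hx : x ∈ D <;> simp [Set.indicator, hx]
  rw [e] at h
  exact measure_eq_zero_iff_ae_notMem.1 (lmarginal_const_eq_zero hlam h)

theorem ae_ae_of_lmarginal_eq_zero (hlam : lam ≠ 0) {s : Finset ι} {i j : ι} (hij : i ≠ j)
    (hi : i ∈ s) (hj : j ∈ s) {D : Set (X × X)} (hD : MeasurableSet D) {w₀ : ι → X}
    (h : lmarginal (fun _ => lam) s (((fun w => (w i, w j)) ⁻¹' D).indicator 1) w₀ = 0) :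
    ∀ᵐ x ∂lam, ∀ᵐ z ∂lam, (x, z) ∉ D := by
  have hm : Measurable (((fun w : ι → X => (w i, w j)) ⁻¹' D).indicator (1 : (ι → X) → ℝ≥0∞)) :=
    measurable_one.indicator (((measurable_pi_apply i).prodMk (measurable_pi_apply j)) hD)
  have hD' : Measurable fun x => lam (Prod.mk x ⁻¹' D) := measurable_measure_prodMk_left hD
  rw [lmarginal_erase' _ hm hj] at h
  have e : (fun w : ι → X => ∫⁻ z, ((fun w : ι → X => (w i, w j)) ⁻¹' D).indicator
      (1 : (ι → X) → ℝ≥0∞) (Function.update w j z) ∂lam) =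
      fun w => lam (Prod.mk (w i) ⁻¹' D) := by
    funext w
    rw [← lintegral_indicator_one (measurable_prodMk_left hD)]
    refine lintegral_congr fun x => ?_
    by_cases hx : (w i, x) ∈ D <;> simp [Set.indicator, hij, hx]
  rw [e, lmarginal_erase' (fun w : ι → X => lam (Prod.mk (w i) ⁻¹' D))
    (hD'.comp (measurable_pi_apply i))
    (Finset.mem_erase.2 ⟨hij, hi⟩)] at h
  simp only [Function.update_self] at h
  have h0 := lmarginal_const_eq_zero hlam h
  rw [lintegral_eq_zero_iff hD'] at h0
  exact h0.mono fun x hx => measure_eq_zero_iff_ae_notMem.1 hx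

end Marginals

/-! ### Finite evidence implies finite smoothing integrals almost everywhere -/

section Integrability

variable {n : ℕ} {X Y : Type*} [MeasurableSpace X]
  [MeasurableSpace Y] {lam : Measure X} {nu : Measure Y}
  {m : StateSpaceModel n X Y lam nu} {y : Fin (n + 1) → Y}

theorem StateSpaceModel.measure_ne_zero (m : StateSpaceModel n X Y lam nu) : lam ≠ 0 := by
  rintro rfl
  simpa using m.lintegral_f₁

theorem StateSpaceModel.nonempty (m : StateSpaceModel n X Y lam nu) : Nonempty X := by
  by_contra h
  have := not_nonempty_iff.1 h
  exact m.measure_ne_zero (Measure.eq_zero_of_isEmpty lam)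

theorem jointDensity_eq (z : Fin (n + 1) → X) :
    jointDensity m y z = m.f₁ (z 0) * (∏ t, m.g t (z t) (y t)) *
      ∏ s : Fin n, m.f s (z s.castSucc) (z s.succ) := by
  rw [jointDensity, Finset.prod_mul_distrib, Fin.prod_univ_succ (fun t => m.g t (z t) (y t))]
  ring

/-- The product of a later density factor, an observation density and a density `h`. -/
def smoothingIntegral (m : StateSpaceModel n X Y lam nu) (y : Fin (n + 1) → Y) (s : Fin n)
    (h : X → ℝ≥0) (z : X) : ℝ≥0∞ :=
  ∫⁻ x, (m.g s.castSucc x (y s.castSucc) * m.f s x z * h x : ℝ≥0) ∂lam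

/-- As a function of one coordinate, the joint density is a constant times the few factors involving
that coordinate. The constant is nonzero because all densities of the model are positive, so an
infinite integral of these factors is inherited by the joint density. -/
theorem jointDensity_update_zero (s : Fin n) (hs : s.castSucc = 0) (w : Fin (n + 1) → X) :
    ∃ c : ℝ≥0, c ≠ 0 ∧ ∀ x, jointDensity m y (Function.update w s.castSucc x) =
      c * (m.g s.castSucc x (y s.castSucc) * m.f s x (w s.succ) * m.f₁ x) := by
  refine ⟨(∏ t ∈ Finset.univ.erase s.castSucc, m.g t (w t) (y t)) *
    ∏ r ∈ Finset.univ.erase s, m.f r (w r.castSucc) (w r.succ), ?_, fun x => ?_⟩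
  · exact mul_ne_zero (Finset.prod_ne_zero_iff.2 fun t _ => (m.g_pos _ _ _).ne')
      (Finset.prod_ne_zero_iff.2 fun t _ => (m.f_pos _ _ _).ne')
  · rw [jointDensity_eq, ← Finset.mul_prod_erase _ _ (Finset.mem_univ s.castSucc),
      ← Finset.mul_prod_erase _ _ (Finset.mem_univ s)]
    have e1 : ∏ t ∈ Finset.univ.erase s.castSucc,
        m.g t (Function.update w s.castSucc x t) (y t) =
        ∏ t ∈ Finset.univ.erase s.castSucc, m.g t (w t) (y t) :=
      Finset.prod_congr rfl fun t ht => by rw [Function.update_of_ne (Finset.ne_of_mem_erase ht)]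
    have e2 : ∏ r ∈ Finset.univ.erase s, m.f r (Function.update w s.castSucc x r.castSucc)
        (Function.update w s.castSucc x r.succ) =
        ∏ r ∈ Finset.univ.erase s, m.f r (w r.castSucc) (w r.succ) :=
      Finset.prod_congr rfl fun r hr => by
        rw [Function.update_of_ne fun e => Finset.ne_of_mem_erase hr (Fin.castSucc_injective n e),
          Function.update_of_ne fun e => (Fin.succ_ne_zero r) (e.trans hs)]
    rw [e1, e2, Function.update_self, ← hs, Function.update_self,
      Function.update_of_ne s.castSucc_lt_succ.ne']
    ring

theorem jointDensity_update_succ (s r : Fin n) (hr : s.castSucc = r.succ) (w : Fin (n + 1) → X) :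
    ∃ c : ℝ≥0, c ≠ 0 ∧ ∀ x, jointDensity m y (Function.update w s.castSucc x) =
      c * (m.g s.castSucc x (y s.castSucc) * m.f s x (w s.succ) * m.f r (w r.castSucc) x) := by
  have hrs : r ≠ s := by
    rintro rfl
    exact r.castSucc_lt_succ.ne hr
  refine ⟨m.f₁ (w 0) * (∏ t ∈ Finset.univ.erase s.castSucc, m.g t (w t) (y t)) *
    ∏ r' ∈ (Finset.univ.erase s).erase r, m.f r' (w r'.castSucc) (w r'.succ), ?_, fun x => ?_⟩
  · exact mul_ne_zero (mul_ne_zero (m.f₁_pos _).ne'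
      (Finset.prod_ne_zero_iff.2 fun t _ => (m.g_pos _ _ _).ne'))
      (Finset.prod_ne_zero_iff.2 fun t _ => (m.f_pos _ _ _).ne')
  · rw [jointDensity_eq, ← Finset.mul_prod_erase _ _ (Finset.mem_univ s.castSucc),
      ← Finset.mul_prod_erase _ _ (Finset.mem_univ s),
      ← Finset.mul_prod_erase _ _ (Finset.mem_erase.2 ⟨hrs, Finset.mem_univ r⟩)]
    have e1 : ∏ t ∈ Finset.univ.erase s.castSucc,
        m.g t (Function.update w s.castSucc x t) (y t) =
        ∏ t ∈ Finset.univ.erase s.castSucc, m.g t (w t) (y t) :=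
      Finset.prod_congr rfl fun t ht => by rw [Function.update_of_ne (Finset.ne_of_mem_erase ht)]
    have e2 : ∏ r' ∈ (Finset.univ.erase s).erase r,
        m.f r' (Function.update w s.castSucc x r'.castSucc)
          (Function.update w s.castSucc x r'.succ) =
        ∏ r' ∈ (Finset.univ.erase s).erase r, m.f r' (w r'.castSucc) (w r'.succ) :=
      Finset.prod_congr rfl fun r' hr' => by
        rw [Finset.mem_erase, Finset.mem_erase] at hr'
        rw [Function.update_of_ne fun e => hr'.2.1 (Fin.castSucc_injective n e),
          Function.update_of_ne fun e => hr'.1 (Fin.succ_injective n (e.trans hr))]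
    rw [e1, e2, Function.update_self, Function.update_of_ne s.castSucc_lt_succ.ne',
      Function.update_of_ne (a := r.castSucc) (by rw [hr]; exact r.castSucc_lt_succ.ne),
      Function.update_of_ne (a := (0 : Fin (n + 1))) (by rw [hr]; exact (Fin.succ_ne_zero r).symm)]
    rw [show Function.update w s.castSucc x r.succ = x by rw [← hr, Function.update_self]]
    ring

theorem lintegral_jointDensity_update {s : Fin n} {w : Fin (n + 1) → X} {h : X → ℝ≥0}
    {c : ℝ≥0} (hc : c ≠ 0)
    (e : ∀ x, jointDensity m y (Function.update w s.castSucc x) =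
      c * (m.g s.castSucc x (y s.castSucc) * m.f s x (w s.succ) * h x))
    (htop : smoothingIntegral m y s h (w s.succ) = ∞) :
    ∫⁻ x, (jointDensity m y (Function.update w s.castSucc x) : ℝ≥0∞) ∂lam = ∞ := by
  simp only [e, ENNReal.coe_mul c]
  rw [lintegral_const_mul', ← smoothingIntegral, htop, ENNReal.mul_top (by simpa using hc)]
  exact ENNReal.coe_ne_top

theorem measurable_smoothingIntegral [SigmaFinite lam] (s : Fin n) {h : X → ℝ≥0}
    (hh : Measurable h) : Measurable (smoothingIntegral m y s h) := by
  refine Measurable.lintegral_prod_right' (f := fun p : X × X =>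
    ((m.g s.castSucc p.2 (y s.castSucc) * m.f s p.2 p.1 * h p.2 : ℝ≥0) : ℝ≥0∞)) ?_
  exact ((((measurable_observation m _ _).comp measurable_snd).mul
    ((m.measurable_f s).comp measurable_swap)).mul (hh.comp measurable_snd)).coe_nnreal_ennreal

theorem ae_smoothingIntegral_zero [SigmaFinite lam] (hy : evidence m y ≠ ∞) (s : Fin n)
    (hs : s.castSucc = 0) : ∀ᵐ z ∂lam, smoothingIntegral m y s m.f₁ z ≠ ∞ := by
  obtain ⟨x₀⟩ : Nonempty X := m.nonempty
  have hD : MeasurableSet {z | smoothingIntegral m y s m.f₁ z = ∞} :=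
    (measurableSet_singleton (∞ : ℝ≥0∞)).preimage
      (measurable_smoothingIntegral s m.measurable_f₁)
  refine ae_of_lmarginal_eq_zero m.measure_ne_zero (s := {s.castSucc}ᶜ) (i := s.succ)
    (by simpa using s.castSucc_lt_succ.ne') hD (w₀ := fun _ => x₀) ?_
  refine lmarginal_compl_indicator_eq_zero (measurable_jointDensity m y).coe_nnreal_ennreal hy
    (measurable_pi_apply s.succ hD) (fun w hw => ?_) _
  obtain ⟨c, hc, e⟩ := jointDensity_update_zero (m := m) (y := y) s hs w
  exact lintegral_jointDensity_update hc e hw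

theorem measurable_smoothingIntegral_succ [SigmaFinite lam] (s r : Fin n) :
    Measurable fun p : X × X => smoothingIntegral m y s (m.f r p.1) p.2 := by
  refine Measurable.lintegral_prod_right' (f := fun p : (X × X) × X =>
    ((m.g s.castSucc p.2 (y s.castSucc) * m.f s p.2 p.1.2 * m.f r p.1.1 p.2 : ℝ≥0) : ℝ≥0∞)) ?_
  exact ((((measurable_observation m _ _).comp measurable_snd).mul
    ((m.measurable_f s).comp (f := fun p : (X × X) × X => (p.2, p.1.2)) (by fun_prop))).mul
      ((m.measurable_f r).comp (f := fun p : (X × X) × X => (p.1.1, p.2))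
        (by fun_prop))).coe_nnreal_ennreal

/-- If the integral over the middle one of three successive states were infinite on a non-negligible
set of outer states, the evidence would be infinite. -/
theorem ae_smoothingIntegral_succ [SigmaFinite lam] (hy : evidence m y ≠ ∞) (s r : Fin n)
    (hr : s.castSucc = r.succ) :
    ∀ᵐ x ∂lam, ∀ᵐ z ∂lam, smoothingIntegral m y s (m.f r x) z ≠ ∞ := by
  obtain ⟨x₀⟩ : Nonempty X := m.nonempty
  have hD : MeasurableSet {p : X × X | smoothingIntegral m y s (m.f r p.1) p.2 = ∞} :=
    (measurableSet_singleton (∞ : ℝ≥0∞)).preimage (measurable_smoothingIntegral_succ s r)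
  have h1 : r.castSucc < s.castSucc := hr ▸ r.castSucc_lt_succ
  refine ae_ae_of_lmarginal_eq_zero m.measure_ne_zero (s := {s.castSucc}ᶜ) (i := r.castSucc)
    (j := s.succ) (h1.trans s.castSucc_lt_succ).ne
    (by simpa using fun e => h1.ne (congrArg Fin.castSucc e))
    (by simpa using s.castSucc_lt_succ.ne') hD (w₀ := fun _ => x₀) ?_
  refine lmarginal_compl_indicator_eq_zero (measurable_jointDensity m y).coe_nnreal_ennreal hy
    (((measurable_pi_apply r.castSucc).prodMk (measurable_pi_apply s.succ)) hD)
    (fun w hw => ?_) _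
  obtain ⟨c, hc, e⟩ := jointDensity_update_succ (m := m) (y := y) s r hr w
  exact lintegral_jointDensity_update hc e hw

end Integrability

/-! ### Exceptional sets -/

section Absorption

/-- An integral that ignores a null set passes this property on to every product in which it can be
moved to the right end. -/
theorem exists_prod_eq_mul_of_mem {M ι : Type*} [Monoid M] {f : ι → M} {l : List ι}
    (h : l.Pairwise fun i j => Commute (f i) (f j)) {x : ι} (hx : x ∈ l) :
    ∃ Y, (l.map f).prod = Y * f x := by
  obtain ⟨s, t, rfl⟩ := List.append_of_mem hx
  refine ⟨((s ++ t).map f).prod, ?_⟩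
  rw [list_prod_perm (l' := (s ++ t) ++ [x]) 
    (List.perm_middle.trans (List.perm_append_singleton x _).symm) h,
    List.map_append, List.prod_append, List.map_singleton, List.prod_singleton]

variable {U α β : Type*} [MeasurableSpace U] [MeasurableSpace α] [MeasurableSpace β]

theorem mul_weigh_prod_of_forall {O : Op U} {k : ℕ} {d : Fin k → measurableFunctions U}
    (h : ∀ i, O * weigh (d i) = O) : O * weigh (∏ i, d i) = O := by
  rw [weigh_prod]
  induction List.finRange k with
  | nil => simp
  | cons i l ih => rw [List.map_cons, List.prod_cons, ← mul_assoc, h, ih]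

/-- The indicator function of a measurable set. -/
def indicatorFunction (S : Set U) (hS : MeasurableSet S) : measurableFunctions U :=
  ⟨S.indicator 1, show Measurable (S.indicator 1) from measurable_one.indicator hS⟩

theorem indicatorFunction_of_mem {S : Set U} {hS : MeasurableSet S} {u : U} (h : u ∈ S) :
    (indicatorFunction S hS).1 u = 1 := Set.indicator_of_mem h _

theorem mem_of_indicatorFunction_ne_zero {S : Set U} {hS : MeasurableSet S} {u : U}
    (h : (indicatorFunction S hS).1 u ≠ 0) : u ∈ S := Set.mem_of_indicator_ne_zero h

theorem assignOp_mul_weigh_indicatorFunction {κ : Kernel U α} [IsSFiniteKernel κ]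
    {set : U → α → U} {hset : Measurable (Function.uncurry set)} {S : Set U}
    {hS : MeasurableSet S} (h : ∀ u, ∀ᵐ z ∂κ u, set u z ∈ S) :
    assignOp κ set hset * weigh (indicatorFunction S hS) = assignOp κ set hset := by
  refine Op.ext fun F u => ?_
  rw [Op.eval_mul, eval_assignOp, eval_assignOp]
  refine lintegral_congr_ae ((h u).mono fun z hz => ?_)
  change (indicatorFunction S hS).1 (set u z) * F.1 (set u z) = F.1 (set u z)
  rw [indicatorFunction_of_mem hz, one_mul]

theorem assignOp_mul_assignOp_mul_weigh_indicatorFunction {κ : Kernel U α} [IsSFiniteKernel κ]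
    {set : U → α → U} {hset : Measurable (Function.uncurry set)} {κ' : Kernel U β}
    [IsSFiniteKernel κ'] {set' : U → β → U} {hset' : Measurable (Function.uncurry set')} {S : Set U}
    {hS : MeasurableSet S}
    (h : ∀ u, ∀ᵐ x ∂κ u, ∀ᵐ z ∂κ' (set u x), set' (set u x) z ∈ S) :
    assignOp κ set hset * assignOp κ' set' hset' * weigh (indicatorFunction S hS) =
      assignOp κ set hset * assignOp κ' set' hset' := by
  refine Op.ext fun F u => ?_
  rw [mul_assoc, Op.eval_mul, Op.eval_mul, eval_assignOp, eval_assignOp]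
  refine lintegral_congr_ae ((h u).mono fun x hx => ?_)
  refine lintegral_congr_ae (hx.mono fun z hz => ?_)
  change (indicatorFunction S hS).1 (set' (set u x) z) * F.1 _ = F.1 _
  rw [indicatorFunction_of_mem hz, one_mul]

end Absorption

/-! ### Removing the points where a target has infinite mass -/

section Exceptional

variable {n : ℕ} {N : Fin (n + 1) → ℕ} {C : Fin n → ℕ} {X Y : Type*} [MeasurableSpace X]
  [MeasurableSpace Y] {lam : Measure X} {nu : Measure Y}
  {m : StateSpaceModel n X Y lam nu} {q : ImportanceDensities n X Y lam} {y : Fin (n + 1) → Y}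

theorem predictive_of_eq_zero {x : States N X} {a : Parents N} {t : Fin (n + 1)} (h : t = 0)
    (z : X) : predictive m q y x a t z = m.f₁ z := by
  subst h
  rfl

theorem predictive_of_eq_succ {x : States N X} {a : Parents N} {t : Fin (n + 1)} {p : Fin n}
    (h : t = p.succ) (z : X) :
    predictive m q y x a t z =
      ∑ i, weight m q y x a p.castSucc i * m.f p (x p.castSucc i) z := by
  subst h
  rfl

theorem lintegral_targetDensity_of_eq_zero {x : States N X} {a : Parents N} {s : Fin n}
    (h : s.castSucc = 0) (z : X) :
    ∫⁻ x', (targetDensity m q y x a z s x' : ℝ≥0∞) ∂lam = smoothingIntegral m y s m.f₁ z := by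
  simp only [targetDensity, predictive_of_eq_zero h, smoothingIntegral]

/-- The predictive density is a finite mixture with finite weights, so the mass of the target is
finite as soon as it is finite for each particle one step back. -/
theorem lintegral_targetDensity_of_eq_succ {x : States N X} {a : Parents N} {s p : Fin n}
    (h : s.castSucc = p.succ) (z : X) :
    ∫⁻ x', (targetDensity m q y x a z s x' : ℝ≥0∞) ∂lam =
      ∑ i, (weight m q y x a p.castSucc i : ℝ≥0∞) *
        smoothingIntegral m y s (m.f p (x p.castSucc i)) z := by
  have hm : ∀ i, Measurable fun x' => ((m.g s.castSucc x' (y s.castSucc) * m.f s x' z *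
      m.f p (x p.castSucc i) x' : ℝ≥0) : ℝ≥0∞) := fun i =>
    (((measurable_observation m _ _).mul ((m.measurable_f s).comp measurable_prodMk_right)).mul
      ((m.measurable_f p).comp measurable_prodMk_left)).coe_nnreal_ennreal
  simp only [smoothingIntegral]
  simp_rw [← lintegral_const_mul _ (hm _)]
  rw [← lintegral_finsetSum _ fun i _ => (hm i).const_mul _]
  refine lintegral_congr fun x' => ?_
  rw [targetDensity, predictive_of_eq_succ h, Finset.mul_sum, ENNReal.ofNNReal_finsetSum]
  refine Finset.sum_congr rfl fun i _ => ?_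
  rw [← ENNReal.coe_mul]
  congr 1
  ring

theorem commute_otherStatesOp [SFinite lam] [Nonempty X] {t t' : Fin (n + 1)} (h : t ≠ t') :
    Commute (otherStatesOp (N := N) (C := C) lam t) (otherStatesOp lam t') :=
  list_prod_commute_list_prod fun _ _ _ _ => commute_skipOp_skipOp
    (fun u z w _ _ => setState_comm (fun e => h (congrArg Sigma.fst e)) u z w)
    (fun _ _ => Iff.rfl) fun _ _ => Iff.rfl

variable [∀ s, NeZero (C s)]

theorem commute_stateOp_selectedOp [SFinite lam] {t t' : Fin (n + 1)} (h : t < Fin.last n)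
    (i : Fin (N t)) : Commute (stateOp (N := N) (C := C) lam t i) (selectedOp lam t') :=
  commute_assignOp (fun _ z w => setSelected_setState_comm
    (fun e e' => h.ne ((congrArg Sigma.fst e').trans e)) z w) (fun _ _ => rfl) fun _ _ => rfl

/-- A run which is not yet exchanged contributes the integral over its starting particle. Together
with the non-selected particles this covers all particles of its time, so an arbitrary one of them
is integrated, whatever the selected index is. -/
theorem exists_mul_stateOp [SFinite lam] [Nonempty X] {l : List (Fin n)}
    (hl : l.Nodup) {p : Fin n} (hp : p ∈ l) (i : Fin (N p.castSucc)) :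
    ∃ Y, ((List.finRange (n + 1)).map fun t => otherStatesOp (N := N) (C := C) lam t).prod *
        (l.map fun s => pathOp lam s 0).prod = Y * stateOp lam p.castSucc i := by
  obtain ⟨Y₁, h₁⟩ := exists_prod_eq_mul_of_mem
    (f := fun t => otherStatesOp (N := N) (C := C) lam t)
    (pairwise_finRange fun t t' h => commute_otherStatesOp h.ne) (List.mem_finRange p.castSucc)
  obtain ⟨Y₂, h₂⟩ := exists_prod_eq_mul_of_mem
    (f := fun s => pathOp (N := N) (C := C) lam s 0)
    (List.Pairwise.imp (fun h => commute_pathOp h) hl) hp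
  obtain ⟨Y₃, h₃⟩ := exists_prod_eq_mul_of_mem
    (f := fun i => stateOp (N := N) (C := C) lam p.castSucc i)
    (pairwise_finRange fun i j h => commute_stateOp fun e => h.ne (by simpa using e))
    (List.mem_finRange i)
  have hc : Commute (otherStatesOp (N := N) (C := C) lam p.castSucc)
      (l.map fun s => pathOp lam s 0).prod :=
    commute_list_prod fun s _ => commute_otherStatesOp_selectedStateOp p.castSucc s.castSucc
  have hc' : pathOp (N := N) (C := C) lam p 0 * otherStatesOp lam p.castSucc =
      statesOp lam p.castSucc := by
    rw [statesOp_eq]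
    exact (commute_otherStatesOp_selectedStateOp p.castSucc p.castSucc).eq.symm
  refine ⟨Y₁ * Y₂ * Y₃, ?_⟩
  rw [h₁, mul_assoc Y₁, hc.eq, h₂, mul_assoc Y₂, hc', statesOp, h₃]
  simp only [mul_assoc]

/-- The state selected one step after run `k` is integrated as well: it is either the final particle
or the end of the next run, which is already exchanged. -/
theorem exists_mul_selectedOp [SFinite lam] {l r : List (Fin n)} {k : Fin n}
    (h : l ++ k :: r = List.finRange n) :
    ∃ Y, (r.map fun s => pathOp (N := N) (C := C) lam s (Fin.last (C s))).prod *
        selectedStateOp lam (Fin.last n) = Y * selectedOp lam k.succ := by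
  have hp := List.pairwise_lt_finRange n
  rw [← h, List.pairwise_append, List.pairwise_cons] at hp
  rcases Fin.eq_castSucc_or_eq_last k.succ with ⟨s, hs⟩ | hs
  · have hks : k < s := by
      rw [← Fin.castSucc_lt_castSucc_iff, ← hs]
      exact k.castSucc_lt_succ
    have hsr : s ∈ r := by
      have hs' : s ∈ l ++ k :: r := h ▸ List.mem_finRange s
      rw [List.mem_append, List.mem_cons] at hs'
      rcases hs' with hs' | hs' | hs'
      · exact absurd (hp.2.2 s hs' k (by simp)) hks.asymm
      · exact absurd hs' hks.ne'
      · exact hs'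
    obtain ⟨Y, hY⟩ := exists_prod_eq_mul_of_mem
      (f := fun s => pathOp (N := N) (C := C) lam s (Fin.last (C s)))
      (hp.2.1.2.imp fun h => commute_pathOp h.ne) hsr
    refine ⟨Y * selectedStateOp lam (Fin.last n), ?_⟩
    rw [hY, hs, selectedOp_castSucc, mul_assoc, mul_assoc, (commute_pathOp_selectedStateOp s _).eq]
  · exact ⟨_, by rw [hs, selectedOp_last]⟩

/-- Up to null sets, the targets of the Markov chain runs are finite measures. -/
theorem exists_weigh_eq [SigmaFinite lam] [Nonempty X] (hy : evidence m y ≠ ∞)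
    (B : Op (ExtSpace N C X)) {l r : List (Fin n)} {k : Fin n}
    (h : l ++ k :: r = List.finRange n) :
    ∃ d : measurableFunctions (ExtSpace N C X),
      (∀ u, d.1 u ≠ 0 → ∫⁻ x, (targetDensity m q y u.1 u.2.1 (selected u k.succ) k x : ℝ≥0∞)
        ∂lam ≠ ∞) ∧
      B * ((List.finRange (n + 1)).map fun t => otherStatesOp (N := N) (C := C) lam t).prod *
        (l.map fun s => pathOp lam s 0).prod *
        (r.map fun s => pathOp lam s (Fin.last (C s))).prod *
        selectedStateOp lam (Fin.last n) * weigh d =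
      B * ((List.finRange (n + 1)).map fun t => otherStatesOp (N := N) (C := C) lam t).prod *
        (l.map fun s => pathOp lam s 0).prod *
        (r.map fun s => pathOp lam s (Fin.last (C s))).prod *
        selectedStateOp lam (Fin.last n) := by
  have hp := List.pairwise_lt_finRange n
  rw [← h, List.pairwise_append, List.pairwise_cons] at hp
  obtain ⟨Y, hY⟩ := exists_mul_selectedOp (N := N) (C := C) (lam := lam) h
  -- At the first time, finiteness is a condition on the next selected state alone; later it
  -- suffices to impose one condition on this state and each particle one step back.
  rcases Fin.eq_zero_or_eq_succ k.castSucc with hk | ⟨p, hk⟩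
  · have hS : MeasurableSet {u : ExtSpace N C X |
        smoothingIntegral m y k m.f₁ (selected u k.succ) ≠ ∞} :=
      ((measurableSet_singleton (∞ : ℝ≥0∞)).compl).preimage
        ((measurable_smoothingIntegral k m.measurable_f₁).comp (measurable_selected k.succ))
    refine ⟨indicatorFunction _ hS, fun u hu => ?_, ?_⟩
    · rw [lintegral_targetDensity_of_eq_zero hk]
      exact mem_of_indicatorFunction_ne_zero hu
    · rw [mul_assoc _ _ (selectedStateOp lam (Fin.last n)), hY]
      simp only [mul_assoc]
      rw [selectedOp, assignOp_mul_weigh_indicatorFunction]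
      refine fun u => (ae_smoothingIntegral_zero hy k hk).mono fun z hz => ?_
      rw [Set.mem_ofPred_eq, selected_setSelected, Function.update_self]
      exact hz
  · have hS : ∀ i, MeasurableSet {u : ExtSpace N C X |
        smoothingIntegral m y k (m.f p (u.1 p.castSucc i)) (selected u k.succ) ≠ ∞} := fun i =>
      ((measurableSet_singleton (∞ : ℝ≥0∞)).compl).preimage
        ((measurable_smoothingIntegral_succ k p).comp
          ((measurable_state p.castSucc i).prodMk (measurable_selected k.succ)))
    have hpk : p < k := by
      rw [← Fin.castSucc_lt_castSucc_iff, hk]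
      exact p.castSucc_lt_succ
    have hpl : p ∈ l := by
      have hp' : p ∈ l ++ k :: r := h ▸ List.mem_finRange p
      rw [List.mem_append, List.mem_cons] at hp'
      rcases hp' with hp' | hp' | hp'
      · exact hp'
      · exact absurd hp' hpk.ne
      · exact absurd (hp.2.1.1 p hp') hpk.asymm
    refine ⟨∏ i, indicatorFunction _ (hS i), fun u hu => ?_, ?_⟩
    · rw [lintegral_targetDensity_of_eq_succ hk]
      refine ENNReal.sum_ne_top.2 fun i _ => ENNReal.mul_ne_top ENNReal.coe_ne_top ?_
      rw [Submonoid.coe_finsetProd, Finset.prod_apply, Finset.prod_ne_zero_iff] at hu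
      exact mem_of_indicatorFunction_ne_zero (hu i (Finset.mem_univ i))
    · refine mul_weigh_prod_of_forall fun i => ?_
      obtain ⟨Y', hY'⟩ := exists_mul_stateOp (N := N) (C := C) (lam := lam) (hp.1.imp ne_of_lt) hpl i
      have hc : Commute (stateOp (N := N) (C := C) lam p.castSucc i)
          ((r.map fun s => pathOp lam s (Fin.last (C s))).prod *
            selectedStateOp lam (Fin.last n)) := by
        rw [← selectedOp_last]
        refine Commute.mul_right (commute_list_prod fun s _ => ?_)
          (commute_stateOp_selectedOp p.castSucc_lt_last i)
        rw [← selectedOp_castSucc]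
        exact commute_stateOp_selectedOp p.castSucc_lt_last i
      have hc' : Commute (stateOp (N := N) (C := C) lam p.castSucc i) (selectedOp lam k.succ) :=
        commute_stateOp_selectedOp p.castSucc_lt_last i
      -- The two variables on which the exceptional set depends are brought to the right end, next
      -- to its indicator.
      rw [mul_assoc _ _ (selectedStateOp lam (Fin.last n)), mul_assoc B, hY', mul_assoc B,
        mul_assoc Y', hc.eq, hY, mul_assoc Y, ← hc'.eq]
      have key : stateOp (N := N) (C := C) lam p.castSucc i * selectedOp lam k.succ *
          weigh (indicatorFunction _ (hS i)) = stateOp lam p.castSucc i * selectedOp lam k.succ := by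
        refine assignOp_mul_assignOp_mul_weigh_indicatorFunction fun u =>
          (ae_smoothingIntegral_succ hy k p hk).mono fun x hx => hx.mono fun z hz => ?_
        have e : (setSelected k.succ (setState p.castSucc i u x) z).1 p.castSucc i = x := by
          rw [setSelected_states_of_ne (t := k.succ) (t' := p.castSucc) (fun e e' => p.castSucc_lt_last.ne
            ((congrArg Sigma.fst e').trans e)), setState_self]
        rw [Set.mem_ofPred_eq, selected_setSelected, Function.update_self, e]
        exact hz
      rw [mul_assoc, mul_assoc, mul_assoc, key]

end Exceptional

/-! ### The density of the extended target with respect to the proposal law -/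

/-- Here `x` stands for the selected particles and `z` for the selected trajectory. The backward
probabilities have the normalisers `pz s.succ`, and the parent probabilities `px s.succ`: both are
predictive densities and cancel against those in the targets. The weights `w` cancel the importance
densities. What is left over sits at the two ends of time, where the predictive density is the
initial density and where trajectory and particle coincide, respectively. -/
theorem density_identity {n : ℕ} {w W gz gx pz px : Fin (n + 1) → ℝ≥0}
    {fxz fz fa wa M : Fin n → ℝ≥0} {M₀ fz₀ fx₀ : ℝ≥0}
    (hw₀ : w 0 * M₀ = gx 0 * fx₀) (hw : ∀ s : Fin n, w s.succ * M s = gx s.succ * fa s)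
    (hpz : pz 0 = fz₀) (hpx : px 0 = fx₀) (hp : pz (Fin.last n) = px (Fin.last n))
    (hg : gz (Fin.last n) = gx (Fin.last n)) (w_ne : ∀ t, w t ≠ 0) (W_ne : ∀ t, W t ≠ 0)
    (gx_ne : ∀ t, gx t ≠ 0) (pz_ne : ∀ t, pz t ≠ 0) (px_ne : ∀ t, px t ≠ 0) (M₀_ne : M₀ ≠ 0)
    (M_ne : ∀ s, M s ≠ 0) :
    w (Fin.last n) / W (Fin.last n) * (∏ s : Fin n, w s.castSucc * fxz s / pz s.succ) *
        (∏ t, W t) * (∏ s : Fin n, gz s.castSucc * fz s * pz s.castSucc) *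
        (M₀ * ∏ s : Fin n, wa s / W s.castSucc * M s) =
      (gz 0 * fz₀ * ∏ s : Fin n, gz s.succ * fz s) * (∏ s : Fin n, wa s * fa s / px s.succ) *
        ∏ s : Fin n, gx s.castSucc * fxz s * px s.castSucc := by
  -- Shifts a product over the non-final times to the non-initial ones, at the cost of boundary
  -- factors, so that all products run over the same times.
  have aux : ∀ v : Fin (n + 1) → ℝ≥0, v (Fin.last n) ≠ 0 →
      ∏ s : Fin n, v s.castSucc = v 0 * (∏ s : Fin n, v s.succ) / v (Fin.last n) := fun v hv => by
    rw [eq_div_iff hv, ← Fin.prod_univ_castSucc, Fin.prod_univ_succ]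
  have hW : ∏ s : Fin n, W s.castSucc ≠ 0 := Finset.prod_ne_zero_iff.2 fun s _ => W_ne _
  have hPz : ∏ s : Fin n, pz s.succ ≠ 0 := Finset.prod_ne_zero_iff.2 fun s _ => pz_ne _
  have hPx : ∏ s : Fin n, px s.succ ≠ 0 := Finset.prod_ne_zero_iff.2 fun s _ => px_ne _
  have hM : ∏ s, M s ≠ 0 := Finset.prod_ne_zero_iff.2 fun s _ => M_ne _
  have h0 : w 0 = gx 0 * fx₀ / M₀ := by rw [eq_div_iff M₀_ne, hw₀]
  have h1 : ∏ s : Fin n, w s.succ = (∏ s : Fin n, gx s.succ) * (∏ s, fa s) / ∏ s, M s := by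
    rw [eq_div_iff hM, ← Finset.prod_mul_distrib, ← Finset.prod_mul_distrib]
    exact Finset.prod_congr rfl fun s _ => hw s
  simp only [Finset.prod_mul_distrib, Finset.prod_div_distrib]
  rw [Fin.prod_univ_castSucc W, aux w (w_ne _), aux pz (pz_ne _), aux px (px_ne _),
    aux gz (hg ▸ gx_ne _), aux gx (gx_ne _), h0, h1, hpz, hpx, hp, hg]
  have n1 := w_ne (Fin.last n)
  have n2 := W_ne (Fin.last n)
  have n3 := gx_ne (Fin.last n)
  have n4 := px_ne (Fin.last n)
  clear hw hpz hpx hp hg w_ne W_ne gx_ne pz_ne px_ne M_ne aux h0 h1 hw₀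
  generalize w (Fin.last n) = a at *
  generalize W (Fin.last n) = b at *
  generalize gx (Fin.last n) = c at *
  generalize px (Fin.last n) = d at *
  generalize ∏ s : Fin n, W s.castSucc = P₁ at *
  generalize ∏ s : Fin n, pz s.succ = P₂ at *
  generalize ∏ s : Fin n, px s.succ = P₃ at *
  generalize ∏ s, M s = P₄ at *
  generalize ∏ s : Fin n, gx s.succ = P₅
  generalize ∏ s : Fin n, gz s.succ = P₆
  generalize ∏ s, fa s = P₇
  generalize ∏ s, fxz s = P₈
  generalize ∏ s, fz s = P₉
  generalize ∏ s, wa s = P₁₀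
  generalize gx 0 = e
  generalize gz 0 = e'
  -- Both sides are one and the same monomial, up to quotients of the form `v / v` with `v` nonzero.
  have hl : a / b * (e * fx₀ / M₀ * (P₅ * P₇ / P₄) / a * P₈ / P₂) * (P₁ * b) *
      (e' * P₆ / c * P₉ * (fz₀ * P₂ / d)) * (M₀ * (P₁₀ / P₁ * P₄)) =
      (a / a) * (b / b) * (M₀ / M₀) * (P₁ / P₁) * (P₂ / P₂) * (P₄ / P₄) *
        (e * fx₀ * P₅ * P₇ * P₈ * e' * P₆ * P₉ * fz₀ * P₁₀ * c⁻¹ * d⁻¹) := by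
    simp only [div_eq_mul_inv]
    generalize a⁻¹ = i₁, b⁻¹ = i₂, c⁻¹ = i₃, d⁻¹ = i₄, P₁⁻¹ = i₅, P₂⁻¹ = i₆, P₄⁻¹ = i₇, M₀⁻¹ = i₈
    ac_rfl
  have hr : e' * fz₀ * (P₆ * P₉) * (P₁₀ * P₇ / P₃) * (e * P₅ / c * P₈ * (fx₀ * P₃ / d)) =
      (P₃ / P₃) * (e * fx₀ * P₅ * P₇ * P₈ * e' * P₆ * P₉ * fz₀ * P₁₀ * c⁻¹ * d⁻¹) := by
    simp only [div_eq_mul_inv]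
    generalize c⁻¹ = i₃, d⁻¹ = i₄, P₃⁻¹ = i₅
    ac_rfl
  rw [hl, hr, div_self n1, div_self n2, div_self M₀_ne, div_self hW, div_self hPz, div_self hPx,
    div_self hM]
  simp only [one_mul]

/-! ### From the pointwise identity to the equality of measures -/

section Identity

variable {n : ℕ} {N : Fin (n + 1) → ℕ} {C : Fin n → ℕ} {X Y : Type*} [MeasurableSpace X]
  [MeasurableSpace Y] {lam : Measure X} {nu : Measure Y}
  {m : StateSpaceModel n X Y lam nu} {q : ImportanceDensities n X Y lam} {y : Fin (n + 1) → Y}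

theorem predictive_pos [∀ t, NeZero (N t)] (hq : q.Positive) (x : States N X) (a : Parents N)
    (t : Fin (n + 1)) (z : X) : 0 < predictive m q y x a t z := by
  cases t using Fin.cases with
  | zero => exact m.f₁_pos z
  | succ s => exact sum_backwardWeight_pos hq x a z s

theorem targetDensity_pos [∀ t, NeZero (N t)] (hq : q.Positive) (x : States N X) (a : Parents N)
    (z : X) (s : Fin n) (x' : X) : 0 < targetDensity m q y x a z s x' :=
  mul_pos (mul_pos (m.g_pos _ _ _) (m.f_pos _ _ _)) (predictive_pos hq x a _ _)

theorem selectedFilterDensity_pos [∀ t, NeZero (N t)] (hq : q.Positive) (x : States N X)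
    (a : Parents N) (b : Indices N) : 0 < selectedFilterDensity m q y x a b :=
  mul_pos (hq.1 _ _) (Finset.prod_pos fun _ _ =>
    mul_pos (div_pos (weight_pos hq _ _ _ _) (sum_weight_pos hq _ _ _)) (hq.2 _ _ _ _))

theorem selected_density_identity [∀ t, NeZero (N t)] (hq : q.Positive)
    (x : States N X) (a : Parents N) (b : Indices N) (z : Fin (n + 1) → X)
    (hz : z (Fin.last n) = x (Fin.last n) (b (Fin.last n))) :
    normalize (weight m q y x a (Fin.last n)) (b (Fin.last n)) *
        (∏ s : Fin n, normalize (backwardWeight m q y x a (z s.succ) s) (b s.castSucc)) *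
        (∏ t, ∑ i, weight m q y x a t i) *
        (∏ s : Fin n, targetDensity m q y x a (z s.succ) s (z s.castSucc)) *
        selectedFilterDensity m q y x a b =
      jointDensity m y z *
        (∏ s : Fin n, normalize (backwardWeight m q y x a (x s.succ (b s.succ)) s)
          (a s (b s.succ))) *
        ∏ s : Fin n, targetDensity m q y x a (z s.succ) s (x s.castSucc (b s.castSucc)) :=
  density_identity (w := fun t => weight m q y x a t (b t))
    (W := fun t => ∑ i, weight m q y x a t i)
    (gz := fun t => m.g t (z t) (y t)) (gx := fun t => m.g t (x t (b t)) (y t))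
    (pz := fun t => predictive m q y x a t (z t))
    (px := fun t => predictive m q y x a t (x t (b t)))
    (fxz := fun s => m.f s (x s.castSucc (b s.castSucc)) (z s.succ))
    (fz := fun s => m.f s (z s.castSucc) (z s.succ))
    (fa := fun s => m.f s (x s.castSucc (a s (b s.succ))) (x s.succ (b s.succ)))
    (wa := fun s => weight m q y x a s.castSucc (a s (b s.succ)))
    (M := fun s => q.M s (y s.succ) (x s.castSucc (a s (b s.succ))) (x s.succ (b s.succ)))
    (M₀ := q.M₁ (y 0) (x 0 (b 0))) (fz₀ := m.f₁ (z 0)) (fx₀ := m.f₁ (x 0 (b 0)))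
    (div_mul_cancel₀ _ (hq.1 _ _).ne') (fun s => div_mul_cancel₀ _ (hq.2 _ _ _ _).ne')
    rfl rfl (by rw [hz]) (by rw [hz]) (fun t => (weight_pos hq _ _ _ _).ne')
    (fun t => (sum_weight_pos hq _ _ _).ne') (fun t => (m.g_pos _ _ _).ne')
    (fun t => (predictive_pos hq _ _ _ _).ne') (fun t => (predictive_pos hq _ _ _ _).ne')
    (hq.1 _ _).ne' fun s => (hq.2 _ _ _ _).ne'

theorem measurable_filterDensity :
    Measurable fun u : ExtSpace N C X => filterDensity m q y u.1 u.2.1 :=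
  (Finset.measurable_fun_prod _ fun i _ => measurable_initialDensity q y i).mul
    (Finset.measurable_fun_prod _ fun s _ =>
      (Finset.measurable_fun_prod _ fun i _ => measurable_parentProb m q y s i).mul
        (Finset.measurable_fun_prod _ fun i _ => measurable_proposalDensity q y s i))

theorem measurable_selectedFilterDensity :
    Measurable fun u : ExtSpace N C X => selectedFilterDensity m q y u.1 u.2.1 u.2.2.1 :=
  (measurable_apply_index (fun i => measurable_initialDensity q y i) (measurable_index 0)).mul
    (Finset.measurable_fun_prod _ fun s _ =>
      (measurable_apply_index (fun i => measurable_parentProb m q y s i)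
        (measurable_index s.succ)).mul
      (measurable_apply_index (fun i => measurable_proposalDensity q y s i)
        (measurable_index s.succ)))

theorem measurable_selectedParent (s : Fin n) :
    Measurable fun u : ExtSpace N C X => u.2.1 s (u.2.2.1 s.succ) :=
  measurable_apply_index (fun i => measurable_parent s i) (measurable_index s.succ)

theorem measurable_selectedParentProb (s : Fin n) :
    Measurable fun u : ExtSpace N C X =>
      normalize (backwardWeight m q y u.1 u.2.1 (u.1 s.succ (u.2.2.1 s.succ)) s)
        (u.2.1 s (u.2.2.1 s.succ)) :=
  measurable_apply_index (fun k => measurable_normalize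
    (fun i => measurable_backwardWeight m q y s i (measurable_selectedState s.succ)) k)
    (measurable_selectedParent s)

theorem measurable_selected_pi : Measurable fun u : ExtSpace N C X => selected u :=
  measurable_pi_lambda _ fun t => measurable_selected t

theorem measurable_extendedDensity [SigmaFinite lam] :
    Measurable fun u : ExtSpace N C X => extendedDensity m q y u :=
  (((((measurable_posteriorDensity m y).comp measurable_selected_pi).mul_const _).mul
    (measurable_filterDensity.div measurable_selectedFilterDensity).coe_nnreal_ennreal).mul
    (Finset.measurable_fun_prod _ fun s _ =>
      measurable_selectedParentProb s).coe_nnreal_ennreal).mul_const _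

theorem measurable_densityRatio :
    Measurable fun u : ExtSpace N C X => densityRatio m q y u :=
  (Finset.measurable_fun_prod _ fun t _ =>
    (Finset.measurable_fun_sum _ fun i _ =>
      measurable_weight m q y t i).mul_const _).coe_nnreal_ennreal.div_const _

/-- Finiteness of the evidence matters here, since division by `∞` would give zero. -/
theorem densityRatio_ne_zero [∀ t, NeZero (N t)] (hq : q.Positive) (hy : evidence m y ≠ ∞)
    (u : ExtSpace N C X) : densityRatio m q y u ≠ 0 := by
  refine ENNReal.div_ne_zero.2 ⟨ENNReal.coe_ne_zero.2 (Finset.prod_ne_zero_iff.2 fun t _ => ?_), hy⟩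
  exact mul_ne_zero (sum_weight_pos hq _ _ _).ne'
    (inv_ne_zero (Nat.cast_ne_zero.2 (NeZero.ne (N t))))

variable (m q y) in
/-- The density of the extended target, as an element of `measurableFunctions`. -/
def extendedFunction [SigmaFinite lam] : measurableFunctions (ExtSpace N C X) :=
  ⟨_, show Measurable fun u => extendedDensity m q y u from measurable_extendedDensity⟩

variable (m q y) in
/-- The density ratio, as an element of `measurableFunctions`. -/
def ratioFunction : measurableFunctions (ExtSpace N C X) :=
  ⟨_, show Measurable fun u => densityRatio m q y u from measurable_densityRatio⟩

theorem prod_targetFunction_apply (j : ∀ s, Fin (C s + 1)) (u : ExtSpace N C X) :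
    (∏ s, targetFunction m q y s (j s)).1 u =
      ((∏ s, targetDensity m q y u.1 u.2.1 (selected u s.succ) s (path u s (j s)) : ℝ≥0) :
        ℝ≥0∞) :=
  prod_finiteFunction_apply _ u

theorem proposalFunction_apply (u : ExtSpace N C X) :
    (proposalFunction m q y).1 u =
      ((filterDensity m q y u.1 u.2.1 *
        normalize (weight m q y u.1 u.2.1 (Fin.last n)) (u.2.2.1 (Fin.last n)) *
        ∏ s : Fin n, normalize (backwardWeight m q y u.1 u.2.1 (selected u s.succ) s)
          (u.2.2.1 s.castSucc) : ℝ≥0) : ℝ≥0∞) := by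
  rw [ENNReal.coe_mul, ENNReal.coe_mul, ← filterFunction_apply, ← finalProb_apply]
  exact congrArg (_ * ·) (prod_finiteFunction_apply (measurable_backwardProb m q y) u)

/-- The two densities differ, besides the ratio, by the targets at the two ends of each run, which
is precisely the factor created by reversing the runs. The targets are kept on both sides to avoid
divisions. -/
theorem proposalFunction_mul_ratioFunction [SigmaFinite lam] [∀ t, NeZero (N t)] (hq : q.Positive)
    (u : ExtSpace N C X) :
    (proposalFunction m q y).1 u * densityRatio m q y u *
        (∏ s, targetFunction m q y s (Fin.last (C s))).1 u =
      extendedDensity m q y u * (∏ s, targetFunction m q y s 0).1 u := by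
  have hS := selectedFilterDensity_pos (m := m) (y := y) hq u.1 u.2.1 u.2.2.1
  have key := selected_density_identity (m := m) (y := y) hq u.1 u.2.1 u.2.2.1 (selected u)
    (selected_last u)
  rw [proposalFunction_apply, prod_targetFunction_apply, prod_targetFunction_apply,
    extendedDensity, densityRatio, posteriorDensity, div_eq_mul_inv, div_eq_mul_inv]
  simp only [← selected_castSucc, path_zero]
  have hN : ∀ t, ((N t : ℝ≥0∞))⁻¹ = (((N t : ℝ≥0)⁻¹ : ℝ≥0) : ℝ≥0∞) := fun t => by
    rw [ENNReal.coe_inv (Nat.cast_ne_zero.2 (NeZero.ne (N t))), ENNReal.coe_natCast]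
  simp only [hN]
  rw [← ENNReal.ofNNReal_finsetProd, Finset.prod_mul_distrib,
    Fin.prod_univ_castSucc (fun t => ((N t : ℝ≥0))⁻¹)]
  -- The evidence enters both sides only through this common factor, so its value plays no role.
  generalize (evidence m y)⁻¹ = e
  generalize selectedFilterDensity m q y u.1 u.2.1 u.2.2.1 = S at *
  generalize filterDensity m q y u.1 u.2.1 = F at *
  have hF : F = F / S * S := (div_mul_cancel₀ F hS.ne').symm
  generalize F / S = D at *
  subst hF
  generalize (∏ s : Fin n, targetDensity m q y u.1 u.2.1 (selected u s.succ) s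
    (selected u s.castSucc)) = T' at *
  generalize (∏ s : Fin n, targetDensity m q y u.1 u.2.1 (selected u s.succ) s
    (u.1 s.castSucc (u.2.2.1 s.castSucc))) = T at *
  generalize (∏ s : Fin n, ((N s.castSucc : ℝ≥0))⁻¹) = ν at *
  generalize ((N (Fin.last n) : ℝ≥0))⁻¹ = ν' at *
  generalize normalize (weight m q y u.1 u.2.1 (Fin.last n)) (u.2.2.1 (Fin.last n)) = ω at *
  have key' := congrArg (fun r : ℝ≥0 => ((r * D * ν * ν' : ℝ≥0) : ℝ≥0∞) * e) key
  simp only [ENNReal.coe_mul] at key' ⊢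
  refine Eq.trans ?_ (key'.trans ?_) <;> ring

variable {K : TransitionKernels N X} [∀ s b, IsMarkovKernel (K s b)]

theorem prod_target_exchange [SigmaFinite lam] [Nonempty X] [∀ s, NeZero (C s)]
    (hy : evidence m y ≠ ∞) (hbal : DetailedBalance m q y K) (B : Op (ExtSpace N C X)) :
    B * ((List.finRange (n + 1)).map fun t => otherStatesOp (N := N) (C := C) lam t).prod *
        ((List.finRange n).map fun s => pathOp lam s 0).prod * selectedStateOp lam (Fin.last n) *
        ((List.finRange n).reverse.map fun s => forwardRunOp K s).prod *
        weigh (∏ s, targetFunction m q y s 0) =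
      B * ((List.finRange (n + 1)).map fun t => otherStatesOp (N := N) (C := C) lam t).prod *
        ((List.finRange n).map fun s => pathOp lam s (Fin.last (C s))).prod *
        selectedStateOp lam (Fin.last n) *
        ((List.finRange n).map fun s => reverseRunOp K s).prod *
        weigh (∏ s, targetFunction m q y s (Fin.last (C s))) := by
  rw [weigh_prod, weigh_prod]
  refine prod_exchange (fun s s' h => commute_pathOp h.ne) (fun s s' h => commute_pathOp h.ne)
    (fun s => commute_pathOp_selectedStateOp s _) (fun s => commute_pathOp_selectedStateOp s _)
    (fun s s' h => commute_reverseRunOp_forwardRunOp h)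
    (fun s s' h => commute_targetFunction_forwardRunOp h _)
    (fun s s' h => commute_targetFunction_forwardRunOp h _)
    (fun s s' h => commute_targetFunction_reverseRunOp h _)
    (fun s s' h => commute_targetFunction_reverseRunOp h _)
    (fun s s' => commute_weigh _ _) (fun s s' => commute_weigh _ _) fun l k r h => ?_
  obtain ⟨d, hd, hB⟩ := exists_weigh_eq (q := q) hy B h
  -- The indicator of finite mass can be inserted without changing the operator; it makes detailed
  -- balance applicable.
  rw [← hB, mul_assoc _ (weigh d), mul_assoc _ (weigh d), pathOp_forwardRunOp hbal hd]

/-- The normal form of the proposal, weighted by the density ratio, agrees with that of the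
extended target. -/
theorem prod_stepOp_mul_weigh [SigmaFinite lam] [Nonempty X] [∀ s, NeZero (C s)]
    [∀ t, NeZero (N t)] (hq : q.Positive) (hy : evidence m y ≠ ∞) (hbal : DetailedBalance m q y K) :
    ((filterSteps (N := N) (C := C) m q y ++ backwardSteps m q y K).map stepOp).prod *
        weigh (ratioFunction m q y) =
      ((reversedSteps (N := N) (C := C) lam K).map stepOp).prod * weigh (extendedFunction m q y) := by
  have hT : ∀ u : ExtSpace N C X, (∏ s, targetFunction m q y s (Fin.last (C s))).1 u ≠ 0 ∧
      (∏ s, targetFunction m q y s (Fin.last (C s))).1 u ≠ ∞ := fun u => by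
    rw [prod_targetFunction_apply]
    exact ⟨ENNReal.coe_ne_zero.2 (Finset.prod_ne_zero_iff.2 fun s _ =>
      (targetDensity_pos hq _ _ _ _ _).ne'), ENNReal.coe_ne_top⟩
  -- The factor common to both densities once the targets are split off: at the ends of the runs for
  -- the extended target, at their starts for the proposal times the ratio. Only the targets take
  -- part in the exchange.
  let Q : measurableFunctions (ExtSpace N C X) := ⟨fun u => extendedDensity m q y u *
    ((∏ s, targetFunction m q y s (Fin.last (C s))).1 u)⁻¹,
    show Measurable _ from measurable_extendedDensity.mul
      (show Measurable (∏ s, targetFunction (N := N) m q y s (Fin.last (C s))).1 from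
        (∏ s, targetFunction m q y s (Fin.last (C s))).2).inv⟩
  have h1 : extendedFunction m q y = (∏ s, targetFunction m q y s (Fin.last (C s))) * Q := by
    refine Subtype.ext (funext fun u => ?_)
    change extendedDensity m q y u = _ * (extendedDensity m q y u * _)
    rw [mul_left_comm, ENNReal.mul_inv_cancel (hT u).1 (hT u).2, mul_one]
  have h2 : proposalFunction m q y * ratioFunction m q y =
      (∏ s, targetFunction m q y s 0) * Q := by
    refine Subtype.ext (funext fun u => ?_)
    change (proposalFunction m q y).1 u * densityRatio m q y u =
      (∏ s, targetFunction m q y s 0).1 u * (extendedDensity m q y u * _)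
    rw [mul_left_comm, ← mul_assoc, ← proposalFunction_mul_ratioFunction hq, mul_assoc,
      ENNReal.mul_inv_cancel (hT u).1 (hT u).2, mul_one]
  rw [prod_stepOp_proposal, prod_stepOp_reversedSteps, mul_assoc _ (weigh (proposalFunction m q y)),
    ← map_mul, h1, h2, map_mul, map_mul, prod_statesOp, prod_selectedOp]
  simp only [← mul_assoc]
  rw [prod_target_exchange hy hbal]

/-- Equal operators give equal integrals of every measurable function, whatever the initial content
`u₀` of the memory. -/
theorem extendedTarget_eq_withDensity [SigmaFinite lam] [Nonempty X] [∀ s, NeZero (C s)]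
    [∀ t, NeZero (N t)] (hq : q.Positive) (hy : evidence m y ≠ ∞) (hbal : DetailedBalance m q y K)
    (u₀ : ExtSpace N C X) :
    extendedTarget m q y K u₀ = (proposalLaw m q y K u₀).withDensity (densityRatio m q y) := by
  refine Measure.ext_of_lintegral _ fun f hf => ?_
  have h := congrArg (fun O : Op (ExtSpace N C X) => O.eval ⟨f, hf⟩ u₀)
    (prod_stepOp_mul_weigh (m := m) (C := C) hq hy hbal)
  simp only [Op.eval_mul] at h
  rw [extendedTarget, proposalLaw, lintegral_withDensity_eq_lintegral_mul _
    measurable_extendedDensity hf, lintegral_withDensity_eq_lintegral_mul _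
    measurable_densityRatio hf]
  exact (lintegral_run_dirac measurable_reversedSteps (extendedFunction m q y * ⟨f, hf⟩) u₀).trans
    (h.symm.trans (lintegral_run_dirac measurable_proposalSteps
      (ratioFunction m q y * ⟨f, hf⟩) u₀).symm)

end Identity

/-! ### Operators which preserve the constant function -/

section FixOne

variable {U α : Type*} [MeasurableSpace U] [MeasurableSpace α]

/-- The operators which map the constant function `1` to itself. -/
def fixOne (U : Type*) [MeasurableSpace U] : Submonoid (Op U) where
  carrier := {O | O.apply 1 = 1}
  mul_mem' {O _} hO hO' := (congrArg O.apply hO').trans hO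
  one_mem' := rfl

theorem mem_fixOne {O : Op U} : O ∈ fixOne U ↔ ∀ u, O.eval 1 u = 1 :=
  ⟨fun h u => congrArg (fun F : measurableFunctions U => F.1 u) h,
    fun h => Subtype.ext (funext h)⟩

theorem list_prod_mem_fixOne {ι : Type*} {f : ι → Op U} {l : List ι} (h : ∀ i ∈ l, f i ∈ fixOne U) :
    (l.map f).prod ∈ fixOne U :=
  Submonoid.list_prod_mem _ (by simpa using h)

theorem assignOp_mem_fixOne {κ : Kernel U α} [IsMarkovKernel κ] {set : U → α → U}
    {hset : Measurable (Function.uncurry set)} : assignOp κ set hset ∈ fixOne U :=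
  mem_fixOne.2 fun u => by
    rw [eval_assignOp]
    change ∫⁻ _, 1 ∂κ u = 1
    rw [lintegral_one, measure_univ]

theorem assignOp_mul_weigh_mem_fixOne {κ : Kernel U α} [IsSFiniteKernel κ] {set : U → α → U}
    {hset : Measurable (Function.uncurry set)} {d : measurableFunctions U}
    (h : ∀ u, ∫⁻ z, d.1 (set u z) ∂κ u = 1) : assignOp κ set hset * weigh d ∈ fixOne U :=
  mem_fixOne.2 fun u => by
    rw [Op.eval_mul, eval_assignOp]
    refine Eq.trans (lintegral_congr fun z => ?_) (h u)
    exact mul_one _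

open Classical in
/-- The function `d`, except where `p` holds. -/
def otherFunction (p : U → Prop) (hp : MeasurableSet {u | p u}) (d : measurableFunctions U) :
    measurableFunctions U :=
  ⟨fun u => if p u then 1 else d.1 u, Measurable.ite hp measurable_const d.2⟩

theorem otherFunction_of_pos {p : U → Prop} {hp : MeasurableSet {u | p u}}
    {d : measurableFunctions U} {u : U} (h : p u) : (otherFunction p hp d).1 u = 1 := if_pos h

theorem otherFunction_of_neg {p : U → Prop} {hp : MeasurableSet {u | p u}}
    {d : measurableFunctions U} {u : U} (h : ¬ p u) : (otherFunction p hp d).1 u = d.1 u := if_neg h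

theorem otherFunction_congr {p : U → Prop} {hp : MeasurableSet {u | p u}}
    {d : measurableFunctions U} {u v : U} (h : p v ↔ p u) (hd : ¬ p u → d.1 v = d.1 u) :
    (otherFunction p hp d).1 v = (otherFunction p hp d).1 u := by
  by_cases hu : p u
  · rw [otherFunction_of_pos hu, otherFunction_of_pos (h.2 hu)]
  · rw [otherFunction_of_neg hu, otherFunction_of_neg (fun hv => hu (h.1 hv)), hd hu]

theorem skipOp_mul_weigh_mem_fixOne [Nonempty α] {p : U → Prop} {hp : MeasurableSet {u | p u}}
    {μ : Measure α} [SFinite μ] {set : U → α → U} {hset : Measurable (Function.uncurry set)}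
    {d : measurableFunctions U} (hps : ∀ u z, p (set u z) ↔ p u)
    (h : ∀ u, ¬ p u → ∫⁻ z, d.1 (set u z) ∂μ = 1) :
    skipOp p hp μ set hset * weigh (otherFunction p hp d) ∈ fixOne U :=
  mem_fixOne.2 fun u => by
    rw [Op.eval_mul]
    by_cases hu : p u
    · rw [eval_skipOp_of_pos hu]
      exact (mul_one _).trans (otherFunction_of_pos hu)
    · rw [eval_skipOp_of_neg hu]
      refine Eq.trans (lintegral_congr fun z => ?_) (h u hu)
      exact (mul_one _).trans (otherFunction_of_neg fun h' => hu ((hps u z).1 h'))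

theorem prod_otherFunction {k : ℕ} {b : U → Fin k} (hb : ∀ i, MeasurableSet {u | i = b u})
    (d : Fin k → measurableFunctions U) (u : U) :
    (d (b u)).1 u * (∏ i, otherFunction (fun u => i = b u) (hb i) (d i)).1 u =
      (∏ i, d i).1 u := by
  rw [Submonoid.coe_finsetProd, Submonoid.coe_finsetProd, Finset.prod_apply, Finset.prod_apply,
    ← Finset.mul_prod_erase _ _ (Finset.mem_univ (b u)),
    ← Finset.mul_prod_erase _ (fun i => (d i).1 u) (Finset.mem_univ (b u)),
    otherFunction_of_pos (p := fun v => b u = b v) rfl, one_mul]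
  congr 1
  exact Finset.prod_congr rfl fun i hi => otherFunction_of_neg (Finset.ne_of_mem_erase hi)

end FixOne

/-! ### The conditional law of the particle system, given the selected trajectory -/

section Conditional

variable {n : ℕ} {N : Fin (n + 1) → ℕ} {C : Fin n → ℕ} {X Y : Type*} [MeasurableSpace X]
  [MeasurableSpace Y] {lam : Measure X} {nu : Measure Y}
  (m : StateSpaceModel n X Y lam nu) (q : ImportanceDensities n X Y lam) (y : Fin (n + 1) → Y)

/-- The density of the particles of time `t` and of their parents, without the selected one. -/
def conditionalFunction (t : Fin (n + 1)) : measurableFunctions (ExtSpace N C X) :=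
  Fin.cases (motive := fun _ => measurableFunctions (ExtSpace N C X))
    (∏ i, otherFunction _ (measurableSet_index_eq 0 i) (initialDensity q y i))
    (fun s => (∏ i, otherFunction _ (measurableSet_index_eq s.succ i) (parentProb m q y s i)) *
      ∏ i, otherFunction _ (measurableSet_index_eq s.succ i) (proposalDensity q y s i)) t

/-- The backward probability of the parent of the selected particle of time `s.succ`. -/
def selectedParentProb (s : Fin n) : measurableFunctions (ExtSpace N C X) :=
  finiteFunction _ (measurable_selectedParentProb (m := m) (q := q) (y := y) s)

theorem selectedParentProb_apply (s : Fin n) (u : ExtSpace N C X) :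
    (selectedParentProb m q y s).1 u =
      normalize (backwardWeight m q y u.1 u.2.1 (u.1 s.succ (u.2.2.1 s.succ)) s)
        (u.2.1 s (u.2.2.1 s.succ)) := rfl

/-- The backward probability of the parent of the selected particle of time `t`, if `t ≠ 0`. -/
def selectedFunction (t : Fin (n + 1)) : measurableFunctions (ExtSpace N C X) :=
  Fin.cases (motive := fun _ => measurableFunctions (ExtSpace N C X)) 1
    (fun s => selectedParentProb m q y s) t

variable {m q y}

/-- This density reads neither the selected particle of time `t` nor its parent, so it is unaffected
by the reversed run and by the choice of the parent at that time. -/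
theorem conditionalFunction_congr {t : Fin (n + 1)} {u v : ExtSpace N C X}
    (hb : v.2.2.1 t = u.2.2.1 t) (hx : ∀ i, i ≠ u.2.2.1 t → v.1 t i = u.1 t i)
    (ha : ∀ (s : Fin n) i, s.succ = t → (⟨s.succ, i⟩ : Σ t, Fin (N t)) ≠ ⟨t, u.2.2.1 t⟩ →
      v.2.1 s i = u.2.1 s i)
    (hx' : ∀ t' < t, v.1 t' = u.1 t') (ha' : ∀ s : Fin n, s.succ < t → v.2.1 s = u.2.1 s) :
    (conditionalFunction m q y t).1 v = (conditionalFunction m q y t).1 u := by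
  have hb' : ∀ i, i = v.2.2.1 t ↔ i = u.2.2.1 t := fun i => by rw [hb]
  cases t using Fin.cases with
  | zero =>
    simp only [conditionalFunction, Fin.cases_zero, Submonoid.coe_finsetProd, Finset.prod_apply]
    refine Finset.prod_congr rfl fun i _ => otherFunction_congr (hb' i) fun hi => ?_
    rw [initialDensity_apply, initialDensity_apply, hx i hi]
  | succ s =>
    simp only [conditionalFunction, Fin.cases_succ, Submonoid.coe_finsetProd, Finset.prod_apply,
      Submonoid.coe_mul, Pi.mul_apply]
    have hs := hx' _ s.castSucc_lt_succ
    have hw : weight m q y v.1 v.2.1 s.castSucc = weight m q y u.1 u.2.1 s.castSucc :=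
      weight_congr m q y hs fun r hr =>
        ⟨hx' _ ((r.castSucc_lt_succ.trans_eq hr.symm).trans s.castSucc_lt_succ),
          ha' _ (hr.symm.trans_lt s.castSucc_lt_succ)⟩
    have hai : ∀ i, i ≠ u.2.2.1 s.succ → v.2.1 s i = u.2.1 s i := fun i hi =>
      ha s i rfl (index_ne hi)
    congr 1
    · refine Finset.prod_congr rfl fun i _ => otherFunction_congr (hb' i) fun hi => ?_
      rw [parentProb_apply, parentProb_apply, hw, hai i hi]
    · refine Finset.prod_congr rfl fun i _ => otherFunction_congr (hb' i) fun hi => ?_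
      rw [proposalDensity_apply, proposalDensity_apply, hs, hai i hi, hx i hi]

/-- In contrast to `conditionalFunction`, this factor reads the selected particle of time `t`, so
the parent has to be drawn after the reversed run has produced that particle. -/
theorem selectedFunction_congr {t : Fin (n + 1)} {u v : ExtSpace N C X}
    (hb : v.2.2.1 t = u.2.2.1 t) (hx : v.1 t (u.2.2.1 t) = u.1 t (u.2.2.1 t))
    (hx' : ∀ t' < t, v.1 t' = u.1 t') (ha : ∀ s : Fin n, s.succ ≤ t → v.2.1 s = u.2.1 s) :
    (selectedFunction m q y t).1 v = (selectedFunction m q y t).1 u := by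
  cases t using Fin.cases with
  | zero => rfl
  | succ s =>
    have hs := hx' _ s.castSucc_lt_succ
    have hw : weight m q y v.1 v.2.1 s.castSucc = weight m q y u.1 u.2.1 s.castSucc :=
      weight_congr m q y hs fun r hr =>
        ⟨hx' _ ((r.castSucc_lt_succ.trans_eq hr.symm).trans s.castSucc_lt_succ),
          ha _ (hr.symm.trans_lt s.castSucc_lt_succ).le⟩
    have hbw : ∀ z, backwardWeight m q y v.1 v.2.1 z s = backwardWeight m q y u.1 u.2.1 z s :=
      fun z => funext fun i => by rw [backwardWeight, backwardWeight, hw, hs]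
    simp only [selectedFunction, Fin.cases_succ, selectedParentProb_apply]
    rw [hbw, hb, hx, ha s le_rfl]

variable {K : TransitionKernels N X} [∀ s b, IsMarkovKernel (K s b)]

/-- Sums over the parents of all particles of time `t`, if `t ≠ 0`. -/
def parentsAt (t : Fin (n + 1)) : Op (ExtSpace N C X) :=
  Fin.cases (motive := fun _ => Op (ExtSpace N C X)) 1 (fun s => parentsOp s) t

/-- Sums over the parents of all particles of time `t` but the selected one, if `t ≠ 0`. -/
def otherParentsAt [∀ t, NeZero (N t)] (t : Fin (n + 1)) : Op (ExtSpace N C X) :=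
  Fin.cases (motive := fun _ => Op (ExtSpace N C X)) 1 (fun s => otherParentsOp s) t

/-- Sums over the parent of the selected particle of time `t`, if `t ≠ 0`. -/
def selectedParentAt (t : Fin (n + 1)) : Op (ExtSpace N C X) :=
  Fin.cases (motive := fun _ => Op (ExtSpace N C X)) 1 (fun s => selectedParentOp s) t

variable (K) in
/-- The reversed run of the Markov chain at time `t`, if `t` is not the final time. -/
def reverseRunAt (t : Fin (n + 1)) : Op (ExtSpace N C X) :=
  Fin.lastCases (motive := fun _ => Op (ExtSpace N C X)) 1 (fun s => reverseRunOp K s) t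

theorem parentsAt_eq [∀ t, NeZero (N t)] (t : Fin (n + 1)) :
    parentsAt (N := N) (C := C) (X := X) t = otherParentsAt t * selectedParentAt t := by
  cases t using Fin.cases with
  | zero => rfl
  | succ s =>
    exact prod_assignOp_eq_prod_skipOp_mul (measurable_setParent s)
      (measurableSet_index_eq s.succ) (measurable_setSelectedParent s) (fun _ => rfl)
      (fun _ _ _ => rfl) fun i j hij u z w => setParent_comm (fun e => hij (by simpa using e)) u z w

theorem prod_parentsAt :
    ((List.finRange (n + 1)).map fun t => parentsAt (N := N) (C := C) (X := X) t).prod =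
      ((List.finRange n).map fun s => parentsOp s).prod := by
  rw [List.finRange_succ, List.map_cons, List.prod_cons, List.map_map]
  exact one_mul _

theorem prod_reverseRunAt :
    ((List.finRange (n + 1)).map fun t => reverseRunAt (N := N) (C := C) K t).prod =
      ((List.finRange n).map fun s => reverseRunOp K s).prod := by
  rw [List.finRange_succ_last, List.map_append, List.prod_append, List.map_map, List.map_singleton,
    List.prod_singleton]
  simp only [Function.comp_def, reverseRunAt, Fin.lastCases_castSucc, Fin.lastCases_last, mul_one]

/-! Commutation -/

theorem commute_parentsAt {O : Op (ExtSpace N C X)} {t : Fin (n + 1)}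
    (h : ∀ (s : Fin n) i, s.succ = t → Commute O (parentOp s i)) : Commute O (parentsAt t) := by
  cases t using Fin.cases with
  | zero => exact Commute.one_right _
  | succ s => exact commute_list_prod fun i _ => h s i rfl

theorem commute_selectedParentAt {O : Op (ExtSpace N C X)} {t : Fin (n + 1)}
    (h : ∀ s : Fin n, s.succ = t → Commute O (selectedParentOp s)) :
    Commute O (selectedParentAt t) := by
  cases t using Fin.cases with
  | zero => exact Commute.one_right _
  | succ s => exact h s rfl

theorem commute_reverseRunAt {O : Op (ExtSpace N C X)} {t : Fin (n + 1)}
    (h : ∀ (s : Fin n) j, s.castSucc = t → Commute O (reverseOp K s j)) :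
    Commute O (reverseRunAt K t) := by
  cases t using Fin.lastCases with
  | last => rw [reverseRunAt, Fin.lastCases_last]; exact Commute.one_right _
  | cast s =>
    rw [reverseRunAt, Fin.lastCases_castSucc]
    exact commute_list_prod fun j _ => h s j rfl

theorem commute_conditionalFunction_parentsAt {t t' : Fin (n + 1)} (h : t < t') :
    Commute (weigh (conditionalFunction (N := N) (C := C) m q y t)) (parentsAt t') :=
  commute_parentsAt fun s i hs => commute_weigh_assignOp fun u k =>
    conditionalFunction_congr rfl (fun _ _ => rfl)
      (fun r j hr _ => congrFun (setParent_time (by rintro rfl; exact h.ne (hr.symm.trans hs)) i u k)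
        j)
      (fun _ _ => rfl)
      fun r hr => setParent_time (by rintro rfl; exact (hr.trans h).ne hs) i u k

theorem commute_selectedFunction_parentsAt {t t' : Fin (n + 1)} (h : t < t') :
    Commute (weigh (selectedFunction (N := N) (C := C) m q y t)) (parentsAt t') :=
  commute_parentsAt fun s i hs => commute_weigh_assignOp fun u k =>
    selectedFunction_congr rfl rfl (fun _ _ => rfl)
      fun r hr => setParent_time (by rintro rfl; exact (hr.trans_lt h).ne hs) i u k

theorem commute_conditionalFunction_otherStatesOp [SFinite lam] [Nonempty X] {t t' : Fin (n + 1)}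
    (h : t < t') :
    Commute (weigh (conditionalFunction (N := N) (C := C) m q y t)) (otherStatesOp lam t') :=
  commute_list_prod fun i _ => commute_weigh_skipOp fun u z _ =>
    conditionalFunction_congr rfl (fun j _ => congrFun (setState_time h.ne i u z) j)
      (fun _ _ _ _ => rfl) (fun _ hr => setState_time (hr.trans h).ne i u z) fun _ _ => rfl

theorem commute_selectedFunction_otherStatesOp [SFinite lam] [Nonempty X] {t t' : Fin (n + 1)}
    (h : t < t') :
    Commute (weigh (selectedFunction (N := N) (C := C) m q y t)) (otherStatesOp lam t') :=
  commute_list_prod fun i _ => commute_weigh_skipOp fun u z _ =>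
    selectedFunction_congr rfl (congrFun (setState_time h.ne i u z) _)
      (fun _ hr => setState_time (hr.trans h).ne i u z) fun _ _ => rfl

theorem commute_conditionalFunction_reverseRunAt {t t' : Fin (n + 1)} (h : t ≤ t') :
    Commute (weigh (conditionalFunction (N := N) (C := C) m q y t)) (reverseRunAt K t') :=
  commute_reverseRunAt fun s j hs => commute_weigh_assignOp fun u z =>
    conditionalFunction_congr (by rw [setPath_indices])
      (fun i hi => setPath_states_of_ne (index_ne hi) _ _)
      (fun r i _ _ => by rw [setPath_parents])
      (fun r hr => setPath_states_time ((hr.trans_le h).trans_eq hs.symm).ne _ _ _)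
      fun r _ => by rw [setPath_parents]

theorem commute_selectedFunction_reverseRunAt {t t' : Fin (n + 1)} (h : t < t') :
    Commute (weigh (selectedFunction (N := N) (C := C) m q y t)) (reverseRunAt K t') :=
  commute_reverseRunAt fun s j hs => commute_weigh_assignOp fun u z =>
    selectedFunction_congr (by rw [setPath_indices])
      (congrFun (setPath_states_time (h.trans_eq hs.symm).ne _ _ _) _)
      (fun r hr => setPath_states_time ((hr.trans h).trans_eq hs.symm).ne _ _ _)
      fun r _ => by rw [setPath_parents]

theorem commute_conditionalFunction_selectedParentAt (t : Fin (n + 1)) :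
    Commute (weigh (conditionalFunction (N := N) (C := C) m q y t)) (selectedParentAt t) :=
  commute_selectedParentAt fun s hs => commute_weigh_assignOp fun u k =>
    conditionalFunction_congr rfl (fun _ _ => rfl)
      (fun r j hr hj => by
        subst hs
        obtain rfl := Fin.succ_injective n hr
        exact setParent_of_ne (fun e => hj (by simpa using e)) u k)
      (fun _ _ => rfl)
      fun r hr => setParent_time (by rintro rfl; exact hr.ne hs) _ u k

theorem commute_otherStatesOp_parentsAt [SFinite lam] [Nonempty X] (t t' : Fin (n + 1)) :
    Commute (otherStatesOp (N := N) (C := C) lam t) (parentsAt t') :=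
  commute_parentsAt fun _ _ _ => list_prod_commute fun _ _ => commute_skipOp_assignOp
    (fun _ _ _ _ => rfl) (fun _ _ => Iff.rfl) fun _ _ _ => rfl

theorem commute_otherStatesOp_selectedParentAt [SFinite lam] [Nonempty X] (t t' : Fin (n + 1)) :
    Commute (otherStatesOp (N := N) (C := C) lam t) (selectedParentAt t') :=
  commute_selectedParentAt fun _ _ => list_prod_commute fun _ _ => commute_skipOp_assignOp
    (fun _ _ _ _ => rfl) (fun _ _ => Iff.rfl) fun _ _ _ => rfl

theorem path_setParent (r : Fin n) (i : Fin (N r.succ)) (u : ExtSpace N C X)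
    (k : Fin (N r.castSucc)) : path (setParent r i u k) = path u := rfl

theorem commute_parentsAt_reverseRunAt {t t' : Fin (n + 1)} (h : t' < t) :
    Commute (parentsAt t) (reverseRunAt (N := N) (C := C) K t') :=
  commute_reverseRunAt fun s j hs => (commute_parentsAt fun r i hr =>
    commute_assignOp (fun u z k => (setPath_setParent_comm u k z).symm) (fun u k => by
      rw [transitionKernel_apply, transitionKernel_apply, path_setParent]
      refine transition_congr _ rfl rfl (fun _ _ _ _ => rfl) fun r' i' hr' _ => ?_
      refine congrFun (setParent_time ?_ _ _ _) _
      rintro rfl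
      exact ((hr'.trans_eq hs).trans_lt h).ne hr) fun _ _ => rfl).symm

/-- The point where it matters that the kernels may not depend on the parent of the selected
particle. -/
theorem commute_selectedParentAt_reverseRunAt (t : Fin (n + 1)) :
    Commute (selectedParentAt t) (reverseRunAt (N := N) (C := C) K t) :=
  commute_reverseRunAt fun s j hs => (commute_selectedParentAt (t := t) (O := reverseOp K s j)
    fun r hr => commute_assignOp (fun u z k => by
      unfold setSelectedParent
      rw [setPath_indices]
      exact (setPath_setParent_comm u k z).symm) (fun u k => by
      rw [transitionKernel_apply, transitionKernel_apply, setSelectedParent, path_setParent]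
      refine transition_congr _ rfl rfl (fun _ _ _ _ => rfl) fun r' i' _ hi' => ?_
      refine setParent_of_ne ?_ _ _
      intro e
      rw [Sigma.mk.injEq] at e
      obtain ⟨rfl, e⟩ := e
      rw [eq_of_heq e] at hi'
      refine hi' ?_
      rw [hs, ← hr]
      rfl) fun _ _ => rfl).symm

variable [∀ s, NeZero (C s)]

theorem path_setState_of_ne {t : Fin (n + 1)} {s : Fin n} (h : t ≠ s.castSucc) (i : Fin (N t))
    (u : ExtSpace N C X) (z : X) : path (setState t i u z) s = path u s := by
  unfold path
  rw [setState_time h.symm]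
  rfl

theorem commute_otherStatesOp_reverseRunAt [SFinite lam] [Nonempty X] {t t' : Fin (n + 1)}
    (h : t' < t) :
    Commute (otherStatesOp (N := N) (C := C) lam t) (reverseRunAt (N := N) (C := C) K t') :=
  commute_reverseRunAt fun s j hs => list_prod_commute fun i _ => commute_skipOp_assignOp
    (fun u z w hu => setPath_setState_comm (index_ne hu) z w)
    (fun u w => by rw [setPath_indices]) fun u z hu => by
      have ht : t ≠ s.castSucc := (hs.trans_lt h).ne'
      rw [transitionKernel_apply, transitionKernel_apply, path_setState_of_ne ht]
      refine transition_congr _ rfl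
        (congrFun (selected_setState_of_ne (fun _ => hu) z) _) (fun r k hr _ => ?_)
        fun _ _ _ _ => rfl
      exact congrFun (setState_time ((hr.trans_eq hs).trans_lt h).ne _ _ _) _

end Conditional

/-! ### Normalisation of the conditional law, time by time -/

section Mass

variable {n : ℕ} {N : Fin (n + 1) → ℕ} {C : Fin n → ℕ} {X Y : Type*} [MeasurableSpace X]
  [MeasurableSpace Y] {lam : Measure X} {nu : Measure Y}
  {m : StateSpaceModel n X Y lam nu} {q : ImportanceDensities n X Y lam} {y : Fin (n + 1) → Y}
  {K : TransitionKernels N X} [∀ s b, IsMarkovKernel (K s b)]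

theorem lintegral_normalize {k : ℕ} {v : Fin k → ℝ≥0} (h : ∑ i, v i ≠ 0) :
    ∫⁻ i, (normalize v i : ℝ≥0∞) ∂Measure.count = 1 := by
  have := isProbabilityMeasure_categorical_normalize h
  rw [← setLIntegral_univ, ← withDensity_apply _ .univ, ← categorical_eq_withDensity, measure_univ]

theorem reverseRunAt_mem_fixOne (t : Fin (n + 1)) :
    reverseRunAt (C := C) K t ∈ fixOne (ExtSpace N C X) := by
  cases t using Fin.lastCases with
  | last => rw [reverseRunAt, Fin.lastCases_last]; exact one_mem _
  | cast s =>
    rw [reverseRunAt, Fin.lastCases_castSucc]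
    exact list_prod_mem_fixOne fun j _ => assignOp_mem_fixOne

theorem selectedParentAt_mul_mem_fixOne [∀ t, NeZero (N t)] (hq : q.Positive) (t : Fin (n + 1)) :
    selectedParentAt t * weigh (selectedFunction m q y t) ∈ fixOne (ExtSpace N C X) := by
  cases t using Fin.cases with
  | zero =>
    change (1 : Op (ExtSpace N C X)) * weigh 1 ∈ _
    rw [map_one]
    exact one_mem _
  | succ s =>
    change selectedParentOp s * weigh (selectedParentProb m q y s) ∈ _
    refine assignOp_mul_weigh_mem_fixOne (κ := Kernel.const _ Measure.count)
      (hset := measurable_setSelectedParent s) fun u => ?_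
    refine Eq.trans (lintegral_congr fun k => ?_) (lintegral_normalize
      (sum_backwardWeight_pos (m := m) (y := y) hq u.1 u.2.1 (u.1 s.succ (u.2.2.1 s.succ)) s).ne')
    change (selectedParentProb m q y s).1 (setParent s (u.2.2.1 s.succ) u k) = _
    rw [selectedParentProb_apply]
    have hw : ∀ z, backwardWeight m q y (setParent s (u.2.2.1 s.succ) u k).1
        (setParent s (u.2.2.1 s.succ) u k).2.1 z s = backwardWeight m q y u.1 u.2.1 z s :=
      fun z => funext fun i => by
        rw [backwardWeight, backwardWeight, weight_setParent m q y s.castSucc_lt_succ]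
        rfl
    rw [hw]
    exact congrArg (fun j => ((normalize _ j : ℝ≥0) : ℝ≥0∞)) (setParent_self s _ u k)

theorem otherParentsOp_mul_mem_fixOne [∀ t, NeZero (N t)] (hq : q.Positive) (s : Fin n) :
    otherParentsOp s *
        weigh (∏ i, otherFunction _ (measurableSet_index_eq s.succ i) (parentProb m q y s i)) ∈
      fixOne (ExtSpace N C X) := by
  rw [weigh_prod, otherParentsOp, ← list_prod_map_mul]
  · refine list_prod_mem_fixOne fun i _ => skipOp_mul_weigh_mem_fixOne (fun _ _ => Iff.rfl)
      fun u _ => ?_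
    refine Eq.trans (lintegral_congr fun k => ?_) (lintegral_normalize
      (sum_weight_pos (m := m) (y := y) hq u.1 u.2.1 s.castSucc).ne')
    rw [parentProb_apply, setParent_self, weight_setParent m q y s.castSucc_lt_succ]
  · refine pairwise_finRange fun i j hij => commute_weigh_skipOp fun u k _ =>
      otherFunction_congr Iff.rfl fun _ => ?_
    rw [parentProb_apply, parentProb_apply, weight_setParent m q y s.castSucc_lt_succ,
      setParent_of_ne fun e => hij.ne (by simpa using e)]

theorem otherStatesOp_mul_mem_fixOne [SFinite lam] [Nonempty X] {t : Fin (n + 1)}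
    {d : Fin (N t) → measurableFunctions (ExtSpace N C X)}
    (h₁ : ∀ i u, ∫⁻ z, (d i).1 (setState t i u z) ∂lam = 1)
    (h₂ : ∀ i j u z, i ≠ j → (d i).1 (setState t j u z) = (d i).1 u) :
    otherStatesOp lam t * weigh (∏ i, otherFunction _ (measurableSet_index_eq t i) (d i)) ∈
      fixOne (ExtSpace N C X) := by
  rw [weigh_prod, otherStatesOp, ← list_prod_map_mul]
  · exact list_prod_mem_fixOne fun i _ => skipOp_mul_weigh_mem_fixOne (fun _ _ => Iff.rfl)
      fun u _ => h₁ i u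
  · exact pairwise_finRange fun i j hij => commute_weigh_skipOp fun u k _ =>
      otherFunction_congr Iff.rfl fun _ => h₂ i j u k hij.ne

/-- One time step of a conditional particle filter: the non-selected parents are drawn with the
normalised weights, then the non-selected particles from the importance densities, and each of these
draws has mass one. -/
theorem otherParentsAt_mul_mem_fixOne [SFinite lam] [Nonempty X] [∀ t, NeZero (N t)]
    (hq : q.Positive) (t : Fin (n + 1)) :
    otherParentsAt t * otherStatesOp lam t * weigh (conditionalFunction m q y t) ∈
      fixOne (ExtSpace N C X) := by
  cases t using Fin.cases with
  | zero =>
    change 1 * otherStatesOp lam 0 * weigh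
      (∏ i, otherFunction _ (measurableSet_index_eq 0 i) (initialDensity q y i)) ∈ _
    rw [one_mul]
    refine otherStatesOp_mul_mem_fixOne (d := fun i => initialDensity q y i) (fun i u => ?_)
      fun i j u z hij => ?_
    · simp only [initialDensity_apply, setState_self]
      exact q.lintegral_M₁ _
    · rw [initialDensity_apply, initialDensity_apply,
        setState_of_ne fun e => hij (by simpa using e)]
  | succ s =>
    have hc : Commute (otherStatesOp (N := N) (C := C) lam s.succ)
        (weigh (∏ i, otherFunction _ (measurableSet_index_eq s.succ i) (parentProb m q y s i))) := by
      refine (commute_weigh_prod fun i => commute_list_prod fun j _ => ?_).symm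
      refine commute_weigh_skipOp fun u z _ => otherFunction_congr Iff.rfl fun _ => ?_
      rw [parentProb_apply, parentProb_apply, weight_setState m q y s.castSucc_lt_succ]
      rfl
    change otherParentsOp s * otherStatesOp lam s.succ * weigh
      ((∏ i, otherFunction _ (measurableSet_index_eq s.succ i) (parentProb m q y s i)) *
        ∏ i, otherFunction _ (measurableSet_index_eq s.succ i) (proposalDensity q y s i)) ∈ _
    rw [map_mul, mul_assoc, ← mul_assoc (otherStatesOp lam s.succ), hc.eq, mul_assoc, ← mul_assoc]
    refine mul_mem (otherParentsOp_mul_mem_fixOne hq s) (otherStatesOp_mul_mem_fixOne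
      (d := fun i => proposalDensity q y s i) (fun i u => ?_) fun i j u z hij => ?_)
    · refine Eq.trans (lintegral_congr fun z => ?_) (q.lintegral_M s (y s.succ)
        (u.1 s.castSucc (u.2.1 s i)))
      rw [proposalDensity_apply, setState_self, setState_time s.castSucc_lt_succ.ne]
      rfl
    · have h1 : (setState s.succ j u z).1 s.succ i = u.1 s.succ i :=
        setState_of_ne (fun e => hij (by simpa using e)) u z
      rw [proposalDensity_apply, proposalDensity_apply, h1, setState_time s.castSucc_lt_succ.ne]
      rfl

/-- Given the selected trajectory, the conditional law of the other variables has mass one. -/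
theorem conditional_mem_fixOne [SFinite lam] [Nonempty X] [∀ s, NeZero (C s)] [∀ t, NeZero (N t)]
    (hq : q.Positive) :
    ((List.finRange n).map fun s => parentsOp s).prod *
        ((List.finRange (n + 1)).map fun t => otherStatesOp lam t).prod *
        ((List.finRange n).map fun s => reverseRunOp K s).prod *
        weigh (∏ t, conditionalFunction m q y t * selectedFunction m q y t) ∈
      fixOne (ExtSpace N C X) := by
  rw [← prod_parentsAt, ← prod_reverseRunAt, weigh_prod, mul_assoc _ (List.prod _) (List.prod _),
    ← list_prod_map_mul, ← list_prod_map_mul, ← list_prod_map_mul]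
  · refine list_prod_mem_fixOne fun t _ => ?_
    -- The operators of one time are put in an order of sampling in which every density is
    -- normalised when it is integrated: other parents and other particles, then the reversed run,
    -- and last the parent of the selected particle, whose probability depends on where the run has
    -- ended.
    have e : parentsAt t * otherStatesOp lam t * (reverseRunAt K t *
        weigh (conditionalFunction m q y t * selectedFunction m q y t)) =
        otherParentsAt (N := N) (C := C) t * otherStatesOp lam t *
          weigh (conditionalFunction m q y t) * reverseRunAt K t *
          (selectedParentAt t * weigh (selectedFunction m q y t)) := by
      have h1 := commute_otherStatesOp_selectedParentAt (N := N) (C := C) (lam := lam) t t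
      have h2 := commute_selectedParentAt_reverseRunAt (C := C) (K := K) t
      have h3 := commute_conditionalFunction_selectedParentAt (N := N) (C := C) (m := m) (q := q)
        (y := y) t
      have h4 := commute_conditionalFunction_reverseRunAt (C := C) (m := m) (q := q)
        (y := y) (K := K) (le_refl t)
      rw [parentsAt_eq, map_mul]
      generalize weigh (selectedFunction m q y t) = V'
      generalize weigh (conditionalFunction m q y t) = V at *
      calc otherParentsAt t * selectedParentAt t * otherStatesOp lam t *
            (reverseRunAt K t * (V * V'))
          = otherParentsAt t * (selectedParentAt t * otherStatesOp lam t) *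
            (reverseRunAt K t * V) * V' := by simp only [mul_assoc]
        _ = otherParentsAt t * otherStatesOp lam t * (selectedParentAt t * V) *
            reverseRunAt K t * V' := by rw [← h1.eq, ← h4.eq]; simp only [mul_assoc]
        _ = otherParentsAt t * otherStatesOp lam t * V * (selectedParentAt t *
            reverseRunAt K t) * V' := by rw [← h3.eq]; simp only [mul_assoc]
        _ = _ := by rw [h2.eq]; simp only [mul_assoc]
    rw [e]
    exact mul_mem (mul_mem (otherParentsAt_mul_mem_fixOne hq t) (reverseRunAt_mem_fixOne t))
      (selectedParentAt_mul_mem_fixOne hq t)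
  · exact pairwise_finRange fun t t' h => Commute.mul_left
      (Commute.mul_right (commute_parentsAt_reverseRunAt h).symm
        (commute_otherStatesOp_reverseRunAt h).symm)
      (commute_weigh_mul
        (Commute.mul_right (commute_conditionalFunction_parentsAt h)
          (commute_conditionalFunction_otherStatesOp h))
        (Commute.mul_right (commute_selectedFunction_parentsAt h)
          (commute_selectedFunction_otherStatesOp h)))
  · exact pairwise_finRange fun t t' h => commute_weigh_mul
      (commute_conditionalFunction_reverseRunAt h.le) (commute_selectedFunction_reverseRunAt h)
  · exact pairwise_finRange fun t t' _ => commute_otherStatesOp_parentsAt t t'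

end Mass

/-! ### The law of the selected trajectory -/

section SelectedLaw

variable {n : ℕ} {N : Fin (n + 1) → ℕ} {C : Fin n → ℕ} {X Y : Type*} [MeasurableSpace X]
  [MeasurableSpace Y] {lam : Measure X} {nu : Measure Y}
  {m : StateSpaceModel n X Y lam nu} {q : ImportanceDensities n X Y lam} {y : Fin (n + 1) → Y}
  {K : TransitionKernels N X} [∀ s b, IsMarkovKernel (K s b)]

/-- Integrating the states of the trajectory in turn produces marginal integrals over larger and
larger sets of times. When all times are covered, the initial trajectory is forgotten and the
product measure remains. -/
theorem eval_prod_selectedOp [SigmaFinite lam] [∀ s, NeZero (C s)]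
    {G : (Fin (n + 1) → X) × Indices N → ℝ≥0∞} (hG : Measurable G)
    {F : measurableFunctions (ExtSpace N C X)} (hF : ∀ u, F.1 u = G (selected u, u.2.2.1))
    (u : ExtSpace N C X) :
    ((List.finRange (n + 1)).map fun t => selectedOp (N := N) (C := C) lam t).prod.eval F u =
      ∫⁻ w, G (w, u.2.2.1) ∂(Measure.pi fun _ => lam) := by
  have key : ∀ (l : List (Fin (n + 1))), l.Nodup → ∀ u : ExtSpace N C X,
      (l.map fun t => selectedOp lam t).prod.eval F u =
        lmarginal (fun _ => lam) l.toFinset (fun w => G (w, u.2.2.1)) (selected u) := by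
    intro l
    induction l with
    | nil =>
      intro _ u
      rw [List.map_nil, List.prod_nil, Op.eval_one, List.toFinset_nil, lmarginal_empty, hF]
    | cons t l ih =>
      intro hl u
      rw [List.nodup_cons] at hl
      rw [List.map_cons, List.prod_cons, Op.eval_mul, List.toFinset_cons, lmarginal_insert
        (fun w => G (w, u.2.2.1)) (hG.comp measurable_prodMk_right) (by simpa using hl.1)]
      refine lintegral_congr fun z => (ih hl.2 _).trans ?_
      rw [selected_setSelected, setSelected_indices]
  rw [key _ (List.nodup_finRange _), List.toFinset_finRange, lmarginal_univ]

theorem eval_prod_indexOp_const {l : List (Fin (n + 1))} {F : measurableFunctions (ExtSpace N C X)}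
    {c : ℝ≥0∞} (hF : ∀ u, F.1 u = c) (u : ExtSpace N C X) :
    (l.map fun t => indexOp (N := N) (C := C) (X := X) t).prod.eval F u =
      (l.map fun t => (N t : ℝ≥0∞)).prod * c := by
  induction l generalizing u with
  | nil => simp [hF]
  | cons t l ih =>
    rw [List.map_cons, List.prod_cons, Op.eval_mul, List.map_cons, List.prod_cons, mul_assoc]
    refine (lintegral_congr fun k => ih _).trans ?_
    rw [lintegral_const, Kernel.const_apply, Measure.count_univ, ENat.card_eq_coe_fintype_card,
      Fintype.card_fin, mul_comm]
    rfl

theorem eval_prod_indexOp {F : measurableFunctions (ExtSpace N C X)}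
    {g : Fin (N (Fin.last n)) → ℝ≥0∞} (hF : ∀ u, F.1 u = g (u.2.2.1 (Fin.last n)))
    (u : ExtSpace N C X) :
    ((List.finRange (n + 1)).map fun t => indexOp (N := N) (C := C) (X := X) t).prod.eval F u =
      (∏ s : Fin n, (N s.castSucc : ℝ≥0∞)) * ∑ k, g k := by
  have hl : ((List.finRange n).map fun s => (N s.castSucc : ℝ≥0∞)).prod =
      ∏ s : Fin n, (N s.castSucc : ℝ≥0∞) := by
    rw [← List.ofFn_eq_map, List.prod_ofFn]
  rw [List.finRange_succ_last, List.map_append, List.prod_append, Op.eval_mul,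
    eval_prod_indexOp_const (c := ∑ k, g k), List.map_map]
  · exact congrArg (· * _) hl
  · intro u
    rw [List.map_singleton, List.prod_singleton]
    change ∫⁻ k, F.1 (setIndex (Fin.last n) u k) ∂Measure.count = _
    simp only [hF, setIndex_self]
    rw [lintegral_count, tsum_fintype]

/-- Reversed transitions never write to the end of a run, and the other draws concern parents and
non-selected particles, so the selected trajectory and the indices stay fixed. -/
theorem commute_weigh_selected [SFinite lam] [Nonempty X] [∀ s, NeZero (C s)]
    {d : measurableFunctions (ExtSpace N C X)}
    (hd : ∀ u v, selected u = selected v → u.2.2.1 = v.2.2.1 → d.1 u = d.1 v) :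
    Commute (weigh d) (((List.finRange n).map fun s => parentsOp s).prod *
        ((List.finRange (n + 1)).map fun t => otherStatesOp lam t).prod *
        ((List.finRange n).map fun s => reverseRunOp K s).prod) := by
  refine Commute.mul_right (Commute.mul_right ?_ ?_) ?_
  · exact commute_list_prod fun s _ => commute_list_prod fun i _ => commute_weigh_assignOp
      fun u k => hd _ _ (selected_setParent _ _ _ _) rfl
  · exact commute_list_prod fun s _ => commute_list_prod fun i _ => commute_weigh_skipOp
      fun u z hu => hd _ _ (selected_setState_of_ne (fun _ => hu) z) rfl
  · exact commute_list_prod fun s _ => commute_list_prod fun j _ => commute_weigh_assignOp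
      fun u z => hd _ _ (funext fun t => selected_setPath_of_ne
        (fun _ => j.castSucc_lt_last.ne) u z) (by rw [setPath_indices])

theorem filterDensity_div_selectedFilterDensity [∀ t, NeZero (N t)] (hq : q.Positive)
    (u : ExtSpace N C X) :
    ((filterDensity m q y u.1 u.2.1 / selectedFilterDensity m q y u.1 u.2.1 u.2.2.1 : ℝ≥0) :
        ℝ≥0∞) = (∏ t, conditionalFunction m q y t).1 u := by
  have hS := (selectedFilterDensity_pos (m := m) (y := y) hq u.1 u.2.1 u.2.2.1).ne'
  rw [ENNReal.coe_div hS, eq_comm, ENNReal.eq_div_iff (ENNReal.coe_ne_zero.2 hS)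
    ENNReal.coe_ne_top, ← filterFunction_apply, filterFunction, selectedFilterDensity,
    Fin.prod_univ_succ, ENNReal.coe_mul, ENNReal.ofNNReal_finsetProd]
  simp only [conditionalFunction, Fin.cases_zero, Fin.cases_succ, Submonoid.coe_mul, Pi.mul_apply]
  rw [mul_mul_mul_comm]
  congr 1
  · exact prod_otherFunction (b := fun u => u.2.2.1 0) (measurableSet_index_eq 0)
      (initialDensity q y) u
  · rw [Submonoid.coe_finsetProd, Submonoid.coe_finsetProd, Finset.prod_apply, Finset.prod_apply,
      ← Finset.prod_mul_distrib]
    refine Finset.prod_congr rfl fun s _ => ?_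
    rw [ENNReal.coe_mul, Submonoid.coe_mul, Pi.mul_apply, mul_mul_mul_comm, Submonoid.coe_mul,
      Pi.mul_apply]
    congr 1
    · exact prod_otherFunction (b := fun u => u.2.2.1 s.succ) (measurableSet_index_eq s.succ)
        (parentProb m q y s) u
    · exact prod_otherFunction (b := fun u => u.2.2.1 s.succ) (measurableSet_index_eq s.succ)
        (proposalDensity q y s) u

theorem prod_selectedFunction_apply (u : ExtSpace N C X) :
    (∏ t, selectedFunction m q y t).1 u = ((∏ s : Fin n, normalize
      (backwardWeight m q y u.1 u.2.1 (u.1 s.succ (u.2.2.1 s.succ)) s)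
      (u.2.1 s (u.2.2.1 s.succ)) : ℝ≥0) : ℝ≥0∞) := by
  rw [Fin.prod_univ_succ]
  exact (one_mul _).trans (prod_finiteFunction_apply (fun s => measurable_selectedParentProb s) u)

end SelectedLaw

/-! ### The marginal of the extended target -/

section SelectedMarginal

variable {n : ℕ} {N : Fin (n + 1) → ℕ} {C : Fin n → ℕ} {X Y : Type*} [MeasurableSpace X]
  [MeasurableSpace Y] {lam : Measure X} {nu : Measure Y}
  {m : StateSpaceModel n X Y lam nu} {q : ImportanceDensities n X Y lam} {y : Fin (n + 1) → Y}
  {K : TransitionKernels N X} [∀ s b, IsMarkovKernel (K s b)]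

theorem commute_selectedOp_parentsOp [SFinite lam] (t : Fin (n + 1)) (s : Fin n) :
    Commute (selectedOp (N := N) (C := C) lam t) (parentsOp s) := by
  refine commute_list_prod fun i _ => ?_
  cases t using Fin.lastCases with
  | last =>
    rw [selectedOp_last]
    exact commute_assignOp (fun _ _ _ => rfl) (fun _ _ => rfl) fun _ _ => rfl
  | cast r =>
    rw [selectedOp_castSucc]
    exact commute_assignOp (fun u z k => (setPath_setParent_comm u k z).symm)
      (fun _ _ => rfl) fun _ _ => rfl

/-- Integrals of functions of the selected trajectory and of the selected indices. -/
theorem eval_prod_stepOp_reversedSteps [SigmaFinite lam] [Nonempty X] [∀ s, NeZero (C s)]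
    [∀ t, NeZero (N t)] (hq : q.Positive)
    {G : (Fin (n + 1) → X) × Indices N → ℝ≥0∞} (hG : Measurable G)
    {F : measurableFunctions (ExtSpace N C X)} (hF : ∀ u, F.1 u = G (selected u, u.2.2.1))
    {g : Fin (N (Fin.last n)) → ℝ≥0∞}
    (hg : ∀ b, ∫⁻ w, G (w, b) ∂(Measure.pi fun _ => lam) = g (b (Fin.last n)))
    (u₀ : ExtSpace N C X) :
    ((reversedSteps (N := N) (C := C) lam K).map stepOp).prod.eval
        (F * ∏ t, conditionalFunction m q y t * selectedFunction m q y t) u₀ =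
      (∏ s : Fin n, (N s.castSucc : ℝ≥0∞)) * ∑ k, g k := by
  have h1 := commute_weigh_selected (K := K) (lam := lam) (d := F) fun u v h h' => by
    rw [hF, hF, h, h']
  have h2 : Commute ((List.finRange (n + 1)).map fun t => selectedOp (N := N) (C := C) lam t).prod
      (((List.finRange n).map fun s => parentsOp s).prod *
        ((List.finRange (n + 1)).map fun t => otherStatesOp lam t).prod) :=
    Commute.mul_right
      (list_prod_commute_list_prod fun t _ s _ => commute_selectedOp_parentsOp t s)
      (list_prod_commute_list_prod fun t _ t' _ => (commute_otherStatesOp_selectedOp t' t).symm)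
  have h3 := conditional_mem_fixOne (C := C) (lam := lam) (m := m) (y := y) (K := K) hq
  set H := ∏ t, conditionalFunction (N := N) (C := C) m q y t * selectedFunction m q y t
  rw [prod_stepOp_reversedSteps]
  set B := ((List.finRange (n + 1)).map fun t => indexOp (N := N) (C := C) (X := X) t).prod with hB
  set S := ((List.finRange (n + 1)).map fun t => selectedOp (N := N) (C := C) lam t).prod with hS
  generalize ((List.finRange n).map fun s => parentsOp (N := N) (C := C) (X := X) s).prod = O₁ at *
  generalize ((List.finRange (n + 1)).map fun t => otherStatesOp (N := N) (C := C) lam t).prod = O₂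
    at *
  generalize ((List.finRange n).map fun s => reverseRunOp (N := N) (C := C) K s).prod = O₃ at *
  -- Disintegration: the indices and the trajectory outside, the conditional law of everything else
  -- inside. The inner factor has mass one and disappears.
  have e : B * O₁ * O₂ * S * O₃ * weigh F * weigh H =
      B * (S * weigh F) * (O₁ * O₂ * O₃ * weigh H) := by
    calc B * O₁ * O₂ * S * O₃ * weigh F * weigh H
        = B * (O₁ * O₂ * S) * O₃ * weigh F * weigh H := by simp only [mul_assoc]
      _ = B * S * (O₁ * O₂ * O₃ * weigh F) * weigh H := by rw [← h2.eq]; simp only [mul_assoc]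
      _ = _ := by rw [← h1.eq]; simp only [mul_assoc]
  have h4 : (B * O₁ * O₂ * S * O₃).eval (F * H) u₀ =
      (B * O₁ * O₂ * S * O₃ * weigh F * weigh H).eval 1 u₀ := by
    rw [mul_assoc _ (weigh F), ← map_mul, Op.eval_mul]
    exact congrArg (fun D => (B * O₁ * O₂ * S * O₃).eval D u₀) (mul_one (F * H)).symm
  have h5 : (B * (S * weigh F) * (O₁ * O₂ * O₃ * weigh H)).eval 1 u₀ = B.eval (S.apply F) u₀ := by
    rw [Op.eval_mul, show (O₁ * O₂ * O₃ * weigh H).apply 1 = 1 from h3, Op.eval_mul]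
    exact congrArg (fun D => B.eval (S.apply D) u₀) (mul_one F)
  rw [h4, e, h5, hB]
  refine eval_prod_indexOp (fun u => ?_) u₀
  exact (eval_prod_selectedOp hG hF u).trans (hg _)

theorem lintegral_uniformOn_univ {k : ℕ} (f : Fin k → ℝ≥0∞) :
    ∫⁻ i, f i ∂(uniformOn (Set.univ : Set (Fin k))) = (k : ℝ≥0∞)⁻¹ * ∑ i, f i := by
  rw [uniformOn, ProbabilityTheory.cond, Measure.restrict_univ, lintegral_smul_measure, lintegral_count, tsum_fintype,
    Measure.count_univ, ENat.card_eq_coe_fintype_card, Fintype.card_fin]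
  rfl

/-- The density of the extended target factors into a function of the trajectory and the final index
and a normalised conditional density. Reversed runs preserve mass for any Markov kernels, so
detailed balance plays no role here. -/
theorem map_selected_extendedTarget [SigmaFinite lam] [Nonempty X] [∀ s, NeZero (C s)]
    [∀ t, NeZero (N t)] (hq : q.Positive) (u₀ : ExtSpace N C X) :
    (extendedTarget m q y K u₀).map (fun u => (selected u, u.2.2.1 (Fin.last n))) =
      ((Measure.pi fun _ : Fin (n + 1) => lam).withDensity (posteriorDensity m y)).prod
        (uniformOn (Set.univ : Set (Fin (N (Fin.last n))))) := by
  have hmap : Measurable fun u : ExtSpace N C X => (selected u, u.2.2.1 (Fin.last n)) :=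
    measurable_selected_pi.prodMk (measurable_index _)
  have hpost := measurable_posteriorDensity m y
  refine Measure.ext_of_lintegral _ fun φ hφ => ?_
  have hφ' : ∀ k, Measurable fun w => φ (w, k) := fun k => hφ.comp measurable_prodMk_right
  set c : ℝ≥0∞ := (N (Fin.last n) : ℝ≥0∞)⁻¹ * ∏ s : Fin n, (N s.castSucc : ℝ≥0∞)⁻¹ with hc
  let G : (Fin (n + 1) → X) × Indices N → ℝ≥0∞ := fun p =>
    c * (posteriorDensity m y p.1 * φ (p.1, p.2 (Fin.last n)))
  have hG : Measurable G := ((hpost.comp measurable_fst).mul (hφ.comp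
    (measurable_fst.prodMk ((measurable_pi_apply (Fin.last n)).comp measurable_snd)))).const_mul c
  let F : measurableFunctions (ExtSpace N C X) :=
    ⟨fun u => G (selected u, u.2.2.1), show Measurable fun u : ExtSpace N C X =>
      G (selected u, u.2.2.1) from
      hG.comp (measurable_selected_pi.prodMk (measurable_snd.snd.fst))⟩
  let φ' : measurableFunctions (ExtSpace N C X) :=
    ⟨fun u => φ (selected u, u.2.2.1 (Fin.last n)), show Measurable _ from hφ.comp hmap⟩
  have hfac : extendedFunction m q y * φ' =
      F * ∏ t, conditionalFunction m q y t * selectedFunction m q y t := by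
    refine Subtype.ext (funext fun u => ?_)
    change extendedDensity m q y u * φ (selected u, u.2.2.1 (Fin.last n)) =
      G (selected u, u.2.2.1) * (∏ t, conditionalFunction m q y t * selectedFunction m q y t).1 u
    rw [Finset.prod_mul_distrib, Submonoid.coe_mul, Pi.mul_apply,
      ← filterDensity_div_selectedFilterDensity hq, prod_selectedFunction_apply, extendedDensity]
    simp only [G, hc]
    ring
  rw [lintegral_map hφ hmap, extendedTarget, lintegral_withDensity_eq_lintegral_mul _
    measurable_extendedDensity (g := fun u => φ (selected u, u.2.2.1 (Fin.last n)))
    (hφ.comp hmap)]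
  refine (lintegral_run_dirac (measurable_reversedSteps (lam := lam) (K := K))
    (extendedFunction m q y * φ') u₀).trans ?_
  rw [hfac, eval_prod_stepOp_reversedSteps hq hG (fun _ => rfl)
    (g := fun k => c * ∫⁻ w, posteriorDensity m y w * φ (w, k) ∂(Measure.pi fun _ => lam))
    (fun b => lintegral_const_mul _ (hpost.mul (hφ' _))), lintegral_prod_symm' _ hφ,
    lintegral_uniformOn_univ, ← Finset.mul_sum, ← mul_assoc]
  -- The sums over the non-final indices cancel their factors `1 / N t`; what remains is the uniform
  -- weight of the final index.
  have hcN : (∏ s : Fin n, (N s.castSucc : ℝ≥0∞)) * c = (N (Fin.last n) : ℝ≥0∞)⁻¹ := by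
    rw [hc, mul_left_comm, ← Finset.prod_mul_distrib, Finset.prod_eq_one, mul_one]
    exact fun s _ => ENNReal.mul_inv_cancel (Nat.cast_ne_zero.2 (NeZero.ne _))
      (ENNReal.natCast_ne_top _)
  rw [hcN]
  congr 1
  refine Finset.sum_congr rfl fun k _ => ?_
  rw [lintegral_withDensity_eq_lintegral_mul _ hpost (hφ' k)]
  rfl

end SelectedMarginal

end PMCMC

end

/-! ### Assembly of the three assertions -/

theorem mainTheorem1 {X Y Θ : Type*} [MeasurableSpace X] [MeasurableSpace Y]
    (lam : Measure X) [SigmaFinite lam] (nu : Measure Y)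
    (n : ℕ) (N : Fin (n + 1) → ℕ) (hN : ∀ t, 1 ≤ N t) (C : Fin n → ℕ) (hC : ∀ s, 1 ≤ C s)
    (y : Fin (n + 1) → Y)
    (m : Θ → StateSpaceModel n X Y lam nu) (q : Θ → ImportanceDensities n X Y lam)
    (K : Θ → TransitionKernels N X) [∀ θ s b, IsMarkovKernel (K θ s b)]
    (hy : ∀ θ, evidence (m θ) y ≠ ∞)
    (hpos : ∀ θ, (q θ).Positive)
    (hbal : ∀ θ, DetailedBalance (m θ) (q θ) y (K θ))
    (θ : Θ) (u₀ : ExtSpace N C X) :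
    (extendedTarget (m θ) (q θ) y (K θ) u₀).map
        (fun u => (selected u, u.2.2.1 (Fin.last n))) =
      ((Measure.pi fun _ : Fin (n + 1) => lam).withDensity (posteriorDensity (m θ) y)).prod
        (uniformOn (Set.univ : Set (Fin (N (Fin.last n))))) ∧
    (extendedTarget (m θ) (q θ) y (K θ) u₀ ≪ proposalLaw (m θ) (q θ) y (K θ) u₀ ∧
      proposalLaw (m θ) (q θ) y (K θ) u₀ ≪ extendedTarget (m θ) (q θ) y (K θ) u₀) ∧
    extendedTarget (m θ) (q θ) y (K θ) u₀ =
      (proposalLaw (m θ) (q θ) y (K θ) u₀).withDensity (densityRatio (m θ) (q θ) y) ∧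
    (extendedTarget (m θ) (q θ) y (K θ) u₀).rnDeriv (proposalLaw (m θ) (q θ) y (K θ) u₀)
      =ᵐ[proposalLaw (m θ) (q θ) y (K θ) u₀] densityRatio (m θ) (q θ) y := by
  have : ∀ t, NeZero (N t) := fun t => ⟨Nat.one_le_iff_ne_zero.1 (hN t)⟩
  have : ∀ s, NeZero (C s) := fun s => ⟨Nat.one_le_iff_ne_zero.1 (hC s)⟩
  have : Nonempty X := (m θ).nonempty
  -- Provides the σ-finiteness under which the density is a version of the Radon–Nikodym derivative.
  have hprob := isProbabilityMeasure_proposalLaw (m := m θ) (y := y) (K := K θ) (hpos θ) u₀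
  have hden := extendedTarget_eq_withDensity (hpos θ) (hy θ) (hbal θ) u₀
  have hratio : Measurable fun u : ExtSpace N C X => densityRatio (m θ) (q θ) y u :=
    measurable_densityRatio
  refine ⟨map_selected_extendedTarget (hpos θ) u₀, ⟨?_, ?_⟩, hden, ?_⟩
  · rw [hden]
    exact withDensity_absolutelyContinuous _ _
  · rw [hden]
    exact withDensity_absolutelyContinuous' hratio.aemeasurable
      (.of_forall fun u => densityRatio_ne_zero (hpos θ) (hy θ) u)
  · rw [hden]
    exact Measure.rnDeriv_withDensity _ hratio
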